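/- **Lemma 6.6.** There are universal constants $c,K>0$ such that the following holds. Let $f\in C^1(\mathbb R^d)$ with $\int e^{-f}<\infty$, let $p\propto e^{-f}$ be the corresponding probability measure, and let $(P_t)_{t\ge 0}$ be the transition kernels of the Langevin diffusion $dX_t=-\nabla f(X_t)\,dt+\sqrt2\,dW_t$, i.e. of the semigroup $e^{t\mathscr L}$ on $L^2(p)$ where $-\mathscr L$ is the self-adjoint operator of the closure of the Dirichlet form $\mathcal E_p(g)=\int\|\nabla g\|^2\,dp$ on $C_c^\infty(\mathbb R^d)$. Write $\lambda_k$ for the $k$-th eigenvalue, with multiplicity, in the Courant–Fischer (min–max) sense. Let $C>0$, $\mu\le 1$ and $n\in\mathbb N$ be such that $\lambda_{n+1}(-\mathscr L)\ge \frac1C$, and such that a Poincaré inequality with constant $2C$ holds on sets of measure at most $\mu$: $\mathcal E_p(g)\ge\frac1{2C}\operatorname{Var}_p(g)$ for every $g\in C_c^\infty(\mathbb R^d)$ with $p(\operatorname{supp} g)\le\mu$. Let $0<T\le \frac C2$, and let $\{A_1,\dots,A_m\}$ be a partition of a measurable set $B\subseteq\mathbb R^d$ into measurable sets with $p(A_j)>0$.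 Let $P_T|_B(x,S)=P_T(x,S)+\mathbf 1_S(x)P_T(x,B^c)$ be the restriction of the chain $P_T$ to $B$, with stationary distribution $p|_B=p(\cdot\cap B)/p(B)$, and let $\overline{P_T|_B}(i,j)=\frac1{p(A_i)}\int_{A_i}P_T|_B(x,A_j)\,dp(x)$ be the projected chain on $[m]$, with stationary distribution $\pi(j)=p(A_j)/p(B)$. Suppose that 1. $P_T(x,B^c)\le\frac{T}{1000C}$ for all $x\in B$; 2. $\lambda_{n+1}(I-P_T|_B)\ge\frac34\left(\lambda_{n+1}(I-P_T)-\frac{T}{6C}\right)$, where the operators act on $L^2(p|_B)$ and $L^2(p)$ respectively. Then there are $\ell\le n$ and a partition of $[m]$ into $\ell$ nonempty sets $J_1,\dots,J_\ell$ such that: 1. $J_1,\dots,J_\ell$ is a $\left(c\,\frac{T^2}{C^2\min\{n,m\}^8},\;K\,\frac TC\right)$-clustering of the chain $\overline{P_T|_B}$; 2. $p\left(\bigcup_{j\in J_i}A_j\right)\ge\frac\mu2$ for every $i$. Here, for a finite chain $M$ with stationary distribution $\pi$, $\phi_M(S)=\frac{1}{\pi(S)}\sum_{x\in S,\,y\notin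 S}\pi(x)M(x,y)$, and $\Phi(M)$ is the minimum of $\phi_M(S)$ over nonempty $S$ with $\pi(S)\le\frac12$ ($+\infty$ if there is no such $S$). The restriction of $M$ to $J$ is $M|_J(x,y)=M(x,y)+\mathbf 1_{x=y}\sum_{z\notin J}M(x,z)$ on $J$, with stationary distribution $\pi(\cdot)/\pi(J)$. Disjoint sets $J_1,\dots,J_\ell$ form a $(\phi_{\rm in},\phi_{\rm out})$-clustering of $M$ if $\Phi(M|_{J_i})\ge\phi_{\rm in}$ and $\phi_M(J_i)\le\phi_{\rm out}$ for every $i$. -/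

import Mathlib

open MeasureTheory ProbabilityTheory
open scoped ContDiff

noncomputable section

namespace LangevinCluster

/-- The state space `ℝᵈ` with the Euclidean norm. -/
abbrev Space (d : ℕ) : Type := EuclideanSpace ℝ (Fin d)

/-- The probability measure with density proportional to `exp (-f)`; it is only used when
`exp (-f)` is integrable. -/
def gibbs {d : ℕ} (f : Space d → ℝ) : Measure (Space d) :=
  (volume : Measure (Space d)).tilted (fun x => -f x)

/-- Test functions: smooth with compact support. -/
def IsTest {d : ℕ} {F : Type*} [NormedAddCommGroup F] [NormedSpace ℝ F]
    (g : Space d → F) : Prop :=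
  ContDiff ℝ ∞ g ∧ HasCompactSupport g

/-- The Dirichlet form `𝓔_p(g) = ∫ ‖∇ g‖² dp` of the Langevin diffusion, for real test
functions `g`. -/
def dirichlet {d : ℕ} (p : Measure (Space d)) (g : Space d → ℝ) : ℝ :=
  ∫ x, ‖gradient g x‖ ^ 2 ∂p

/-! ### The Langevin semigroup

The Langevin diffusion `dX = -∇f(X) dt + √2 dW` is the reversible diffusion whose generator
`𝓛` is the self-adjoint operator on `L²(p)` attached to the closure of the form
`∫ ⟨∇g, ∇h⟩ dp` on test functions (on test functions `𝓛 g = Δ g - ⟨∇f, ∇g⟩`, when `f` is `C²`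
say).  Its transition semigroup is `exp (t 𝓛)`.  Complex scalars are used so that the
continuous functional calculus applies. -/

/-- `L²(p)` with complex values. -/
abbrev L2 {d : ℕ} (p : Measure (Space d)) : Type := Lp ℂ 2 p

/-- Square integrable complex vector fields. -/
abbrev L2Field {d : ℕ} (p : Measure (Space d)) : Type := Lp (EuclideanSpace ℂ (Fin d)) 2 p

/-- The gradient `(∂₁ g, …, ∂_d g)` of a complex-valued function. -/
def complexGradient {d : ℕ} (g : Space d → ℂ) (x : Space d) : EuclideanSpace ℂ (Fin d) :=
  WithLp.toLp 2 fun i => fderiv ℝ g x (EuclideanSpace.single i 1)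

/-- The form domain, as the graph of the closed gradient: the closure in
`L²(p) × L²(p; ℂᵈ)` of the pairs `(g, ∇ g)` with `g` a test function.  The norm it inherits
is `‖g‖² + ‖∇ g‖²`. -/
def formDomain {d : ℕ} (p : Measure (Space d)) :
    Submodule ℂ (WithLp 2 (L2 p × L2Field p)) :=
  (Submodule.span ℂ {w | ∃ g : Space d → ℂ, IsTest g ∧
    (w.fst : Space d → ℂ) =ᵐ[p] g ∧
    (w.snd : Space d → EuclideanSpace ℂ (Fin d)) =ᵐ[p] complexGradient g}).topologicalClosure

instance {d : ℕ} (p : Measure (Space d)) : CompleteSpace (formDomain p) :=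
  (Submodule.isClosed_topologicalClosure _).completeSpace_coe

/-- The inclusion `ι` of the form domain into `L²(p)`. -/
def formInclusion {d : ℕ} (p : Measure (Space d)) : formDomain p →L[ℂ] L2 p :=
  (WithLp.fstL 2 ℂ (L2 p) (L2Field p)).comp (formDomain p).subtypeL

/-- The resolvent `(1 - 𝓛)⁻¹ = ι ι†` on `L²(p)`: for `h` in `L²(p)`, `u = ι† h` is the unique
element of the form domain with `⟨v, u⟩ + ⟨∇v, ∇u⟩ = ⟨v, h⟩` for all `v` in the form domain. -/
def resolvent {d : ℕ} (p : Measure (Space d)) : L2 p →L[ℂ] L2 p :=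
  (formInclusion p).comp (ContinuousLinearMap.adjoint (formInclusion p))

/-- `semigroupFun t r = exp (-t (1/r - 1))` for `0 < r`, extended by `0`.  An eigenvalue
`r = 1 / (1 + a)` of the resolvent belongs to the eigenvalue `a` of `-𝓛`, and
`semigroupFun t r = exp (-t a)`. -/
def semigroupFun (t r : ℝ) : ℝ := if 0 < r then Real.exp (-t * (1 / r - 1)) else 0

/-- The operator `exp (t 𝓛)`, for `0 < t`, of the semigroup whose generator `𝓛 ≤ 0` has the
resolvent `R = (1 - 𝓛)⁻¹`, by the continuous functional calculus. -/
def semigroupOfResolvent {H : Type*} [NormedAddCommGroup H] [InnerProductSpace ℂ H]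
    [CompleteSpace H] (R : H →L[ℂ] H) (t : ℝ) : H →L[ℂ] H :=
  cfc (semigroupFun t) R

/-- The operator `exp (t 𝓛)` of the Langevin semigroup on `L²(p)`, for `0 < t`. -/
def langevinOperator {d : ℕ} (p : Measure (Space d)) (t : ℝ) : L2 p →L[ℂ] L2 p :=
  semigroupOfResolvent (resolvent p) t

/-- `P t x S` is the probability that the Langevin diffusion for `f` started at `x` is in `S`
at time `t`: the `P t` are Markov kernels which represent `exp (t 𝓛)`, i.e.
`P t x S = (exp (t 𝓛) 1_S) (x)`.  (Identities in `L²(p)` determine the kernel `P t x` for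
`p`-almost every `x`; every version is allowed.) -/
def IsLangevinChain {d : ℕ} (f : Space d → ℝ) (P : ℝ → Kernel (Space d) (Space d)) : Prop :=
  ∀ t : ℝ, 0 < t → IsMarkovKernel (P t) ∧
    ∀ S : Set (Space d), MeasurableSet S → ∀ h : L2 (gibbs f),
      (h : Space d → ℂ) =ᵐ[gibbs f] S.indicator (fun _ => (1 : ℂ)) →
      (langevinOperator (gibbs f) t h : Space d → ℂ) =ᵐ[gibbs f]
        fun x => (((P t x).real S : ℝ) : ℂ)

/-- The `k`-th eigenvalue `λ_k(-𝓛)` of the Langevin generator (`k ≥ 1`, counted with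
multiplicity), by the Courant-Fischer formula: the infimum over `k`-dimensional spaces of test
functions, which are a core of the closed form, of the maximal Rayleigh quotient. -/
def generatorEigenvalue {d : ℕ} (f : Space d → ℝ) (k : ℕ) : EReal :=
  ⨅ (V : Submodule ℝ (Space d → ℝ)) (_ : ∀ g ∈ V, IsTest g) (_ : Module.finrank ℝ V = k),
    ⨆ (g : Space d → ℝ) (_ : g ∈ V) (_ : g ≠ 0),
      ((dirichlet (gibbs f) g / ∫ x, g x ^ 2 ∂(gibbs f) : ℝ) : EReal)

/-- A Poincaré inequality with constant `K` holds on sets of measure at most `D`. -/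
def PoincareOnSmallSets {d : ℕ} (p : Measure (Space d)) (K D : ℝ) : Prop :=
  ∀ g : Space d → ℝ, IsTest g → p.real (tsupport g) ≤ D →
    1 / K * variance g p ≤ dirichlet p g

/-! ### Markov chains given by a kernel and a stationary distribution -/

section Chains

variable {Ω : Type*} [MeasurableSpace Ω]

/-- The `k`-th eigenvalue `λ_k(I - κ)` (`k ≥ 1`, with multiplicity) of a chain `κ` that is
reversible with respect to `π`, as an operator on `L²(π)`, by the Courant-Fischer formula. -/
def chainEigenvalue (κ : Kernel Ω Ω) (π : Measure Ω) (k : ℕ) : EReal :=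
  ⨅ (V : Submodule ℝ (Lp ℝ 2 π)) (_ : Module.finrank ℝ V = k),
    ⨆ (g : Lp ℝ 2 π) (_ : g ∈ V) (_ : g ≠ 0),
      (((∫ x, g x * (g x - ∫ y, g y ∂(κ x)) ∂π) / ‖g‖ ^ 2 : ℝ) : EReal)

/-- The restriction of a chain to `B`: moves that would leave `B` are rejected,
`κ|_B (x, S) = κ (x, S) + 1_S(x) κ (x, Bᶜ)` for `x ∈ B` and `S ⊆ B`.  Its stationary
distribution is the stationary distribution of `κ` conditioned on `B`. -/
def restrictKernel (κ : Kernel Ω Ω) {B : Set Ω} (hB : MeasurableSet B) : Kernel Ω Ω where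
  toFun x := (κ x).restrict B + κ x Bᶜ • Measure.dirac x
  measurable' := by
    refine Measure.measurable_of_measurable_coe _ fun S hS => ?_
    have h1 : Measurable fun x => κ x (S ∩ B) := κ.measurable_coe (hS.inter hB)
    have h2 : Measurable fun x => κ x Bᶜ := κ.measurable_coe hB.compl
    have h3 : Measurable (S.indicator (1 : Ω → ENNReal)) := measurable_one.indicator hS
    have h4 : Measurable fun x => κ x (S ∩ B) + κ x Bᶜ * S.indicator (1 : Ω → ENNReal) x :=
      h1.add (h2.mul h3)
    simpa [Measure.restrict_apply hS, Measure.dirac_apply' _ hS] using h4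

/-- The transition matrix of the projection of the chain `κ`, with stationary distribution `π`,
to the partition `A`: the entry `(i, j)` is `1 / π(A_i) * ∫_{A_i} κ(x, A_j) dπ(x)`. -/
def projMatrix (κ : Kernel Ω Ω) (π : Measure Ω) {m : ℕ} (A : Fin m → Set Ω)
    (i j : Fin m) : ℝ :=
  1 / π.real (A i) * ∫ x in A i, (κ x).real (A j) ∂π

end Chains

/-! ### Finite chains: conductance and clustering -/

section Finite

variable {ι : Type*} [Fintype ι] [DecidableEq ι]

/-- `φ(S) = Q(S, Sᶜ) / π(S)` with `Q(x, y) = π(x) M(x, y)`. -/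
def conductance (M : ι → ι → ℝ) (π : ι → ℝ) (S : Finset ι) : ℝ :=
  (∑ x ∈ S, ∑ y ∈ Sᶜ, π x * M x y) / ∑ x ∈ S, π x

/-- The Cheeger constant: the minimum of `φ(S)` over nonempty `S` with `π(S) ≤ 1/2`
(equal to `⊤` when there is no such `S`, as for a chain with one state). -/
def cheeger (M : ι → ι → ℝ) (π : ι → ℝ) : EReal :=
  ⨅ (S : Finset ι) (_ : S.Nonempty) (_ : ∑ x ∈ S, π x ≤ 1 / 2),
    ((conductance M π S : ℝ) : EReal)

/-- Transition matrix of the restriction of a finite chain to `J`. -/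
def restrictMatrix (M : ι → ι → ℝ) (J : Finset ι) (x y : J) : ℝ :=
  M x y + if x = y then ∑ z ∈ Jᶜ, M x z else 0

/-- Stationary distribution of the restriction of a finite chain to `J`. -/
def restrictWeight (π : ι → ℝ) (J : Finset ι) (x : J) : ℝ :=
  π x / ∑ y ∈ J, π y

/-- The sets in `𝒥` form a `(φin, φout)`-clustering of the chain `M` with stationary
distribution `π`. -/
def IsClustering (M : ι → ι → ℝ) (π : ι → ℝ) (𝒥 : Finset (Finset ι)) (φin φout : ℝ) : Prop :=
  (𝒥 : Set (Finset ι)).PairwiseDisjoint id ∧ ∀ J ∈ 𝒥,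
    (φin : EReal) ≤ cheeger (restrictMatrix M J) (restrictWeight π J) ∧
    conductance M π J ≤ φout

end Finite

end LangevinCluster

end

open MeasureTheory ProbabilityTheory
open scoped ContDiff

set_option linter.unusedSectionVars false

noncomputable section

namespace LangevinCluster

/-! The projected chain is a weighted graph on the cells, with the ergodic flow as edge weights. The
clusters come from a purely combinatorial statement, `exists_finpartition_expanders`: for k = min n
m, if no k+1 disjoint sets have conductance at most σ(k+1), then the vertices split into at most k
sets of outer conductance at most σk² and inner conductance at least σ/(8k). Pick ℓ such that ℓ
disjoint sets of conductance at most σℓ exist but ℓ+1 of conductance at most σ(ℓ+1) do not. Among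
these families take cores of least total mass, and extend them to a partition of least cut.
Maximality of ℓ forbids two disjoint sparse sets in one class, minimal mass forbids sparse proper
parts of a core, and minimal cut bounds the edges leaving the class by those staying in it. Together
these make the classes sparse and expanding.

Many sparse sets are excluded by cardinality if m ≤ n. Otherwise the easy direction of the
higher-order Cheeger inequality (`chainEigenvalue_le_of_isSparseFamily`) turns n+1 sparse sets into
an (n+1)-dimensional space of step functions with Rayleigh quotients at most 2σ(n+1), below the
lower bound 3T/(8C) for the restricted eigenvalue. That bound rests on λ_{n+1}(I - P_T) ≥ 1 -
exp(-T/C), which has to be derived from min-max values over test functions, without assuming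
discrete spectrum. A space on which exp(T𝓛) has large Rayleigh quotients is mapped by a high power
of the resolvent to a space with generator Rayleigh quotients uniformly below 1/C, and then
approximated by real test functions (`exists_test_rayleigh_le`).

The mass bound is a statement about small sets: by `PoincareOnSmallSets.le_escape`, one step from a
set of measure at most μ/2 leaves it with probability at least T/(200C). Otherwise its indicator
would be L²-close to a test function of small energy. Cutting that function off at height 1/2 gives
it small support without raising its energy, contradicting the Poincaré inequality. A cluster loses
at most T/(500C) to other clusters and T/(1000C) to the complement of B, so it cannot be that small.
-/

/-! ### Partitioning a finite weighted graph into expanders -/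

section Graph

variable {ι : Type*}

/-- The total weight of the edges from `S` to `T`. -/
def flow (w : ι → ι → ℝ) (S T : Finset ι) : ℝ := ∑ x ∈ S, ∑ y ∈ T, w x y

/-- The mass of a set of vertices. -/
def mass (π : ι → ℝ) (S : Finset ι) : ℝ := ∑ x ∈ S, π x

theorem flow_comm {w : ι → ι → ℝ} (hs : ∀ x y, w x y = w y x) (S T : Finset ι) :
    flow w S T = flow w T S := by
  unfold flow
  rw [Finset.sum_comm]
  exact Finset.sum_congr rfl fun x _ => Finset.sum_congr rfl fun y _ => hs y x

theorem flow_nonneg {w : ι → ι → ℝ} (hw : ∀ x y, 0 ≤ w x y) (S T : Finset ι) :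
    0 ≤ flow w S T := Finset.sum_nonneg fun x _ => Finset.sum_nonneg fun y _ => hw x y

theorem flow_mono {w : ι → ι → ℝ} (hw : ∀ x y, 0 ≤ w x y) {S S' T T' : Finset ι}
    (hS : S ⊆ S') (hT : T ⊆ T') : flow w S T ≤ flow w S' T' := by
  unfold flow
  refine (Finset.sum_le_sum fun x _ => Finset.sum_le_sum_of_subset_of_nonneg hT
    fun y _ _ => hw x y).trans ?_
  exact Finset.sum_le_sum_of_subset_of_nonneg hS fun x _ _ =>
    Finset.sum_nonneg fun y _ => hw x y

theorem mass_pos {π : ι → ℝ} (hπ : ∀ x, 0 < π x) {S : Finset ι} (h : S.Nonempty) :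
    0 < mass π S := Finset.sum_pos (fun x _ => hπ x) h

theorem mass_nonneg {π : ι → ℝ} (hπ : ∀ x, 0 < π x) (S : Finset ι) :
    0 ≤ mass π S := Finset.sum_nonneg (fun x _ => (hπ x).le)

variable [DecidableEq ι]

theorem flow_union_left {w : ι → ι → ℝ} {S T : Finset ι} (U : Finset ι) (h : Disjoint S T) :
    flow w (S ∪ T) U = flow w S U + flow w T U := Finset.sum_union h

theorem flow_union_right {w : ι → ι → ℝ} {T U : Finset ι} (S : Finset ι) (h : Disjoint T U) :
    flow w S (T ∪ U) = flow w S T + flow w S U := by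
  simp [flow, Finset.sum_union h, Finset.sum_add_distrib]

theorem mass_union {π : ι → ℝ} {S T : Finset ι} (h : Disjoint S T) :
    mass π (S ∪ T) = mass π S + mass π T := Finset.sum_union h

variable [Fintype ι]

/-- `ℓ` disjoint nonempty sets whose conductance is at most `r`. -/
def IsSparseFamily (w : ι → ι → ℝ) (π : ι → ℝ) (r : ℝ) {ℓ : ℕ} (B : Fin ℓ → Finset ι) : Prop :=
  (∀ i, (B i).Nonempty) ∧ (∀ i j, i ≠ j → Disjoint (B i) (B j)) ∧
    ∀ i, flow w (B i) (B i)ᶜ ≤ r * mass π (B i)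

theorem IsSparseFamily.split {w : ι → ι → ℝ} {π : ι → ℝ} (hπ : ∀ x, 0 < π x) {r R : ℝ}
    (hrR : r ≤ R) {ℓ : ℕ} {B : Fin ℓ → Finset ι} (hB : IsSparseFamily w π r B) (i : Fin ℓ)
    {S T : Finset ι} (hS : S.Nonempty) (hT : T.Nonempty) (hST : Disjoint S T)
    (hSB : ∀ j, j ≠ i → Disjoint S (B j)) (hTB : ∀ j, j ≠ i → Disjoint T (B j))
    (hφS : flow w S Sᶜ ≤ R * mass π S) (hφT : flow w T Tᶜ ≤ R * mass π T) :
    ∃ B' : Fin (ℓ + 1) → Finset ι, IsSparseFamily w π R B' := by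
  obtain ⟨h1, h2, h3⟩ := hB
  refine ⟨Fin.cons S (Function.update B i T), ?_, ?_, ?_⟩
  · refine Fin.cases (by simpa using hS) fun j => ?_
    rcases eq_or_ne j i with rfl | h
    · simpa using hT
    · simpa [h] using h1 j
  · have key : ∀ j, Disjoint S (Function.update B i T j) := by
      intro j
      rcases eq_or_ne j i with rfl | h
      · simpa using hST
      · simpa [h] using hSB j h
    refine Fin.cases (Fin.cases (by simp) fun j _ => by simpa using key j) fun j => ?_
    refine Fin.cases (fun _ => by simpa using (key j).symm) fun j' hne => ?_
    have hne' : j ≠ j' := fun h => hne (by rw [h])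
    simp only [Fin.cons_succ]
    rcases eq_or_ne j i with rfl | h
    · rw [Function.update_self, Function.update_of_ne hne'.symm]
      exact hTB _ hne'.symm
    · rw [Function.update_of_ne h]
      rcases eq_or_ne j' i with rfl | h'
      · rw [Function.update_self]
        exact (hTB _ h).symm
      · rw [Function.update_of_ne h']
        exact h2 _ _ hne'
  · refine Fin.cases (by simpa using hφS) fun j => ?_
    simp only [Fin.cons_succ]
    rcases eq_or_ne j i with rfl | h
    · simpa using hφT
    · rw [Function.update_of_ne h]
      exact (h3 j).trans (mul_le_mul_of_nonneg_right hrR (mass_nonneg hπ _))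

theorem IsSparseFamily.replace {w : ι → ι → ℝ} {π : ι → ℝ} {r : ℝ}
    {ℓ : ℕ} {B : Fin ℓ → Finset ι} (hB : IsSparseFamily w π r B) (i : Fin ℓ)
    {T : Finset ι} (hT : T.Nonempty) (hTB : T ⊆ B i)
    (hφT : flow w T Tᶜ ≤ r * mass π T) :
    IsSparseFamily w π r (Function.update B i T) := by
  obtain ⟨h1, h2, h3⟩ := hB
  refine ⟨fun j => ?_, fun j j' hne => ?_, fun j => ?_⟩
  · rcases eq_or_ne j i with rfl | h
    · simpa using hT
    · simpa [h] using h1 j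
  · have hsub : ∀ j, Function.update B i T j ⊆ B j := by
      intro j
      rcases eq_or_ne j i with rfl | h
      · simpa using hTB
      · simp [h]
    exact (h2 j j' hne).mono (hsub j) (hsub j')
  · rcases eq_or_ne j i with rfl | h
    · simpa using hφT
    · simpa [h] using h3 j

/-- The weight of all edges joining different classes of the partition given by `a`. -/
def cutCost (w : ι → ι → ℝ) {ℓ : ℕ} (a : ι → Fin ℓ) : ℝ :=
  ∑ x, ∑ y, if a x = a y then 0 else w x y

/-- The classes of the partition given by `a`. -/
def cell {ℓ : ℕ} (a : ι → Fin ℓ) (i : Fin ℓ) : Finset ι := Finset.univ.filter fun x => a x = i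

theorem mem_cell {ℓ : ℕ} {a : ι → Fin ℓ} {i : Fin ℓ} {x : ι} : x ∈ cell a i ↔ a x = i := by
  simp [cell]

/-- Only pairs joining S to its old or its new class change status. The factor 2 appears because
`cutCost` counts ordered pairs. -/
theorem cutCost_move {w : ι → ι → ℝ} (hs : ∀ x y, w x y = w y x) {ℓ : ℕ} (a : ι → Fin ℓ)
    {i j : Fin ℓ} (hij : j ≠ i) {S : Finset ι} (hS : S ⊆ cell a i) :
    cutCost w (fun x => if x ∈ S then j else a x) =
      cutCost w a + 2 * (flow w S (cell a i \ S) - flow w S (cell a j)) := by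
  have hflow : ∀ U V : Finset ι, flow w U V = ∑ x, ∑ y, if x ∈ U ∧ y ∈ V then w x y else 0 := by
    intro U V
    simp [flow, ite_and]
  have hpt : ∀ x y, (if (if x ∈ S then j else a x) = (if y ∈ S then j else a y) then 0 else w x y) =
      (if a x = a y then 0 else w x y)
      + ((if x ∈ S ∧ y ∈ cell a i \ S then w x y else 0) - (if x ∈ S ∧ y ∈ cell a j then w x y else 0))
      + ((if x ∈ cell a i \ S ∧ y ∈ S then w x y else 0)
        - (if x ∈ cell a j ∧ y ∈ S then w x y else 0)) := by
    intro x y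
    have hax : x ∈ S → a x = i := fun h => mem_cell.1 (hS h)
    have hay : y ∈ S → a y = i := fun h => mem_cell.1 (hS h)
    by_cases hx : x ∈ S <;> by_cases hy : y ∈ S
    · simp [hx, hy, hax hx, hay hy, mem_cell, hij.symm]
    · simp only [hx, hy, hax hx, mem_cell, if_true, if_false, true_and, and_true,
        Finset.mem_sdiff, not_false_eq_true, and_false, not_true_eq_false, sub_zero,
        add_zero]
      by_cases h1 : a y = i
      · simp [h1, hij, hij.symm]
      · by_cases h2 : a y = j
        · simp [h2, hij, hij.symm]
        · simp [h1, h2, Ne.symm h1, Ne.symm h2]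
    · simp only [hx, hy, hay hy, mem_cell, if_true, if_false, and_true,
        Finset.mem_sdiff, not_false_eq_true, and_false, not_true_eq_false, false_and, sub_zero,
        add_zero]
      by_cases h1 : a x = i
      · simp [h1, hij.symm]
      · by_cases h2 : a x = j
        · simp [h2, hij]
        · simp [h1, h2]
    · simp [hx, hy]
  unfold cutCost
  simp only [hpt, Finset.sum_add_distrib, Finset.sum_sub_distrib, ← hflow]
  rw [flow_comm hs (cell a i \ S) S, flow_comm hs (cell a j) S]
  ring

/-- Since S avoids the core, moving it to class j gives another admissible partition, and minimality
says that the cut does not decrease. -/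
theorem flow_cell_le_of_minimal {w : ι → ι → ℝ} (hs : ∀ x y, w x y = w y x) {ℓ : ℕ}
    {B : Fin ℓ → Finset ι} {a : ι → Fin ℓ} (ha : ∀ i, ∀ x ∈ B i, a x = i)
    (hmin : ∀ a' : ι → Fin ℓ, (∀ i, ∀ x ∈ B i, a' x = i) → cutCost w a ≤ cutCost w a')
    {i j : Fin ℓ} (hij : j ≠ i) {S : Finset ι} (hS : S ⊆ cell a i) (hSB : Disjoint S (B i)) :
    flow w S (cell a j) ≤ flow w S (cell a i \ S) := by
  have h := hmin (fun x => if x ∈ S then j else a x) (by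
    intro l x hx
    have hxS : x ∉ S := by
      intro hxS
      have h1 := mem_cell.1 (hS hxS)
      have h2 := ha l x hx
      rw [h1] at h2
      subst h2
      exact Finset.disjoint_left.1 hSB hxS hx
    simp [hxS, ha l x hx])
  rw [cutCost_move hs a hij hS] at h
  linarith

/-- All edges leaving a set in class `i`, outside of the core, are controlled by those that stay
in the class. -/
theorem flow_compl_le_of_minimal {w : ι → ι → ℝ} (hs : ∀ x y, w x y = w y x) {ℓ : ℕ}
    {B : Fin ℓ → Finset ι} {a : ι → Fin ℓ} (ha : ∀ i, ∀ x ∈ B i, a x = i)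
    (hmin : ∀ a' : ι → Fin ℓ, (∀ i, ∀ x ∈ B i, a' x = i) → cutCost w a ≤ cutCost w a')
    {i : Fin ℓ} {S : Finset ι} (hS : S ⊆ cell a i) (hSB : Disjoint S (B i)) :
    flow w S Sᶜ ≤ ℓ * flow w S (cell a i \ S) ∧
      flow w S (cell a i)ᶜ ≤ (ℓ - 1) * flow w S (cell a i \ S) := by
  have hout : flow w S (cell a i)ᶜ ≤ (ℓ - 1) * flow w S (cell a i \ S) := by
    have h1 : (cell a i)ᶜ = (Finset.univ.erase i).biUnion (cell a) := by
      ext x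
      simp [mem_cell]
    have h2 : flow w S (cell a i)ᶜ = ∑ j ∈ Finset.univ.erase i, flow w S (cell a j) := by
      have hcomm : ∑ j ∈ Finset.univ.erase i, flow w S (cell a j) =
          ∑ x ∈ S, ∑ j ∈ Finset.univ.erase i, ∑ y ∈ cell a j, w x y := Finset.sum_comm
      rw [hcomm]
      refine Finset.sum_congr rfl fun x _ => ?_
      rw [h1, Finset.sum_biUnion]
      intro j _ l _ hjl
      refine Finset.disjoint_left.2 fun y hy hy' => hjl ?_
      rw [← mem_cell.1 hy, mem_cell.1 hy']
    rw [h2]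
    have h3 : ∑ j ∈ Finset.univ.erase i, flow w S (cell a j) ≤
        (Finset.univ.erase i).card • flow w S (cell a i \ S) :=
      Finset.sum_le_card_nsmul _ _ _ fun j hj =>
        flow_cell_le_of_minimal hs ha hmin (Finset.ne_of_mem_erase hj) hS hSB
    refine h3.trans ?_
    rw [nsmul_eq_mul, Finset.card_erase_of_mem (Finset.mem_univ _), Finset.card_univ,
      Fintype.card_fin, Nat.cast_sub (Fin.pos i)]
    simp
  refine ⟨?_, hout⟩
  have h3 : Sᶜ = (cell a i)ᶜ ∪ (cell a i \ S) := by
    ext x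
    have := @hS x
    simp only [Finset.mem_compl, Finset.mem_union, Finset.mem_sdiff]
    tauto
  rw [h3, flow_union_right]
  · linarith
  · exact Finset.disjoint_left.2 fun x hx hx' =>
      (Finset.mem_compl.1 hx) (Finset.mem_sdiff.1 hx').1

end Graph

/-! ### Extremal sparse families and their classes. -/

section Graph

variable {ι : Type*} [Fintype ι] [DecidableEq ι]

/-- A family of `ℓ` sparse sets of minimal total mass that cannot be enlarged, together with a
partition extending it whose total cut is minimal. -/
structure IsExtremal (w : ι → ι → ℝ) (π : ι → ℝ) (σ : ℝ) {ℓ : ℕ} (B : Fin ℓ → Finset ι)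
    (a : ι → Fin ℓ) : Prop where
  sparse : IsSparseFamily w π (σ * ℓ) B
  maximal : ¬ ∃ B' : Fin (ℓ + 1) → Finset ι, IsSparseFamily w π (σ * (ℓ + 1)) B'
  minimal : ∀ B' : Fin ℓ → Finset ι, IsSparseFamily w π (σ * ℓ) B' →
    ∑ i, mass π (B i) ≤ ∑ i, mass π (B' i)
  extend : ∀ i, ∀ x ∈ B i, a x = i
  minCut : ∀ a' : ι → Fin ℓ, (∀ i, ∀ x ∈ B i, a' x = i) → cutCost w a ≤ cutCost w a'

/-- The whole vertex set has no outgoing edges, so level 1 is attained, while level k+1 is not. Some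
ℓ in between is attained with ℓ+1 not attained; the two minimizations are over finite sets. The
threshold grows with ℓ, which leaves the slack σ exploited in the contradictions below. -/
theorem exists_isExtremal [Nonempty ι] {w : ι → ι → ℝ} {π : ι → ℝ} (hπ : ∀ x, 0 < π x)
    {σ : ℝ} (hσ : 0 < σ) (k : ℕ)
    (hk : ¬ ∃ B : Fin (k + 1) → Finset ι, IsSparseFamily w π (σ * (k + 1)) B) :
    ∃ ℓ : ℕ, 1 ≤ ℓ ∧ ℓ ≤ k ∧ ∃ (B : Fin ℓ → Finset ι) (a : ι → Fin ℓ), IsExtremal w π σ B a := by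
  set Good : ℕ → Prop := fun ℓ => ∃ B : Fin ℓ → Finset ι, IsSparseFamily w π (σ * ℓ) B
  have h1 : Good 1 := by
    refine ⟨fun _ => Finset.univ, fun _ => Finset.univ_nonempty, fun i j h => ?_, fun _ => ?_⟩
    · exact absurd (Subsingleton.elim i j) h
    · have := mass_nonneg hπ (Finset.univ : Finset ι)
      simp only [flow, Finset.compl_univ, Finset.sum_empty, Finset.sum_const_zero]
      positivity
  have h2 : ∃ ℓ, 1 ≤ ℓ ∧ ℓ ≤ k ∧ Good ℓ ∧ ¬ Good (ℓ + 1) := by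
    by_contra hcon
    push Not at hcon
    have : ∀ ℓ, ℓ ≤ k → Good (ℓ + 1) := by
      intro ℓ
      induction ℓ with
      | zero => intro _; exact h1
      | succ l ih => intro hl; exact hcon (l + 1) (by omega) hl (ih (by omega))
    refine hk ?_
    have := this k le_rfl
    simpa [Good] using this
  obtain ⟨ℓ, hℓ1, hℓk, ⟨B0, hB0⟩, hmax⟩ := h2
  refine ⟨ℓ, hℓ1, hℓk, ?_⟩
  have : Nonempty {B : Fin ℓ → Finset ι // IsSparseFamily w π (σ * ℓ) B} := ⟨⟨B0, hB0⟩⟩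
  obtain ⟨⟨B, hB⟩, hmin⟩ := Finite.exists_min
    (fun B : {B : Fin ℓ → Finset ι // IsSparseFamily w π (σ * ℓ) B} => ∑ i, mass π (B.1 i))
  have : Nonempty {a : ι → Fin ℓ // ∀ i, ∀ x ∈ B i, a x = i} := by
    classical
    refine ⟨⟨fun x => if h : ∃ i, x ∈ B i then h.choose else ⟨0, hℓ1⟩, fun i x hx => ?_⟩⟩
    have h : ∃ i, x ∈ B i := ⟨i, hx⟩
    simp only [h, dif_pos]
    by_contra hne
    exact Finset.disjoint_left.1 (hB.2.1 _ _ hne) h.choose_spec hx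
  obtain ⟨⟨a, ha⟩, hamin⟩ := Finite.exists_min
    (fun a : {a : ι → Fin ℓ // ∀ i, ∀ x ∈ B i, a x = i} => cutCost w a.1)
  refine ⟨B, a, hB, ?_, fun B' hB' => hmin ⟨B', hB'⟩, ha, fun a' ha' => hamin ⟨a', ha'⟩⟩
  simpa [Good] using hmax

namespace IsExtremal

variable {w : ι → ι → ℝ} {π : ι → ℝ} {σ : ℝ} {ℓ : ℕ} {B : Fin ℓ → Finset ι} {a : ι → Fin ℓ}

theorem subset_cell (h : IsExtremal w π σ B a) (i : Fin ℓ) : B i ⊆ cell a i :=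
  fun x hx => mem_cell.2 (h.extend i x hx)

theorem disjoint_of_subset_cell (h : IsExtremal w π σ B a) {i : Fin ℓ} {S : Finset ι}
    (hS : S ⊆ cell a i) (j : Fin ℓ) (hj : j ≠ i) : Disjoint S (B j) :=
  Finset.disjoint_left.2 fun x hx hx' => hj <| by
    rw [← mem_cell.1 (hS hx), h.extend j x hx']

/-- Replacing the core of class i by S and T would produce ℓ+1 disjoint sets at level σ(ℓ+1),
against the choice of ℓ. -/
theorem not_both_sparse (h : IsExtremal w π σ B a) (hπ : ∀ x, 0 < π x) (hσ : 0 < σ) (i : Fin ℓ)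
    {S T : Finset ι} (hS : S.Nonempty) (hT : T.Nonempty) (hST : Disjoint S T)
    (hSi : S ⊆ cell a i) (hTi : T ⊆ cell a i)
    (hφS : flow w S Sᶜ ≤ σ * (ℓ + 1) * mass π S) :
    σ * (ℓ + 1) * mass π T < flow w T Tᶜ := by
  by_contra hφT
  push Not at hφT
  exact h.maximal (h.sparse.split hπ (by nlinarith) i hS hT hST
    (h.disjoint_of_subset_cell hSi) (h.disjoint_of_subset_cell hTi) hφS hφT)

theorem lt_flow_of_disjoint (h : IsExtremal w π σ B a) (hπ : ∀ x, 0 < π x) (hσ : 0 < σ)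
    (i : Fin ℓ) {S : Finset ι} (hS : S.Nonempty) (hSi : S ⊆ cell a i) (hSB : Disjoint S (B i)) :
    σ * (ℓ + 1) * mass π S < flow w S Sᶜ := by
  refine h.not_both_sparse hπ hσ i (h.sparse.1 i) hS hSB.symm (h.subset_cell i) hSi
    ((h.sparse.2.2 i).trans ?_)
  have := mass_nonneg hπ (B i)
  nlinarith

/-- A sparse proper part of a core could replace it and lower the total mass. -/
theorem lt_flow_of_ssubset (h : IsExtremal w π σ B a) (hπ : ∀ x, 0 < π x)
    (i : Fin ℓ) {T : Finset ι} (hT : T.Nonempty) (hTB : T ⊂ B i) :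
    σ * ℓ * mass π T < flow w T Tᶜ := by
  by_contra hφ
  push Not at hφ
  have h1 := h.minimal _ (h.sparse.replace i hT hTB.1 hφ)
  have h2 : ∑ j, mass π (Function.update B i T j) < ∑ j, mass π (B j) := by
    refine Finset.sum_lt_sum (fun j _ => ?_) ⟨i, Finset.mem_univ _, ?_⟩
    · rcases eq_or_ne j i with rfl | hj
      · rw [Function.update_self]
        exact Finset.sum_le_sum_of_subset_of_nonneg hTB.1 fun x _ _ => (hπ x).le
      · simp [hj]
    · rw [Function.update_self]
      obtain ⟨x, hx, hx'⟩ := Finset.exists_of_ssubset hTB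
      exact Finset.sum_lt_sum_of_subset hTB.1 hx hx' (hπ x) fun y _ _ => (hπ y).le
  linarith

/-- The edges leaving the class from outside the core are at most ℓ-1 times those between the core
and the rest of the class. Hence everything leaving the class is at most ℓ times what leaves the
core, which is sparse. -/
theorem flow_cell_compl_le (h : IsExtremal w π σ B a) (hw : ∀ x y, 0 ≤ w x y)
    (hs : ∀ x y, w x y = w y x) (hπ : ∀ x, 0 < π x) (hσ : 0 < σ) (i : Fin ℓ) :
    flow w (cell a i) (cell a i)ᶜ ≤ σ * ℓ ^ 2 * mass π (cell a i) := by
  have hsub := h.subset_cell i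
  have h1 : cell a i = B i ∪ (cell a i \ B i) := by
    rw [Finset.union_sdiff_of_subset hsub]
  have h2 : flow w (cell a i) (cell a i)ᶜ =
      flow w (B i) (cell a i)ᶜ + flow w (cell a i \ B i) (cell a i)ᶜ := by
    rw [← flow_union_left _ Finset.disjoint_sdiff, ← h1]
  have h3 := (flow_compl_le_of_minimal hs h.extend h.minCut (i := i) (S := cell a i \ B i)
    Finset.sdiff_subset Finset.sdiff_disjoint).2
  rw [Finset.sdiff_sdiff_eq_self hsub, flow_comm hs _ (B i)] at h3
  have h4 : flow w (B i) (cell a i)ᶜ + flow w (B i) (cell a i \ B i) = flow w (B i) (B i)ᶜ := by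
    rw [← flow_union_right]
    · congr 1
      ext x
      have := @hsub x
      simp only [Finset.mem_union, Finset.mem_compl, Finset.mem_sdiff]
      tauto
    · exact Finset.disjoint_left.2 fun x hx hx' =>
        (Finset.mem_compl.1 hx) (Finset.mem_sdiff.1 hx').1
  have h5 := h.sparse.2.2 i
  have h6 : mass π (B i) ≤ mass π (cell a i) :=
    Finset.sum_le_sum_of_subset_of_nonneg hsub fun x _ _ => (hπ x).le
  have h7 := flow_nonneg hw (B i) (cell a i)ᶜ
  have h8 := flow_nonneg hw (B i) (cell a i \ B i)
  have hℓ : (1 : ℝ) ≤ ℓ := by exact_mod_cast Fin.pos i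
  have h9 : flow w (cell a i) (cell a i)ᶜ ≤ ℓ * flow w (B i) (B i)ᶜ := by
    rw [h2, ← h4]
    nlinarith
  calc _ ≤ _ := h9
    _ ≤ ℓ * (σ * ℓ * mass π (B i)) := by gcongr
    _ ≤ ℓ * (σ * ℓ * mass π (cell a i)) := by gcongr
    _ = _ := by ring

/-- Splitting the core `B i` in two parts. -/
theorem flow_core (h : IsExtremal w π σ B a) (hs : ∀ x y, w x y = w y x) (i : Fin ℓ)
    {U V : Finset ι} (hUV : Disjoint U V) (hB : U ∪ V = B i) :
    flow w U Uᶜ = flow w U V + flow w U (B i)ᶜ ∧ flow w V Vᶜ = flow w U V + flow w V (B i)ᶜ ∧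
      flow w U (B i)ᶜ + flow w V (B i)ᶜ ≤ σ * ℓ * (mass π U + mass π V) := by
  have hd : ∀ {X : Finset ι}, X ⊆ B i → Disjoint X (B i)ᶜ := fun hX =>
    Finset.disjoint_left.2 fun x hx hx' => Finset.mem_compl.1 hx' (hX hx)
  have hU : U ⊆ B i := hB ▸ Finset.subset_union_left
  have hV : V ⊆ B i := hB ▸ Finset.subset_union_right
  have e1 : Uᶜ = V ∪ (B i)ᶜ := by
    ext x
    have : x ∈ U → x ∉ V := fun hx => Finset.disjoint_left.1 hUV hx
    simp only [← hB, Finset.mem_compl, Finset.mem_union]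
    tauto
  have e2 : Vᶜ = U ∪ (B i)ᶜ := by
    ext x
    have : x ∈ U → x ∉ V := fun hx => Finset.disjoint_left.1 hUV hx
    simp only [← hB, Finset.mem_compl, Finset.mem_union]
    tauto
  refine ⟨?_, ?_, ?_⟩
  · rw [e1, flow_union_right _ (hd hV)]
  · rw [e2, flow_union_right _ (hd hU), flow_comm hs V U]
  · rw [← flow_union_left _ hUV, ← mass_union hUV, hB]
    exact h.sparse.2.2 i

/-- If the cut between U and V is cheap, then U is not much heavier than its core part. Since V ∩ B
i is not sparse while B i is, the flow from U ∩ B i out of the core is at most σℓ times its mass, up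
to the cut. The part of U off the core has large boundary, of which a fraction 1/ℓ stays in the
class; that fraction must end in U ∩ B i or cross the cut. -/
theorem mass_le_of_flow_le (h : IsExtremal w π σ B a) (hw : ∀ x y, 0 ≤ w x y)
    (hs : ∀ x y, w x y = w y x) (hπ : ∀ x, 0 < π x) (hσ : 0 < σ) (i : Fin ℓ)
    {U V : Finset ι} (hUV : Disjoint U V) (hcell : U ∪ V = cell a i)
    (hU : (U ∩ B i).Nonempty) (hV : (V ∩ B i).Nonempty)
    (hf : 8 * ℓ * flow w U V ≤ σ * mass π U) :
    mass π U ≤ (1 + 2 * ℓ) * mass π (U ∩ B i) := by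
  have hℓ : (1 : ℝ) ≤ ℓ := by exact_mod_cast Fin.pos i
  have hsub := h.subset_cell i
  have hUc : U ⊆ cell a i := hcell ▸ Finset.subset_union_left
  have hdisj : Disjoint (U ∩ B i) (V ∩ B i) :=
    hUV.mono Finset.inter_subset_left Finset.inter_subset_left
  have hcore : (U ∩ B i) ∪ (V ∩ B i) = B i := by
    rw [← Finset.union_inter_distrib_right, hcell, Finset.inter_eq_right.2 hsub]
  obtain ⟨-, c2, c3⟩ := h.flow_core hs i hdisj hcore
  have hss : V ∩ B i ⊂ B i := by
    refine Finset.ssubset_iff_subset_ne.2 ⟨Finset.inter_subset_right, fun he => ?_⟩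
    obtain ⟨x, hx⟩ := hU
    have hx2 : x ∈ V ∩ B i := by
      rw [he]
      exact (Finset.mem_inter.1 hx).2
    exact Finset.disjoint_left.1 hdisj hx hx2
  have c4 := h.lt_flow_of_ssubset hπ i hV hss
  have c5 : flow w (U ∩ B i) (V ∩ B i) ≤ flow w U V :=
    flow_mono hw Finset.inter_subset_left Finset.inter_subset_left
  have hmU : mass π U = mass π (U ∩ B i) + mass π (U \ B i) := by
    rw [← mass_union (Finset.disjoint_left.2 fun x hx hx' => (Finset.mem_sdiff.1 hx').2
      (Finset.mem_inter.1 hx).2), Finset.union_comm, Finset.sdiff_union_inter]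
  have c6 : σ * (ℓ + 1) * mass π (U \ B i) ≤
      ℓ * (flow w (U ∩ B i) (B i)ᶜ + flow w U V) := by
    rcases (U \ B i).eq_empty_or_nonempty with he | hne
    · have h1 := flow_nonneg hw (U ∩ B i) (B i)ᶜ
      have h2 := flow_nonneg hw U V
      rw [he]
      simp only [mass, Finset.sum_empty, mul_zero]
      positivity
    · have hZ : U \ B i ⊆ cell a i := Finset.sdiff_subset.trans hUc
      have h1 := h.lt_flow_of_disjoint hπ hσ i hne hZ Finset.sdiff_disjoint
      have h2 := (flow_compl_le_of_minimal hs h.extend h.minCut hZ Finset.sdiff_disjoint).1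
      have h3 : flow w (U \ B i) (cell a i \ (U \ B i)) ≤
          flow w (U ∩ B i) (B i)ᶜ + flow w U V := by
        have e : cell a i \ (U \ B i) = (U ∩ B i) ∪ V := by
          ext x
          have : x ∈ U → x ∉ V := fun hx => Finset.disjoint_left.1 hUV hx
          simp only [← hcell, Finset.mem_sdiff, Finset.mem_union, Finset.mem_inter]
          tauto
        rw [e, flow_union_right _ (hUV.mono_left Finset.inter_subset_left),
          flow_comm hs _ (U ∩ B i)]
        refine add_le_add (flow_mono hw subset_rfl fun x hx => ?_)
          (flow_mono hw Finset.sdiff_subset subset_rfl)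
        exact Finset.mem_compl.2 (Finset.mem_sdiff.1 hx).2
      calc _ ≤ _ := h1.le
        _ ≤ _ := h2
        _ ≤ _ := by gcongr
  have hmB := mass_nonneg hπ (U ∩ B i)
  have hmZ := mass_nonneg hπ (U \ B i)
  have c7 : flow w (U ∩ B i) (B i)ᶜ ≤ σ * ℓ * mass π (U ∩ B i) + flow w U V := by linarith
  have c8 : σ * (ℓ + 1) * mass π (U \ B i) ≤
      ℓ * (σ * ℓ * mass π (U ∩ B i)) + σ / 4 * mass π U := by
    calc _ ≤ _ := c6
      _ ≤ ℓ * (σ * ℓ * mass π (U ∩ B i) + flow w U V + flow w U V) := by gcongr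
      _ = ℓ * (σ * ℓ * mass π (U ∩ B i)) + (8 * ℓ * flow w U V) / 4 := by ring
      _ ≤ _ := by linarith
  rw [hmU] at c8 ⊢
  set u := mass π (U ∩ B i)
  set z := mass π (U \ B i)
  have c9 : σ * ((ℓ + 1) * z) ≤ σ * (ℓ * (ℓ * u) + (u + z) / 4) := by linarith
  have c10 := le_of_mul_le_mul_left c9 hσ
  -- After moving z/4 to the left, the right side is (ℓ² + 1/4)u, which is below (ℓ + 3/4)·2ℓu as ℓ
  -- ≥ 1.
  have c11 : (ℓ + 3 / 4) * z ≤ (ℓ + 3 / 4) * (2 * ℓ * u) := by nlinarith [mul_nonneg hmB (by linarith : (0:ℝ) ≤ ℓ)]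
  have c12 := le_of_mul_le_mul_left c11 (by linarith)
  linarith

/-- The classes are expanders. -/
theorem mass_le_flow (h : IsExtremal w π σ B a) (hw : ∀ x y, 0 ≤ w x y)
    (hs : ∀ x y, w x y = w y x) (hπ : ∀ x, 0 < π x) (hσ : 0 < σ) (i : Fin ℓ)
    {S T : Finset ι} (hST : Disjoint S T) (hcell : S ∪ T = cell a i) (hS : S.Nonempty)
    (hle : mass π S ≤ mass π T) :
    σ * mass π S ≤ 8 * ℓ * flow w S T := by
  by_contra hcon
  push Not at hcon
  have hℓ : (1 : ℝ) ≤ ℓ := by exact_mod_cast Fin.pos i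
  have hmS := mass_pos hπ hS
  have hf := flow_nonneg hw S T
  have hsub := h.subset_cell i
  have hSc : S ⊆ cell a i := hcell ▸ Finset.subset_union_left
  have hTc : T ⊆ cell a i := hcell ▸ Finset.subset_union_right
  have hT : T.Nonempty := by
    rw [Finset.nonempty_iff_ne_empty]
    rintro rfl
    simp only [mass, Finset.sum_empty] at hle hmS
    linarith
  -- Both sides of a cheap cut meet the core: a side U missing it would satisfy σ(ℓ+1)·mass U <
  -- ℓ·flow U V.
  have main : ∀ {U V : Finset ι}, U.Nonempty → U ⊆ cell a i → Disjoint U V →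
      U ∪ V = cell a i → ℓ * flow w U V < σ * mass π U → (U ∩ B i).Nonempty := by
    intro U V hne hUc hUV hc hlt
    rw [Finset.nonempty_iff_ne_empty]
    intro he
    have hd : Disjoint U (B i) := Finset.disjoint_iff_inter_eq_empty.2 he
    have h1 := h.lt_flow_of_disjoint hπ hσ i hne hUc hd
    have h2 := (flow_compl_le_of_minimal hs h.extend h.minCut hUc hd).1
    have h3 : cell a i \ U = V := by rw [← hc, Finset.union_sdiff_cancel_left hUV]
    rw [h3] at h2
    have h4 := mass_pos hπ hne
    nlinarith [mul_pos hσ h4]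
  have hlt1 : ℓ * flow w S T < σ * mass π S := by nlinarith
  have hlt2 : ℓ * flow w T S < σ * mass π T := by
    rw [flow_comm hs T S]
    nlinarith
  have hSB := main hS hSc hST hcell hlt1
  have hTB := main hT hTc hST.symm (by rw [Finset.union_comm, hcell]) hlt2
  have b1 := h.mass_le_of_flow_le hw hs hπ hσ i hST hcell hSB hTB hcon.le
  have b2 := h.mass_le_of_flow_le hw hs hπ hσ i hST.symm (by rw [Finset.union_comm, hcell])
    hTB hSB (by rw [flow_comm hs T S]; nlinarith)
  have hdisj : Disjoint (S ∩ B i) (T ∩ B i) :=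
    hST.mono Finset.inter_subset_left Finset.inter_subset_left
  have hcore : (S ∩ B i) ∪ (T ∩ B i) = B i := by
    rw [← Finset.union_inter_distrib_right, hcell, Finset.inter_eq_right.2 hsub]
  obtain ⟨c1, c2, c3⟩ := h.flow_core hs i hdisj hcore
  have hss : ∀ {U V : Finset ι}, Disjoint U V → U.Nonempty → V ⊆ B i → U ⊆ B i → V ⊂ B i := by
    intro U V hUV hU hVB hUB
    refine Finset.ssubset_iff_subset_ne.2 ⟨hVB, fun he => ?_⟩
    obtain ⟨x, hx⟩ := hU
    exact Finset.disjoint_left.1 hUV hx (he ▸ hUB hx)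
  have c4 := h.lt_flow_of_ssubset hπ i hTB
    (hss hdisj hSB Finset.inter_subset_right Finset.inter_subset_right)
  have c5 := h.lt_flow_of_ssubset hπ i hSB
    (hss hdisj.symm hTB Finset.inter_subset_right Finset.inter_subset_right)
  have c6 : flow w (S ∩ B i) (T ∩ B i) ≤ flow w S T :=
    flow_mono hw Finset.inter_subset_left Finset.inter_subset_left
  have hmSB := mass_pos hπ hSB
  have hmTB := mass_pos hπ hTB
  -- As 1 + 2ℓ ≤ 3ℓ, the cut is below (3/8)σu, so twice the cut stays below σu.
  have fin : ∀ u : ℝ, 0 < u → 8 * ℓ * flow w S T < σ * ((1 + 2 * ℓ) * u) →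
      2 * flow w S T < σ * u := by
    intro u hu hlt
    have : 8 * ℓ * flow w S T < ℓ * (3 * (σ * u)) := by nlinarith [mul_pos hσ hu]
    have := lt_of_mul_lt_mul_left (by linarith : ℓ * (8 * flow w S T) < ℓ * (3 * (σ * u)))
      (by linarith)
    nlinarith [mul_pos hσ hu]
  have f1 := fin _ hmSB (hcon.trans_le (mul_le_mul_of_nonneg_left b1 hσ.le))
  have f2 := fin _ hmTB (hcon.trans_le (mul_le_mul_of_nonneg_left (hle.trans b2) hσ.le))
  -- The two core parts have total boundary at most 2·flow S T + σℓ·mass (B i). Each exceeds level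
  -- σℓ and at least one exceeds level σ(ℓ+1), so 2·flow S T would be more than σ times the mass of
  -- that part.
  by_cases hφ : flow w (S ∩ B i) (S ∩ B i)ᶜ ≤ σ * (ℓ + 1) * mass π (S ∩ B i)
  · have := h.not_both_sparse hπ hσ i hSB hTB hdisj (Finset.inter_subset_left.trans hSc)
      (Finset.inter_subset_left.trans hTc) hφ
    linarith
  · linarith

end IsExtremal

/-- If a weighted graph does not have `k + 1` disjoint sets of small conductance, then it can be
partitioned into at most `k` expanders of small conductance. -/
theorem exists_finpartition_expanders {w : ι → ι → ℝ} (hw : ∀ x y, 0 ≤ w x y)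
    (hs : ∀ x y, w x y = w y x) {π : ι → ℝ} (hπ : ∀ x, 0 < π x) {σ : ℝ} (hσ : 0 < σ) (k : ℕ)
    (hk : ∀ B : Fin (k + 1) → Finset ι, ¬ IsSparseFamily w π (σ * (k + 1)) B) :
    ∃ 𝒥 : Finpartition (Finset.univ : Finset ι), 𝒥.parts.card ≤ k ∧ ∀ J ∈ 𝒥.parts,
      flow w J Jᶜ ≤ σ * k ^ 2 * mass π J ∧
      ∀ S ⊆ J, S.Nonempty → 2 * mass π S ≤ mass π J →
        σ * mass π S ≤ 8 * k * flow w S (J \ S) := by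
  rcases isEmpty_or_nonempty ι with hι | hι
  · have huniv : (Finset.univ : Finset ι) = ⊥ := by simp
    rw [huniv]
    exact ⟨⊥, by simp, by simp⟩
  obtain ⟨ℓ, -, hℓk, B, a, h⟩ := exists_isExtremal (w := w) hπ hσ k (by push Not; exact hk)
  have hℓk' : (ℓ : ℝ) ≤ k := by exact_mod_cast hℓk
  have hcell : ∀ i, (cell a i).Nonempty := fun i => (h.sparse.1 i).mono (h.subset_cell i)
  have hdisj : ∀ i j, i ≠ j → Disjoint (cell a i) (cell a j) := fun i j hij =>
    Finset.disjoint_left.2 fun x hx hx' => hij (by rw [← mem_cell.1 hx, mem_cell.1 hx'])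
  refine ⟨Finpartition.mk (Finset.univ.image (cell a)) ?_ ?_ ?_, ?_, ?_⟩
  · rw [Finset.supIndep_iff_pairwiseDisjoint]
    intro U hU V hV hUV
    simp only [Finset.coe_image, Finset.coe_univ, Set.image_univ, Set.mem_range] at hU hV
    obtain ⟨i, rfl⟩ := hU
    obtain ⟨j, rfl⟩ := hV
    exact hdisj i j fun hij => hUV (by rw [hij])
  · ext x
    simp [Finset.mem_sup, mem_cell]
  · simp only [Finset.bot_eq_empty, Finset.mem_image, Finset.mem_univ, true_and, not_exists]
    exact fun i hi => (hcell i).ne_empty hi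
  · refine Finset.card_image_le.trans ?_
    simpa using hℓk
  · intro J hJ
    simp only [Finset.mem_image, Finset.mem_univ, true_and] at hJ
    obtain ⟨i, rfl⟩ := hJ
    refine ⟨(h.flow_cell_compl_le hw hs hπ hσ i).trans ?_, fun S hS hne hle => ?_⟩
    · have := mass_nonneg hπ (cell a i)
      gcongr
    · have hm : mass π (cell a i) = mass π S + mass π (cell a i \ S) := by
        rw [← mass_union Finset.disjoint_sdiff, Finset.union_sdiff_of_subset hS]
      refine (h.mass_le_flow hw hs hπ hσ i Finset.disjoint_sdiff
        (Finset.union_sdiff_of_subset hS) hne (by linarith)).trans ?_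
      have := flow_nonneg hw S (cell a i \ S)
      gcongr

end Graph

/-! ### Functional calculus of the resolvent -/

section Semigroup

theorem semigroupFun_of_pos (t : ℝ) {r : ℝ} (hr : 0 < r) :
    semigroupFun t r = Real.exp (-t * (1 / r - 1)) := by simp [semigroupFun, hr]

theorem semigroupFun_of_nonpos (t : ℝ) {r : ℝ} (hr : r ≤ 0) : semigroupFun t r = 0 := by
  simp [semigroupFun, hr]

theorem semigroupFun_nonneg (t r : ℝ) : 0 ≤ semigroupFun t r := by
  unfold semigroupFun
  split_ifs <;> positivity

/-- The point r = 0 corresponds to infinite energy, where exp(-ta) tends to 0. Continuity there puts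
`semigroupFun` within reach of the continuous functional calculus, even though 0 may lie in the
spectrum of the resolvent. -/
theorem continuous_semigroupFun {t : ℝ} (ht : 0 < t) : Continuous (semigroupFun t) := by
  rw [continuous_iff_continuousAt]
  intro r
  rcases lt_trichotomy r 0 with h | rfl | h
  · refine (continuousAt_const (y := (0 : ℝ))).congr ?_
    filter_upwards [gt_mem_nhds h] with y hy
    exact (semigroupFun_of_nonpos t hy.le).symm
  · rw [ContinuousAt, semigroupFun_of_nonpos t le_rfl, ← nhdsLE_sup_nhdsGT, Filter.tendsto_sup]
    rw [nhdsLE_sup_nhdsGT]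
    refine ⟨?_, ?_⟩
    · refine (tendsto_const_nhds (x := (0 : ℝ))).congr' ?_
      filter_upwards [self_mem_nhdsWithin] with y hy
      exact (semigroupFun_of_nonpos t hy).symm
    · have h1 : Filter.Tendsto (fun r : ℝ => Real.exp (-t * (1 / r - 1))) (nhdsWithin 0 (Set.Ioi 0))
          (nhds 0) := by
        refine Real.tendsto_exp_atBot.comp ?_
        refine Filter.Tendsto.const_mul_atTop_of_neg (by linarith) ?_
        simp only [one_div]
        exact Filter.tendsto_atTop_add_const_right _ _ tendsto_inv_nhdsGT_zero
      refine h1.congr' ?_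
      filter_upwards [self_mem_nhdsWithin] with y hy
      exact (semigroupFun_of_pos t hy).symm
  · have h1 : ContinuousAt (fun r : ℝ => Real.exp (-t * (1 / r - 1))) r := by
      have := h.ne'
      fun_prop (disch := assumption)
    refine h1.congr ?_
    filter_upwards [lt_mem_nhds h] with y hy
    exact (semigroupFun_of_pos t hy).symm

theorem semigroupFun_strictMono {t : ℝ} (ht : 0 < t) {r r' : ℝ} (hr : 0 < r) (h : r < r') :
    semigroupFun t r < semigroupFun t r' := by
  rw [semigroupFun_of_pos t hr, semigroupFun_of_pos t (hr.trans h), Real.exp_lt_exp]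
  have := one_div_lt_one_div_of_lt hr h
  nlinarith

theorem semigroupFun_mono {t : ℝ} (ht : 0 < t) : Monotone (semigroupFun t) := by
  intro r r' h
  rcases le_or_gt r 0 with hr | hr
  · rw [semigroupFun_of_nonpos t hr]
    exact semigroupFun_nonneg _ _
  · rcases h.eq_or_lt with rfl | h
    · rfl
    · exact (semigroupFun_strictMono ht hr h).le

theorem semigroupFun_one (t : ℝ) : semigroupFun t 1 = 1 := by simp [semigroupFun]

end Semigroup

section Resolvent

variable {H D : Type*} [NormedAddCommGroup H] [InnerProductSpace ℂ H] [CompleteSpace H]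
  [NormedAddCommGroup D] [InnerProductSpace ℂ D] [CompleteSpace D]

theorem isSelfAdjoint_cfc_operator (f : ℝ → ℝ) (R : H →L[ℂ] H) : IsSelfAdjoint (cfc f R) :=
  cfc_predicate f R

theorem inner_cfc_left (f : ℝ → ℝ) (R : H →L[ℂ] H) (u v : H) :
    inner ℂ (cfc f R u) v = inner ℂ u (cfc f R v) := by
  have h := isSelfAdjoint_cfc_operator f R
  rw [ContinuousLinearMap.isSelfAdjoint_iff'] at h
  rw [← ContinuousLinearMap.adjoint_inner_right, h]

/-- The quadratic form of `f(R)`. -/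
def cfcForm (R : H →L[ℂ] H) (f : ℝ → ℝ) (v : H) : ℝ := (inner ℂ (cfc f R v) v).re

theorem cfcForm_const (R : H →L[ℂ] H) (hR : IsSelfAdjoint R) (c : ℝ) (v : H) :
    cfcForm R (fun _ => c) v = c * ‖v‖ ^ 2 := by
  rw [cfcForm, cfc_const c R]
  rw [Algebra.algebraMap_eq_smul_one, smul_apply,
    one_apply_eq_self, inner_smul_left_eq_smul, Complex.real_smul,
    Complex.re_ofReal_mul]
  have := inner_self_eq_norm_sq (𝕜 := ℂ) v
  simp only [RCLike.re_to_complex] at this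
  rw [this]

theorem cfcForm_add (R : H →L[ℂ] H) {f g : ℝ → ℝ} (hf : ContinuousOn f (spectrum ℝ R))
    (hg : ContinuousOn g (spectrum ℝ R)) (v : H) :
    cfcForm R (fun r => f r + g r) v = cfcForm R f v + cfcForm R g v := by
  rw [cfcForm, cfc_add (a := R) f g, add_apply, inner_add_left, Complex.add_re]
  rfl

theorem cfcForm_sub (R : H →L[ℂ] H) {f g : ℝ → ℝ} (hf : ContinuousOn f (spectrum ℝ R))
    (hg : ContinuousOn g (spectrum ℝ R)) (v : H) :
    cfcForm R (fun r => f r - g r) v = cfcForm R f v - cfcForm R g v := by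
  rw [cfcForm, cfc_sub (a := R) f g, sub_apply, inner_sub_left, Complex.sub_re]
  rfl

theorem cfcForm_const_mul (R : H →L[ℂ] H) (c : ℝ) {f : ℝ → ℝ}
    (hf : ContinuousOn f (spectrum ℝ R)) (v : H) :
    cfcForm R (fun r => c * f r) v = c * cfcForm R f v := by
  rw [cfcForm, cfc_const_mul c f R, smul_apply, inner_smul_left_eq_smul,
    Complex.real_smul, Complex.re_ofReal_mul]
  rfl

theorem norm_cfc_sq (R : H →L[ℂ] H) {f : ℝ → ℝ} (hf : ContinuousOn f (spectrum ℝ R)) (v : H) :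
    ‖cfc f R v‖ ^ 2 = cfcForm R (fun r => f r * f r) v := by
  rw [cfcForm, cfc_mul f f R, mul_apply_eq_comp, inner_cfc_left]
  have := inner_self_eq_norm_sq (𝕜 := ℂ) (cfc f R v)
  simp only [RCLike.re_to_complex] at this
  exact this.symm

theorem spectrum_subset_Icc {R : H →L[ℂ] H} (h0 : R.IsPositive) (h1 : ‖R‖ ≤ 1) :
    spectrum ℝ R ⊆ Set.Icc 0 1 := by
  intro r hr
  have h0' : (0 : H →L[ℂ] H) ≤ R := (ContinuousLinearMap.nonneg_iff_isPositive R).2 h0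
  refine ⟨spectrum_nonneg_of_nonneg h0' hr, ?_⟩
  rcases subsingleton_or_nontrivial H with hH | hH
  · have : Subsingleton (H →L[ℂ] H) := ⟨fun a b => by ext x; exact Subsingleton.elim _ _⟩
    rw [spectrum.of_subsingleton] at hr
    exact hr.elim
  · exact (le_abs_self r).trans ((spectrum.norm_le_norm_of_mem hr).trans h1)

theorem cfcForm_mono {R : H →L[ℂ] H} (h0 : R.IsPositive) (h1 : ‖R‖ ≤ 1) {f g : ℝ → ℝ}
    (hf : ContinuousOn f (Set.Icc 0 1)) (hg : ContinuousOn g (Set.Icc 0 1))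
    (hfg : ∀ r ∈ Set.Icc (0 : ℝ) 1, f r ≤ g r) (v : H) : cfcForm R f v ≤ cfcForm R g v := by
  have hs := spectrum_subset_Icc h0 h1
  have h : cfc f R ≤ cfc g R :=
    cfc_mono (fun r hr => hfg r (hs hr)) (hf.mono hs) (hg.mono hs)
  have h2 := ((ContinuousLinearMap.le_def _ _).1 h).re_inner_nonneg_left v
  rw [sub_apply, inner_sub_left] at h2
  simp only [RCLike.re_to_complex, Complex.sub_re] at h2
  unfold cfcForm
  linarith

open ContinuousLinearMap in
-- Because ‖i†u‖² = ⟨i i†u, u⟩, the form norm of vectors i†f(R)v is again a quadratic form of a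
-- function of R. Inequalities between energies then reduce to scalar inequalities on [0, 1].
theorem norm_adjoint_cfc_sq (i : D →L[ℂ] H) (f : ℝ → ℝ)
    (hf : ContinuousOn f (spectrum ℝ (i ∘L adjoint i))) (v : H) :
    ‖adjoint i (cfc f (i ∘L adjoint i) v)‖ ^ 2 =
      cfcForm (i ∘L adjoint i) (fun r => f r * (r * f r)) v := by
  set R := i ∘L adjoint i with hR
  have hpos : R.IsPositive := isPositive_self_comp_adjoint i
  have hmul : cfc (fun r => r * f r) R = R * cfc f R := by
    rw [cfc_mul (fun r => r) f R (by fun_prop) hf, cfc_id' ℝ R hpos.isSelfAdjoint]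
  rw [cfcForm, cfc_mul f (fun r => r * f r) R hf (by fun_prop), hmul,
    mul_apply_eq_comp, mul_apply_eq_comp, inner_cfc_left]
  have := inner_self_eq_norm_sq (𝕜 := ℂ) (adjoint i (cfc f R v))
  simp only [RCLike.re_to_complex] at this
  rw [← this, adjoint_inner_right]
  rfl

open ContinuousLinearMap in
theorem comp_adjoint_cfc (i : D →L[ℂ] H) (f : ℝ → ℝ)
    (hf : ContinuousOn f (spectrum ℝ (i ∘L adjoint i))) (v : H) :
    i (adjoint i (cfc f (i ∘L adjoint i) v)) = cfc (fun r => r * f r) (i ∘L adjoint i) v := by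
  set R := i ∘L adjoint i with hR
  have hpos : R.IsPositive := isPositive_self_comp_adjoint i
  rw [cfc_mul (fun r => r) f R (by fun_prop) hf, cfc_id' ℝ R hpos.isSelfAdjoint]
  rfl

open ContinuousLinearMap in
theorem norm_comp_adjoint_le (i : D →L[ℂ] H) (hi : ‖i‖ ≤ 1) : ‖i ∘L adjoint i‖ ≤ 1 := by
  refine (opNorm_comp_le _ _).trans ?_
  rw [LinearIsometryEquiv.norm_map]
  exact mul_le_one₀ hi (norm_nonneg _) hi

open ContinuousLinearMap in
/-- A vector with small energy close to a given one. -/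
theorem exists_form_near (i : D →L[ℂ] H) (hi : ‖i‖ ≤ 1) {t : ℝ} (ht : 0 < t) (v : H) :
    ∃ w : D, ‖i w - v‖ ^ 2 ≤ ‖v‖ ^ 2 - cfcForm (i ∘L adjoint i) (semigroupFun t) v ∧
      t * (‖w‖ ^ 2 - ‖i w‖ ^ 2) ≤
        ‖v‖ ^ 2 - cfcForm (i ∘L adjoint i) (semigroupFun t) v := by
  set R := i ∘L adjoint i with hR
  have h0 : R.IsPositive := isPositive_self_comp_adjoint i
  have h1 : ‖R‖ ≤ 1 := norm_comp_adjoint_le i hi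
  have hs := spectrum_subset_Icc h0 h1
  -- Implicit Euler step: with r = 1/(1+a) one has r·ψ(r) = 1/(1+ta), so i w = (1 - t𝓛)⁻¹v. Writing
  -- z for this number, exp(-ta) ≤ z ≤ 1 bounds both the squared error (1-z)² and the scaled energy
  -- z(1-z) by 1 - exp(-ta).
  set ψ : ℝ → ℝ := fun r => 1 / (r + t * (1 - r)) with hψ
  have hden : ∀ r ∈ Set.Icc (0 : ℝ) 1, 0 < r + t * (1 - r) := by
    rintro r ⟨hr0, hr1⟩
    rcases hr0.eq_or_lt with rfl | h
    · simpa using ht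
    · have := mul_nonneg ht.le (sub_nonneg.2 hr1)
      linarith
  have hψc : ContinuousOn ψ (Set.Icc 0 1) := by
    refine ContinuousOn.div (by fun_prop) (by fun_prop) fun r hr => (hden r hr).ne'
  have hψs := hψc.mono hs
  have hsc : ContinuousOn (semigroupFun t) (Set.Icc 0 1) := (continuous_semigroupFun ht).continuousOn
  have key : ∀ r ∈ Set.Icc (0 : ℝ) 1, (r * ψ r - 1) * (r * ψ r - 1) ≤ 1 - semigroupFun t r ∧
      t * (ψ r * (r * ψ r) - r * ψ r * (r * ψ r)) ≤ 1 - semigroupFun t r := by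
    intro r hr
    have hd := hden r hr
    obtain ⟨hr0, hr1⟩ := hr
    set z := r * ψ r with hz
    have hz0 : 0 ≤ z := by positivity
    have hz1 : z ≤ 1 := by
      rw [hz, hψ]
      simp only [mul_one_div]
      rw [div_le_one hd]
      nlinarith
    have hzs : semigroupFun t r ≤ z := by
      rcases hr0.eq_or_lt with rfl | h
      · rw [semigroupFun_of_nonpos t le_rfl]
        exact hz0
      · rw [semigroupFun_of_pos t h, hz, hψ, neg_mul, Real.exp_neg, mul_one_div, ← one_div,
          div_le_div_iff₀ (Real.exp_pos _) hd]
        have h3 := Real.add_one_le_exp (t * (1 / r - 1))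
        have h4 : r * (t * (1 / r - 1) + 1) = r + t * (1 - r) := by
          field_simp
          ring
        nlinarith
    have he : t * (ψ r * z - z * z) = z * (1 - z) := by
      have : t * (1 - r) * ψ r = 1 - z := by
        rw [hz, hψ]
        field_simp
        ring
      rw [hz]
      calc t * (ψ r * (r * ψ r) - r * ψ r * (r * ψ r)) = (r * ψ r) * (t * (1 - r) * ψ r) := by ring
        _ = _ := by rw [this]
    refine ⟨by nlinarith, ?_⟩
    rw [he]
    nlinarith
  have hone : ‖v‖ ^ 2 - cfcForm R (semigroupFun t) v =
      cfcForm R (fun r => 1 - semigroupFun t r) v := by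
    rw [cfcForm_sub R (by fun_prop) (hsc.mono hs), cfcForm_const R h0.isSelfAdjoint, one_mul]
  rw [hone]
  refine ⟨adjoint i (cfc ψ R v), ?_, ?_⟩
  · rw [comp_adjoint_cfc i ψ hψs]
    have e : cfc (fun r => r * ψ r) R v - v = cfc (fun r => r * ψ r - 1) R v := by
      rw [cfc_sub (fun r => r * ψ r) (fun _ => 1) R (by fun_prop) (by fun_prop),
        cfc_const_one ℝ R h0.isSelfAdjoint]
      rfl
    rw [e, norm_cfc_sq R (by fun_prop)]
    exact cfcForm_mono h0 h1 (by fun_prop) (by fun_prop) (fun r hr => (key r hr).1) v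
  · rw [comp_adjoint_cfc i ψ hψs, norm_adjoint_cfc_sq i ψ hψs, norm_cfc_sq R (by fun_prop),
      ← cfcForm_sub R (by fun_prop) (by fun_prop), ← cfcForm_const_mul R t (by fun_prop)]
    exact cfcForm_mono h0 h1 (by fun_prop) (by fun_prop) (fun r hr => (key r hr).2) v

/-- A polynomial substitute for the spectral projection onto r > r₀. Choose r₁ > r₀ with
`semigroupFun t r₁ < s` and normalize the correction r^(2N+1)(r - r₀) to equal 1 at r₁. Beyond r₁ it
dominates the trivial bound 1, between r₀ and r₁ it is not needed, and below r₀ its negative part is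
as small as desired for large N, by powers of r₀/r₁. -/
theorem exists_pow_bound {t : ℝ} (ht : 0 < t) {r₀ s : ℝ} (hr₀ : 0 < r₀)
    (hs : semigroupFun t r₀ < s) :
    ∃ (N : ℕ) (K : ℝ), 0 < K ∧ ∀ r ∈ Set.Icc (0 : ℝ) 1,
      semigroupFun t r ≤ s + K * (r ^ (N + 1) * r ^ (N + 1) - r₀ * (r ^ N * r ^ (N + 1))) := by
  obtain ⟨r₁, hr₁, hs1⟩ : ∃ r₁, r₀ < r₁ ∧ semigroupFun t r₁ < s := by
    have h := ((continuous_semigroupFun ht).tendsto r₀).eventually (gt_mem_nhds hs)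
    obtain ⟨r₁, h1, h2⟩ := ((h.filter_mono nhdsWithin_le_nhds).and
      (self_mem_nhdsWithin : Set.Ioi r₀ ∈ nhdsWithin r₀ (Set.Ioi r₀))).exists
    exact ⟨r₁, h2, h1⟩
  have hr1 : 0 < r₁ := hr₀.trans hr₁
  have hq : r₀ / r₁ < 1 := (div_lt_one hr1).2 hr₁
  have hε : 0 < (s - semigroupFun t r₀) * (r₁ - r₀) := mul_pos (by linarith) (by linarith)
  obtain ⟨N, hN⟩ := exists_pow_lt_of_lt_one (div_pos hε hr₀) hq
  have hq' : (r₀ / r₁) ^ (2 * N + 1) ≤ (r₀ / r₁) ^ N :=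
    pow_le_pow_of_le_one (by positivity) hq.le (by omega)
  have hKpos : 0 < r₁ ^ (2 * N + 1) * (r₁ - r₀) := mul_pos (by positivity) (by linarith)
  refine ⟨N, 1 / (r₁ ^ (2 * N + 1) * (r₁ - r₀)), by positivity, fun r hr => ?_⟩
  have e : r ^ (N + 1) * r ^ (N + 1) - r₀ * (r ^ N * r ^ (N + 1)) =
      r ^ (2 * N + 1) * (r - r₀) := by ring
  rw [e]
  obtain ⟨hra, hrb⟩ := hr
  rcases le_or_gt r r₀ with h | h
  · have h1 : semigroupFun t r ≤ semigroupFun t r₀ := semigroupFun_mono ht h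
    have h2 : r ^ (2 * N + 1) * (r₀ - r) ≤ r₀ ^ (2 * N + 1) * r₀ := by
      gcongr
      linarith
    have h3 : r₀ ^ (2 * N + 1) * r₀ ≤
        (s - semigroupFun t r₀) * (r₁ ^ (2 * N + 1) * (r₁ - r₀)) := by
      have h4 : (r₀ / r₁) ^ (2 * N + 1) * r₀ ≤ (s - semigroupFun t r₀) * (r₁ - r₀) := by
        have := hq'.trans hN.le
        rwa [le_div_iff₀ hr₀] at this
      rw [div_pow, div_mul_eq_mul_div, div_le_iff₀ (by positivity)] at h4
      linarith
    have h5 : 1 / (r₁ ^ (2 * N + 1) * (r₁ - r₀)) * (r ^ (2 * N + 1) * (r₀ - r)) ≤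
        s - semigroupFun t r₀ := by
      rw [one_div_mul_eq_div, div_le_iff₀ hKpos]
      exact h2.trans h3
    have h6 : 1 / (r₁ ^ (2 * N + 1) * (r₁ - r₀)) * (r ^ (2 * N + 1) * (r - r₀)) =
      -(1 / (r₁ ^ (2 * N + 1) * (r₁ - r₀)) * (r ^ (2 * N + 1) * (r₀ - r))) := by ring
    linarith
  · have hpos : 0 ≤ 1 / (r₁ ^ (2 * N + 1) * (r₁ - r₀)) * (r ^ (2 * N + 1) * (r - r₀)) := by
      have := sub_pos.2 h
      positivity
    rcases le_or_gt r r₁ with h' | h'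
    · have := semigroupFun_mono ht h'
      linarith
    · have h1 : semigroupFun t r ≤ 1 := by
        rw [← semigroupFun_one t]
        exact semigroupFun_mono ht hrb
      have h2 : r₁ ^ (2 * N + 1) * (r₁ - r₀) ≤ r ^ (2 * N + 1) * (r - r₀) := by
        have := sub_pos.2 hr₁
        gcongr
      have h3 : 1 ≤ 1 / (r₁ ^ (2 * N + 1) * (r₁ - r₀)) * (r ^ (2 * N + 1) * (r - r₀)) := by
        rw [one_div_mul_eq_div, one_le_div hKpos]
        exact h2
      have := semigroupFun_nonneg t r₀
      linarith

open ContinuousLinearMap in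
/-- Powers of the resolvent improve the Rayleigh quotient. -/
theorem exists_pow_form_bound (i : D →L[ℂ] H) (hi : ‖i‖ ≤ 1) {t : ℝ} (ht : 0 < t) {r₀ s : ℝ}
    (hr₀ : 0 < r₀) (hs : semigroupFun t r₀ < s) :
    ∃ (N : ℕ) (K : ℝ), 0 < K ∧ ∀ v : H,
      cfcForm (i ∘L adjoint i) (semigroupFun t) v ≤ s * ‖v‖ ^ 2 +
        K * (‖i (adjoint i (((i ∘L adjoint i) ^ N) v))‖ ^ 2 -
          r₀ * ‖adjoint i (((i ∘L adjoint i) ^ N) v)‖ ^ 2) := by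
  obtain ⟨N, K, hK, hb⟩ := exists_pow_bound ht hr₀ hs
  refine ⟨N, K, hK, fun v => ?_⟩
  set R := i ∘L adjoint i with hR
  have h0 : R.IsPositive := isPositive_self_comp_adjoint i
  have h1 : ‖R‖ ≤ 1 := norm_comp_adjoint_le i hi
  rw [← cfc_pow_id (R := ℝ) R N h0.isSelfAdjoint, comp_adjoint_cfc i _ (by fun_prop),
    norm_adjoint_cfc_sq i _ (by fun_prop), norm_cfc_sq R (by fun_prop),
    ← cfcForm_const_mul R _ (by fun_prop), ← cfcForm_sub R (by fun_prop) (by fun_prop),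
    ← cfcForm_const_mul R _ (by fun_prop), ← cfcForm_const R h0.isSelfAdjoint,
    ← cfcForm_add R (by fun_prop) (by fun_prop)]
  refine cfcForm_mono h0 h1 (continuous_semigroupFun ht).continuousOn (by fun_prop)
    (fun r hr => (hb r hr).trans (le_of_eq ?_)) v
  ring

end Resolvent

/-! ### Test functions and the form domain -/

section FormDomain

variable {d : ℕ}

theorem re_inner_L2 {α E : Type*} [MeasurableSpace α] {μ : Measure α} [NormedAddCommGroup E]
    [InnerProductSpace ℂ E] (u v : Lp E 2 μ) :
    (inner ℂ u v).re = ∫ x, (inner ℂ (u x) (v x)).re ∂μ := by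
  rw [MeasureTheory.L2.inner_def]
  exact (integral_re (MeasureTheory.L2.integrable_inner (𝕜 := ℂ) u v)).symm

theorem norm_sq_L2 {α E : Type*} [MeasurableSpace α] {μ : Measure α} [NormedAddCommGroup E]
    [InnerProductSpace ℂ E] (u : Lp E 2 μ) : ‖u‖ ^ 2 = ∫ x, ‖u x‖ ^ 2 ∂μ := by
  have h := inner_self_eq_norm_sq (𝕜 := ℂ) u
  simp only [RCLike.re_to_complex] at h
  rw [← h, re_inner_L2]
  refine integral_congr_ae (Filter.Eventually.of_forall fun x => ?_)
  have h := inner_self_eq_norm_sq (𝕜 := ℂ) (u x)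
  simpa only [RCLike.re_to_complex] using h

theorem norm_sq_real_L2 {α : Type*} [MeasurableSpace α] {μ : Measure α}
    (u : Lp ℝ 2 μ) : ‖u‖ ^ 2 = ∫ x, u x ^ 2 ∂μ := by
  have h := inner_self_eq_norm_sq (𝕜 := ℝ) u
  simp only [RCLike.re_to_real] at h
  rw [← h, MeasureTheory.L2.inner_def]
  refine integral_congr_ae (Filter.Eventually.of_forall fun x => ?_)
  simp [sq]

theorem norm_sq_add_I_smul {H : Type*} [NormedAddCommGroup H] [InnerProductSpace ℂ H] {u v : H}
    (h : (inner ℂ u (Complex.I • v)).re = 0) :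
    ‖u + Complex.I • v‖ ^ 2 = ‖u‖ ^ 2 + ‖v‖ ^ 2 := by
  have := norm_add_sq (𝕜 := ℂ) u (Complex.I • v)
  simp only [RCLike.re_to_complex] at this
  rw [this, h, norm_smul]
  simp

/-- Real test functions. -/
def testSpace (d : ℕ) : Submodule ℝ (Space d → ℝ) where
  carrier := {g | IsTest g}
  add_mem' ha hb := ⟨ha.1.add hb.1, ha.2.add hb.2⟩
  zero_mem' := ⟨contDiff_const, HasCompactSupport.zero⟩
  smul_mem' c g hg := ⟨contDiff_const.smul hg.1, hg.2.mono' (by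
    refine (Function.support_const_smul_subset c g).trans (subset_tsupport g))⟩

theorem testSpace_isTest (a : testSpace d) : IsTest (a : Space d → ℝ) := a.2

theorem IsTest.differentiable {F : Type*} [NormedAddCommGroup F] [NormedSpace ℝ F]
    {g : Space d → F} (hg : IsTest g) : Differentiable ℝ g := hg.1.differentiable (by simp)

theorem IsTest.clm_comp {F G : Type*} [NormedAddCommGroup F] [NormedSpace ℝ F]
    [NormedAddCommGroup G] [NormedSpace ℝ G] (L : F →L[ℝ] G)
    {g : Space d → F} (hg : IsTest g) : IsTest (fun x => L (g x)) :=
  ⟨L.contDiff.comp hg.1, hg.2.comp_left (g := L) (map_zero L)⟩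

/-- Collecting the partial derivatives in a vector. -/
def partials (L : Space d →L[ℝ] ℂ) : EuclideanSpace ℂ (Fin d) :=
  WithLp.toLp 2 fun i => L (EuclideanSpace.single i 1)

theorem continuous_partials : Continuous (partials (d := d)) := by
  refine (PiLp.continuous_toLp 2 _).comp (continuous_pi fun i => ?_)
  fun_prop

theorem IsTest.memLp_complexGradient {g : Space d → ℂ} (hg : IsTest g) (p : Measure (Space d))
    [IsFiniteMeasure p] : MemLp (complexGradient g) 2 p := by
  have h1 : Continuous (fderiv ℝ g) := hg.1.continuous_fderiv (by simp)
  have h2 : HasCompactSupport (complexGradient g) :=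
    (hg.2.fderiv (𝕜 := ℝ)).comp_left (g := partials) (by ext i; simp [partials])
  exact (continuous_partials.comp h1).memLp_of_hasCompactSupport h2

theorem IsTest.memLp {F : Type*} [NormedAddCommGroup F] [NormedSpace ℝ F] {g : Space d → F}
    (hg : IsTest g) (p : Measure (Space d)) [IsFiniteMeasure p] : MemLp g 2 p :=
  hg.1.continuous.memLp_of_hasCompactSupport hg.2

theorem complexGradient_ofReal {a : Space d → ℝ} (ha : IsTest a) (x : Space d) :
    complexGradient (fun y => Complex.ofRealCLM (a y)) x =
      WithLp.toLp 2 fun i => ((gradient a x i : ℝ) : ℂ) := by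
  have h : fderiv ℝ (fun y => Complex.ofRealCLM (a y)) x =
      Complex.ofRealCLM.comp (fderiv ℝ a x) :=
    (Complex.ofRealCLM.hasFDerivAt.comp x (ha.differentiable x).hasFDerivAt).fderiv
  ext i
  simp only [complexGradient, h]
  have h2 : fderiv ℝ a x (EuclideanSpace.single i 1) = gradient a x i := by
    have h3 : inner ℝ (gradient a x) (EuclideanSpace.single i (1 : ℝ)) =
        fderiv ℝ a x (EuclideanSpace.single i 1) := by
      rw [gradient]
      exact InnerProductSpace.toDual_symm_apply
    rw [← h3, EuclideanSpace.inner_single_right]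
    simp
  simp [h2]

variable (p : Measure (Space d)) [IsFiniteMeasure p]

/-- A real test function with its gradient, as an element of the form domain. -/
def testGraph (a : testSpace d) : formDomain p :=
  ⟨WithLp.toLp 2
    (MemLp.toLp _ (((testSpace_isTest a).clm_comp Complex.ofRealCLM).memLp p),
      MemLp.toLp _ (((testSpace_isTest a).clm_comp Complex.ofRealCLM).memLp_complexGradient p)),
    Submodule.le_topologicalClosure _ (Submodule.subset_span
      ⟨_, (testSpace_isTest a).clm_comp Complex.ofRealCLM,
        MemLp.coeFn_toLp (((testSpace_isTest a).clm_comp Complex.ofRealCLM).memLp p),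
        MemLp.coeFn_toLp
          (((testSpace_isTest a).clm_comp Complex.ofRealCLM).memLp_complexGradient p)⟩)⟩

variable {p}

theorem testGraph_fst (a : testSpace d) :
    ((testGraph p a : WithLp 2 (L2 p × L2Field p)).fst : Space d → ℂ) =ᵐ[p]
      fun x => ((a : Space d → ℝ) x : ℂ) :=
  MemLp.coeFn_toLp (((testSpace_isTest a).clm_comp Complex.ofRealCLM).memLp p)

theorem testGraph_snd (a : testSpace d) :
    ((testGraph p a : WithLp 2 (L2 p × L2Field p)).snd : Space d → EuclideanSpace ℂ (Fin d))
      =ᵐ[p] fun x => WithLp.toLp 2 fun i => ((gradient (a : Space d → ℝ) x i : ℝ) : ℂ) := by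
  refine (MemLp.coeFn_toLp (((testSpace_isTest a).clm_comp
    Complex.ofRealCLM).memLp_complexGradient p)).trans (Filter.Eventually.of_forall fun x => ?_)
  exact complexGradient_ofReal a.2 x

theorem formDomain_ext {u v : formDomain p}
    (h1 : (u : WithLp 2 (L2 p × L2Field p)).fst = (v : WithLp 2 (L2 p × L2Field p)).fst)
    (h2 : (u : WithLp 2 (L2 p × L2Field p)).snd = (v : WithLp 2 (L2 p × L2Field p)).snd) :
    u = v := by
  apply Subtype.ext
  apply (WithLp.equiv 2 _).injective
  exact Prod.ext h1 h2

theorem gradient_add' (a b : testSpace d) (x : Space d) :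
    gradient ((a + b : testSpace d) : Space d → ℝ) x =
      gradient (a : Space d → ℝ) x + gradient (b : Space d → ℝ) x := by
  have := fderiv_add ((testSpace_isTest a).differentiable x) ((testSpace_isTest b).differentiable x)
  rw [gradient, Submodule.coe_add, this, map_add]
  rfl

theorem gradient_smul' (c : ℝ) (a : testSpace d) (x : Space d) :
    gradient ((c • a : testSpace d) : Space d → ℝ) x = c • gradient (a : Space d → ℝ) x := by
  have := fderiv_const_smul ((testSpace_isTest a).differentiable x) c
  rw [gradient, Submodule.coe_smul, this, map_smulₛₗ]
  rfl

theorem testGraph_add (a b : testSpace d) :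
    testGraph p (a + b) = testGraph p a + testGraph p b := by
  apply formDomain_ext
  · refine Lp.ext ((testGraph_fst _).trans ?_)
    refine Filter.EventuallyEq.trans ?_ (Lp.coeFn_add
      (testGraph p a : WithLp 2 (L2 p × L2Field p)).fst (testGraph p b : WithLp 2 (L2 p × L2Field p)).fst).symm
    filter_upwards [testGraph_fst (p := p) a, testGraph_fst (p := p) b] with x h1 h2
    simp [Pi.add_apply, h1, h2]
  · refine Lp.ext ((testGraph_snd _).trans ?_)
    refine Filter.EventuallyEq.trans ?_ (Lp.coeFn_add
      (testGraph p a : WithLp 2 (L2 p × L2Field p)).snd (testGraph p b : WithLp 2 (L2 p × L2Field p)).snd).symm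
    filter_upwards [testGraph_snd (p := p) a, testGraph_snd (p := p) b] with x h1 h2
    simp only [Pi.add_apply, h1, h2, gradient_add']
    ext i
    simp

theorem testGraph_smul (c : ℝ) (a : testSpace d) :
    testGraph p (c • a) = (c : ℂ) • testGraph p a := by
  apply formDomain_ext
  · refine Lp.ext ((testGraph_fst _).trans ?_)
    refine Filter.EventuallyEq.trans ?_ (Lp.coeFn_smul (c : ℂ)
      (testGraph p a : WithLp 2 (L2 p × L2Field p)).fst).symm
    filter_upwards [testGraph_fst (p := p) a] with x h1
    simp [Pi.smul_apply, h1]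
  · refine Lp.ext ((testGraph_snd _).trans ?_)
    refine Filter.EventuallyEq.trans ?_ (Lp.coeFn_smul (c : ℂ)
      (testGraph p a : WithLp 2 (L2 p × L2Field p)).snd).symm
    filter_upwards [testGraph_snd (p := p) a] with x h1
    simp only [Pi.smul_apply, h1, gradient_smul']
    ext i
    simp

theorem norm_sq_formDomain (u : formDomain p) :
    ‖u‖ ^ 2 = ‖formInclusion p u‖ ^ 2 + ‖(u : WithLp 2 (L2 p × L2Field p)).snd‖ ^ 2 :=
  WithLp.prod_norm_sq_eq_of_L2 _

theorem norm_sq_formInclusion_testGraph (a : testSpace d) :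
    ‖formInclusion p (testGraph p a)‖ ^ 2 = ∫ x, (a : Space d → ℝ) x ^ 2 ∂p := by
  rw [norm_sq_L2]
  refine integral_congr_ae ?_
  filter_upwards [testGraph_fst (p := p) a] with x h
  have : (formInclusion p (testGraph p a) : Space d → ℂ) x = ((a : Space d → ℝ) x : ℂ) := h
  rw [this]
  simp

theorem norm_sq_testGraph_snd (a : testSpace d) :
    ‖(testGraph p a : WithLp 2 (L2 p × L2Field p)).snd‖ ^ 2 = dirichlet p (a : Space d → ℝ) := by
  rw [norm_sq_L2, dirichlet]
  refine integral_congr_ae ?_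
  filter_upwards [testGraph_snd (p := p) a] with x h
  rw [h, EuclideanSpace.norm_sq_eq, EuclideanSpace.norm_sq_eq]
  simp

theorem norm_formInclusion_le : ‖formInclusion p‖ ≤ 1 := by
  refine ContinuousLinearMap.opNorm_le_bound _ zero_le_one fun u => ?_
  rw [one_mul]
  have := norm_sq_formDomain u
  nlinarith [norm_nonneg u, norm_nonneg (formInclusion p u),
    sq_nonneg ‖(u : WithLp 2 (L2 p × L2Field p)).snd‖]

theorem re_inner_fst_I (a b : testSpace d) :
    (inner ℂ (formInclusion p (testGraph p a))
      (Complex.I • formInclusion p (testGraph p b))).re = 0 := by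
  rw [re_inner_L2]
  refine integral_eq_zero_of_ae ?_
  filter_upwards [testGraph_fst (p := p) a, testGraph_fst (p := p) b,
    Lp.coeFn_smul Complex.I (formInclusion p (testGraph p b))] with x h1 h2 h3
  have h1' : (formInclusion p (testGraph p a) : Space d → ℂ) x = ((a : Space d → ℝ) x : ℂ) := h1
  have h2' : (formInclusion p (testGraph p b) : Space d → ℂ) x = ((b : Space d → ℝ) x : ℂ) := h2
  rw [h3, Pi.smul_apply, h1', h2']
  simp

theorem re_inner_snd_I (a b : testSpace d) :
    (inner ℂ ((testGraph p a : WithLp 2 (L2 p × L2Field p)).snd)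
      (Complex.I • (testGraph p b : WithLp 2 (L2 p × L2Field p)).snd)).re = 0 := by
  rw [re_inner_L2]
  refine integral_eq_zero_of_ae ?_
  filter_upwards [testGraph_snd (p := p) a, testGraph_snd (p := p) b,
    Lp.coeFn_smul Complex.I (testGraph p b : WithLp 2 (L2 p × L2Field p)).snd] with x h1 h2 h3
  rw [h3, Pi.smul_apply, h1, h2, PiLp.inner_apply]
  simp

/-- Pythagoras over ℝ: real functions are orthogonal to purely imaginary ones. This and its gradient
version allow the imaginary part of an approximation to be dropped. -/
theorem norm_sq_fst_add_I (a b : testSpace d) :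
    ‖formInclusion p (testGraph p a + Complex.I • testGraph p b)‖ ^ 2 =
      ‖formInclusion p (testGraph p a)‖ ^ 2 + ‖formInclusion p (testGraph p b)‖ ^ 2 := by
  rw [map_add, map_smul]
  exact norm_sq_add_I_smul (re_inner_fst_I a b)

theorem norm_sq_snd_add_I (a b : testSpace d) :
    ‖((testGraph p a + Complex.I • testGraph p b : formDomain p) :
      WithLp 2 (L2 p × L2Field p)).snd‖ ^ 2 =
      dirichlet p (a : Space d → ℝ) + dirichlet p (b : Space d → ℝ) := by
  rw [← norm_sq_testGraph_snd (p := p) a, ← norm_sq_testGraph_snd (p := p) b]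
  exact norm_sq_add_I_smul (re_inner_snd_I a b)

theorem norm_sq_testGraph_add_I (a b : testSpace d) :
    ‖testGraph p a + Complex.I • testGraph p b‖ ^ 2 =
      ‖testGraph p a‖ ^ 2 + ‖testGraph p b‖ ^ 2 := by
  rw [norm_sq_formDomain, norm_sq_fst_add_I, norm_sq_snd_add_I, norm_sq_formDomain,
    norm_sq_formDomain, norm_sq_testGraph_snd, norm_sq_testGraph_snd]
  ring

/-- Test functions are a core of the form. -/
theorem exists_testGraph_near (w : formDomain p) {ε : ℝ} (hε : 0 < ε) :
    ∃ a b : testSpace d, ‖w - (testGraph p a + Complex.I • testGraph p b)‖ < ε := by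
  -- Before taking the closure, every element of the span is already of the form a + I b with a, b
  -- real test functions.
  have hspan : ∀ z ∈ Submodule.span ℂ {w : WithLp 2 (L2 p × L2Field p) |
      ∃ g : Space d → ℂ, IsTest g ∧ (w.fst : Space d → ℂ) =ᵐ[p] g ∧
      (w.snd : Space d → EuclideanSpace ℂ (Fin d)) =ᵐ[p] complexGradient g},
      ∃ a b : testSpace d, z = ((testGraph p a + Complex.I • testGraph p b : formDomain p) :
        WithLp 2 (L2 p × L2Field p)) := by
    intro z hz
    induction hz using Submodule.span_induction with
    | mem z hz =>
      obtain ⟨g, hg, h1, h2⟩ := hz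
      have hre : IsTest (fun x => Complex.reCLM (g x)) := hg.clm_comp _
      have him : IsTest (fun x => Complex.imCLM (g x)) := hg.clm_comp _
      refine ⟨⟨_, hre⟩, ⟨_, him⟩, ?_⟩
      set a : testSpace d := ⟨_, hre⟩
      set b : testSpace d := ⟨_, him⟩
      apply (WithLp.equiv 2 _).injective
      refine Prod.ext (Lp.ext (h1.trans ?_)) (Lp.ext (h2.trans ?_))
      · refine Filter.EventuallyEq.trans ?_ (Lp.coeFn_add
          (testGraph p a : WithLp 2 (L2 p × L2Field p)).fst
          (Complex.I • (testGraph p b : WithLp 2 (L2 p × L2Field p)).fst)).symm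
        filter_upwards [testGraph_fst (p := p) a, testGraph_fst (p := p) b,
          Lp.coeFn_smul Complex.I (testGraph p b : WithLp 2 (L2 p × L2Field p)).fst] with x e1 e2 e3
        rw [Pi.add_apply, e3, Pi.smul_apply, e1, e2, smul_eq_mul, mul_comm]
        exact (Complex.re_add_im (g x)).symm
      · refine Filter.EventuallyEq.trans ?_ (Lp.coeFn_add
          (testGraph p a : WithLp 2 (L2 p × L2Field p)).snd
          (Complex.I • (testGraph p b : WithLp 2 (L2 p × L2Field p)).snd)).symm
        filter_upwards [testGraph_snd (p := p) a, testGraph_snd (p := p) b,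
          Lp.coeFn_smul Complex.I (testGraph p b : WithLp 2 (L2 p × L2Field p)).snd] with x e1 e2 e3
        rw [Pi.add_apply, e3, Pi.smul_apply, e1, e2, ← complexGradient_ofReal hre,
          ← complexGradient_ofReal him]
        have f1 : ∀ (L : ℂ →L[ℝ] ℂ) , fderiv ℝ (fun y => L (g y)) x = L.comp (fderiv ℝ g x) :=
          fun L => (L.hasFDerivAt.comp x (hg.differentiable x).hasFDerivAt).fderiv
        ext i
        have g1 := f1 (Complex.ofRealCLM.comp Complex.reCLM)
        have g2 := f1 (Complex.ofRealCLM.comp Complex.imCLM)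
        simp only [ContinuousLinearMap.comp_apply] at g1 g2
        simp only [complexGradient, PiLp.add_apply, PiLp.smul_apply, g1, g2,
          ContinuousLinearMap.comp_apply, smul_eq_mul]
        rw [mul_comm]
        exact (Complex.re_add_im _).symm
    | zero =>
      refine ⟨0, 0, ?_⟩
      have : testGraph p (0 : testSpace d) = 0 := by
        have := testGraph_smul (p := p) 0 (0 : testSpace d)
        simpa using this
      simp [this]
    | add x y _ _ hx hy =>
      obtain ⟨a, b, rfl⟩ := hx
      obtain ⟨a', b', rfl⟩ := hy
      refine ⟨a + a', b + b', ?_⟩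
      rw [← Submodule.coe_add, testGraph_add, testGraph_add]
      congr 1
      module
    | smul c x _ hx =>
      obtain ⟨a, b, rfl⟩ := hx
      refine ⟨c.re • a + (-c.im) • b, c.re • b + c.im • a, ?_⟩
      rw [← Submodule.coe_smul, testGraph_add, testGraph_add, testGraph_smul, testGraph_smul,
        testGraph_smul, testGraph_smul]
      congr 1
      have hI : c * Complex.I = Complex.I * c.re - c.im := by
        nth_rewrite 1 [← Complex.re_add_im c]
        linear_combination (c.im : ℂ) * Complex.I_mul_I
      rw [smul_add, smul_smul, hI]
      nth_rewrite 1 [← Complex.re_add_im c]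
      push_cast
      module
  have hw := w.2
  unfold formDomain at hw
  rw [← SetLike.mem_coe, Submodule.topologicalClosure_coe, Metric.mem_closure_iff] at hw
  obtain ⟨z, hz, hd⟩ := hw ε hε
  obtain ⟨a, b, rfl⟩ := hspan z hz
  refine ⟨a, b, ?_⟩
  rw [dist_eq_norm] at hd
  exact hd

end FormDomain

/-! ### Real functions and the spectral gap of the semigroup -/

section Reality

variable {d : ℕ} {p : Measure (Space d)}

/-- The inclusion of real into complex square integrable functions. -/
def ofRealL (p : Measure (Space d)) : Lp ℝ 2 p →L[ℝ] L2 p := Complex.ofRealCLM.compLpL 2 p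

/-- The imaginary part of a square integrable function. -/
def imL (p : Measure (Space d)) : L2 p →L[ℝ] Lp ℝ 2 p := Complex.imCLM.compLpL 2 p

theorem coeFn_ofRealL (h : Lp ℝ 2 p) :
    (ofRealL p h : Space d → ℂ) =ᵐ[p] fun x => ((h x : ℝ) : ℂ) :=
  Complex.ofRealCLM.coeFn_compLpL h

theorem coeFn_imL (u : L2 p) : (imL p u : Space d → ℝ) =ᵐ[p] fun x => (u x).im :=
  Complex.imCLM.coeFn_compLpL u

theorem norm_ofRealL (h : Lp ℝ 2 p) : ‖ofRealL p h‖ = ‖h‖ := by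
  have h1 : ‖ofRealL p h‖ ^ 2 = ‖h‖ ^ 2 := by
    rw [norm_sq_L2, norm_sq_real_L2]
    refine integral_congr_ae ?_
    filter_upwards [coeFn_ofRealL h] with x hx
    rw [hx]
    simp
  exact (sq_eq_sq₀ (norm_nonneg _) (norm_nonneg _)).1 h1

theorem exists_ofRealL_of_imL {u : L2 p} (hu : imL p u = 0) : ∃ h, u = ofRealL p h := by
  refine ⟨Complex.reCLM.compLpL 2 p u, Lp.ext ?_⟩
  have h0 : (imL p u : Space d → ℝ) =ᵐ[p] 0 := by
    rw [hu]
    exact Lp.coeFn_zero ℝ 2 p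
  filter_upwards [coeFn_imL u, h0, coeFn_ofRealL (Complex.reCLM.compLpL 2 p u),
    Complex.reCLM.coeFn_compLpL u] with x h1 h2 h3 h4
  rw [h1] at h2
  rw [h3, h4]
  exact Complex.ext (by simp) (by simpa using h2)

theorem re_inner_I_ofRealL (u h : Lp ℝ 2 p) :
    (inner ℂ (Complex.I • ofRealL p u) (ofRealL p h)).re = 0 := by
  rw [re_inner_L2]
  refine integral_eq_zero_of_ae ?_
  filter_upwards [coeFn_ofRealL u, coeFn_ofRealL h,
    Lp.coeFn_smul Complex.I (ofRealL p u)] with x h1 h2 h3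
  rw [h3, Pi.smul_apply, h1, h2]
  simp

variable [IsFiniteMeasure p]

theorem imL_testGraph (a : testSpace d) : imL p (formInclusion p (testGraph p a)) = 0 := by
  refine Lp.ext ?_
  filter_upwards [coeFn_imL (formInclusion p (testGraph p a)), testGraph_fst (p := p) a,
    Lp.coeFn_zero ℝ 2 p] with x h1 h2 h3
  have h2' : (formInclusion p (testGraph p a) : Space d → ℂ) x = ((a : Space d → ℝ) x : ℂ) := h2
  rw [h1, h3, h2']
  simp

/-- Solutions of the resolvent equation with real data are limits of real test functions. -/
theorem exists_real_testGraph_near (h : Lp ℝ 2 p) {ε : ℝ} (hε : 0 < ε) :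
    ∃ a : testSpace d,
      ‖ContinuousLinearMap.adjoint (formInclusion p) (ofRealL p h) - testGraph p a‖ < ε := by
  set u := ContinuousLinearMap.adjoint (formInclusion p) (ofRealL p h) with hu
  obtain ⟨a, b, hab⟩ := exists_testGraph_near u hε
  refine ⟨a, lt_of_le_of_lt ?_ hab⟩
  -- Expanding both distances, the cross term of I b with u is the real part of ⟨I b, h⟩ in L²,
  -- which vanishes as b and h are real. Dropping b therefore only removes ‖b‖², and it need not be
  -- known beforehand that u is real.
  have e1 := norm_sub_sq (𝕜 := ℂ) (testGraph p a + Complex.I • testGraph p b) u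
  have e2 := norm_sub_sq (𝕜 := ℂ) (testGraph p a) u
  obtain ⟨b', hb'⟩ := exists_ofRealL_of_imL (imL_testGraph (p := p) b)
  have e3 : (inner ℂ (Complex.I • testGraph p b) u).re = 0 := by
    rw [hu, ContinuousLinearMap.adjoint_inner_right, map_smul, hb']
    exact re_inner_I_ofRealL _ _
  rw [inner_add_left, norm_sq_testGraph_add_I] at e1
  simp only [RCLike.re_to_complex, Complex.add_re] at e1 e2
  rw [e3] at e1
  rw [norm_sub_rev u, norm_sub_rev u]
  refine abs_le_of_sq_le_sq' ?_ (norm_nonneg _) |>.2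
  rw [e1, e2]
  nlinarith [sq_nonneg ‖testGraph p b‖]

theorem resolvent_eq : resolvent p = formInclusion p ∘L ContinuousLinearMap.adjoint (formInclusion p) :=
  rfl

theorem exists_resolvent_ofRealL (h : Lp ℝ 2 p) :
    ∃ h', resolvent p (ofRealL p h) = ofRealL p h' := by
  apply exists_ofRealL_of_imL
  have hcl : IsClosed {v : L2 p | imL p v = 0} := isClosed_singleton.preimage (imL p).continuous
  have : resolvent p (ofRealL p h) ∈ closure {v : L2 p | imL p v = 0} := by
    rw [Metric.mem_closure_iff]
    intro ε hε
    obtain ⟨a, ha⟩ := exists_real_testGraph_near h hε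
    refine ⟨formInclusion p (testGraph p a), imL_testGraph a, ?_⟩
    rw [dist_eq_norm, resolvent_eq, ContinuousLinearMap.comp_apply, ← map_sub]
    refine lt_of_le_of_lt ((formInclusion p).le_of_opNorm_le norm_formInclusion_le _) ?_
    rwa [one_mul]
  rwa [hcl.closure_eq] at this

theorem exists_resolvent_pow_ofRealL (N : ℕ) (h : Lp ℝ 2 p) :
    ∃ h', (resolvent p ^ N) (ofRealL p h) = ofRealL p h' ∧ ‖h'‖ ≤ ‖h‖ := by
  induction N with
  | zero => exact ⟨h, rfl, le_rfl⟩
  | succ N ih =>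
    obtain ⟨h', h1, h2⟩ := ih
    obtain ⟨h'', h3⟩ := exists_resolvent_ofRealL h'
    refine ⟨h'', ?_, le_trans ?_ h2⟩
    · rw [pow_succ', mul_apply_eq_comp, h1, h3]
    · rw [← norm_ofRealL h'', ← h3, ← norm_ofRealL h']
      have := (resolvent p).le_of_opNorm_le
        (norm_comp_adjoint_le (formInclusion p) norm_formInclusion_le) (ofRealL p h')
      rwa [one_mul] at this

/-- A linear map into the form domain is approximated by one into the test functions. -/
theorem exists_linearMap_testGraph_near {V : Type*} [NormedAddCommGroup V] [NormedSpace ℝ V]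
    [FiniteDimensional ℝ V] (w : V →ₗ[ℝ] formDomain p)
    (hw : ∀ v, ∀ ε > 0, ∃ a : testSpace d, ‖w v - testGraph p a‖ < ε) {δ : ℝ} (hδ : 0 < δ) :
    ∃ G : V →ₗ[ℝ] testSpace d, ∀ v, ‖w v - testGraph p (G v)‖ ≤ δ * ‖v‖ := by
  -- It suffices to approximate on a basis; M converts bounds on basis vectors into operator norm
  -- bounds, hence the tolerance δ/M.
  set b := Module.finBasis ℝ V
  obtain ⟨M, hM, hb⟩ := b.exists_opNorm_le (F := formDomain p)
  have hb' : ∀ (u : V →L[ℝ] formDomain p) (r : ℝ), 0 ≤ r → (∀ i, ‖u (b i)‖ ≤ r) →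
      ‖u‖ ≤ M * r := fun u r hr h => hb hr h
  choose a ha using fun i => hw (b i) (δ / M) (by positivity)
  set G : V →ₗ[ℝ] testSpace d := b.constr ℝ a
  let tg : testSpace d →ₗ[ℝ] formDomain p :=
    { toFun := testGraph p
      map_add' := testGraph_add
      map_smul' := fun c a => by
        rw [testGraph_smul]
        exact Complex.coe_smul c _ }
  refine ⟨G, fun v => ?_⟩
  set e := LinearMap.toContinuousLinearMap (w - tg ∘ₗ G) with he
  have h1 : ‖e‖ ≤ M * (δ / M) := by
    refine hb' _ _ (by positivity) fun i => ?_
    have h2 : e (b i) = w (b i) - testGraph p (a i) := by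
      simp [he, G, tg]
    rw [h2]
    exact (ha i).le
  rw [mul_div_cancel₀ _ hM.ne'] at h1
  exact e.le_of_opNorm_le h1 v

end Reality

/-! ### From Rayleigh quotients of the semigroup to those of the generator. -/

section SpectralGap

variable {d : ℕ} {f : Space d → ℝ}

/-- Here W and J are the form norm and the L² norm of a vector, W' and J' those of its
approximation, E the energy of the latter and x the size of the source vector. A perturbation of
size δx costs at most 5δx² ≤ (η/2)x² of the gap. Since J' ≤ 2x, what remains is at least (η/8)J'²,
and 1/r₀ = 1 + 1/C turns this into a Rayleigh quotient strictly below 1/C. -/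
theorem rayleigh_of_near {C η δ x W J W' J' E : ℝ} (hC : 0 < C) (hηpos : 0 < η)
    (hδpos : 0 < δ) (hδ1 : δ ≤ 1) (hδη : δ ≤ η / 10) (hx : 0 < x) (n2 : 0 ≤ J)
    (n3 : 0 ≤ W') (n4 : 0 ≤ J') (g5 : -(δ * x) ≤ W - W' ∧ W - W' ≤ δ * x)
    (g6 : -(δ * x) ≤ J - J' ∧ J - J' ≤ δ * x)
    (g7 : η * x ^ 2 ≤ J ^ 2 - C / (1 + C) * W ^ 2) (g8 : W ≤ x) (g9 : J ≤ x)
    (g3 : W' ^ 2 = J' ^ 2 + E) :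
    0 < J' ^ 2 ∧ E ≤ (1 / C - η / (8 * (C / (1 + C)))) * J' ^ 2 := by
  have hr₀ : 0 < C / (1 + C) := by positivity
  have hr₁ : C / (1 + C) < 1 := by
    rw [div_lt_one (by positivity)]
    linarith
  obtain ⟨r₀, hr₀'⟩ : ∃ r₀, r₀ = C / (1 + C) := ⟨_, rfl⟩
  rw [← hr₀'] at hr₀ hr₁ g7 ⊢
  have b1 : J ^ 2 - 2 * δ * x ^ 2 ≤ J' ^ 2 := by
    rcases le_or_gt (δ * x) J with h | h
    · have : (J - δ * x) ^ 2 ≤ J' ^ 2 := by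
        apply pow_le_pow_left₀ (by linarith)
        linarith
      nlinarith [mul_nonneg (mul_nonneg hδpos.le hx.le) (sub_nonneg.2 g9), sq_nonneg (δ * x)]
    · nlinarith [mul_pos hδpos hx, sq_nonneg J']
  have b2 : W' ^ 2 ≤ W ^ 2 + 3 * δ * x ^ 2 := by
    have : W' ^ 2 ≤ (W + δ * x) ^ 2 := pow_le_pow_left₀ n3 (by linarith) 2
    have h1 : δ * x * W ≤ δ * x * x := by gcongr
    have h2 : δ * x * (δ * x) ≤ δ * x * (1 * x) := by gcongr
    nlinarith
  have b3 : J' ^ 2 ≤ 4 * x ^ 2 := by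
    have : J' ≤ 2 * x := by nlinarith
    nlinarith
  have b4 : r₀ * W' ^ 2 ≤ r₀ * W ^ 2 + 3 * δ * x ^ 2 := by
    have h1 : r₀ * W' ^ 2 ≤ r₀ * (W ^ 2 + 3 * δ * x ^ 2) := by gcongr
    have h2 : r₀ * (3 * δ * x ^ 2) ≤ 1 * (3 * δ * x ^ 2) := by gcongr
    linarith
  have b5 : η / 2 * x ^ 2 ≤ J' ^ 2 - r₀ * W' ^ 2 := by nlinarith [sq_nonneg x]
  have b6 : 0 < η / 2 * x ^ 2 := by positivity
  have b7 : 0 ≤ r₀ * W' ^ 2 := by positivity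
  refine ⟨by linarith, ?_⟩
  have b8 : r₀ * W' ^ 2 ≤ (1 - η / 8) * J' ^ 2 := by nlinarith
  have b9 : 1 / C - η / (8 * r₀) = (1 - η / 8) / r₀ - 1 := by
    simp only [hr₀']
    field_simp
    ring
  rw [b9, sub_mul, div_mul_eq_mul_div, one_mul]
  have b10 : W' ^ 2 ≤ (1 - η / 8) * J' ^ 2 / r₀ := by
    rw [le_div_iff₀ hr₀]
    linarith
  linarith

theorem norm_formInclusion_apply_le {p : Measure (Space d)} [IsFiniteMeasure p]
    (u : formDomain p) : ‖formInclusion p u‖ ≤ ‖u‖ := by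
  have := (formInclusion p).le_of_opNorm_le norm_formInclusion_le u
  rwa [one_mul] at this

/-- Powers of the resolvent on real functions, as elements of the form domain. -/
def smoothing (p : Measure (Space d)) (N : ℕ) : Lp ℝ 2 p →ₗ[ℝ] formDomain p where
  toFun v := ContinuousLinearMap.adjoint (formInclusion p) ((resolvent p ^ N) (ofRealL p v))
  map_add' u v := by simp
  map_smul' c v := by
    have h1 : ofRealL p (c • v) = (c : ℂ) • ofRealL p v := by
      rw [map_smul]
      exact (Complex.coe_smul c _).symm
    rw [h1, map_smul, map_smul]
    exact Complex.coe_smul c _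

theorem smoothing_apply (p : Measure (Space d)) (N : ℕ) (v : Lp ℝ 2 p) : smoothing p N v =
    ContinuousLinearMap.adjoint (formInclusion p) ((resolvent p ^ N) (ofRealL p v)) := rfl

theorem norm_smoothing_le {p : Measure (Space d)} [IsFiniteMeasure p] (N : ℕ) (v : Lp ℝ 2 p) :
    ‖smoothing p N v‖ ≤ ‖v‖ := by
  obtain ⟨h', h1, h2⟩ := exists_resolvent_pow_ofRealL N v
  rw [smoothing_apply, h1]
  have h3 : ‖ContinuousLinearMap.adjoint (formInclusion p)‖ ≤ 1 := by
    rw [LinearIsometryEquiv.norm_map]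
    exact norm_formInclusion_le
  have h4 := (ContinuousLinearMap.adjoint (formInclusion p)).le_of_opNorm_le h3 (ofRealL p h')
  rw [one_mul, norm_ofRealL] at h4
  exact h4.trans h2

theorem exists_testGraph_near_smoothing {p : Measure (Space d)} [IsFiniteMeasure p] (N : ℕ)
    (v : Lp ℝ 2 p) {ε : ℝ} (hε : 0 < ε) :
    ∃ a : testSpace d, ‖smoothing p N v - testGraph p a‖ < ε := by
  obtain ⟨h', h1, -⟩ := exists_resolvent_pow_ofRealL N v
  rw [smoothing_apply, h1]
  exact exists_real_testGraph_near h' hε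

/-- The number C/(1+C) = 1/(1 + 1/C) is the resolvent value of generator energy 1/C. An intermediate
s' between exp(-t/C) and s makes the gap η uniform in v, so that it survives approximation by test
functions. -/
theorem exists_smoothing_gap {p : Measure (Space d)} [IsFiniteMeasure p] {C t : ℝ}
    (hC : 0 < C) (ht : 0 < t) {s : ℝ} (hs : Real.exp (-t / C) < s) :
    ∃ (N : ℕ) (η : ℝ), 0 < η ∧ ∀ v : Lp ℝ 2 p,
      s * ‖v‖ ^ 2 ≤ cfcForm (resolvent p) (semigroupFun t) (ofRealL _ v) →
      η * ‖v‖ ^ 2 ≤ ‖formInclusion p (smoothing p N v)‖ ^ 2 -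
        C / (1 + C) * ‖smoothing p N v‖ ^ 2 := by
  obtain ⟨s', hs1, hs2⟩ := exists_between hs
  have hr₀ : 0 < C / (1 + C) := by positivity
  have hsg : semigroupFun t (C / (1 + C)) < s' := by
    rw [semigroupFun_of_pos t hr₀]
    convert hs1 using 2
    field_simp
    ring
  obtain ⟨N, K, hK, hform⟩ :=
    exists_pow_form_bound (formInclusion p) norm_formInclusion_le ht hr₀ hsg
  refine ⟨N, (s - s') / K, div_pos (by linarith) hK, fun v hv => ?_⟩
  have h2 := hform (ofRealL p v)
  rw [norm_ofRealL, ← resolvent_eq, ← smoothing_apply] at h2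
  have h3 := hv.trans h2
  rw [div_mul_eq_mul_div, div_le_iff₀ hK]
  linarith

/-- A space on which the semigroup has large Rayleigh quotients is mapped by a power of the
resolvent, and approximation, to a space of test functions with small Rayleigh quotients. -/
theorem exists_test_rayleigh_le {p : Measure (Space d)} [IsFiniteMeasure p] {C t : ℝ}
    (hC : 0 < C) (ht : 0 < t) (V : Submodule ℝ (Lp ℝ 2 p)) [FiniteDimensional ℝ V] {s : ℝ}
    (hs : Real.exp (-t / C) < s)
    (hcon : ∀ v ∈ V, s * ‖v‖ ^ 2 ≤ cfcForm (resolvent p) (semigroupFun t) (ofRealL _ v)) :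
    ∃ κ : ℝ, 0 < κ ∧ ∃ G : V →ₗ[ℝ] testSpace d, ∀ v : V, v ≠ 0 →
      0 < ∫ x, (G v : Space d → ℝ) x ^ 2 ∂p ∧
      dirichlet p (G v : Space d → ℝ) ≤
        (1 / C - κ) * ∫ x, (G v : Space d → ℝ) x ^ 2 ∂p := by
  obtain ⟨N, η, hηpos, hgap⟩ := exists_smoothing_gap (p := p) hC ht hs
  obtain ⟨G, hG⟩ := exists_linearMap_testGraph_near (smoothing p N ∘ₗ V.subtype)
    (fun v ε hε => exists_testGraph_near_smoothing N (v : Lp ℝ 2 p) hε)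
    (lt_min one_pos (by positivity : 0 < η / 10))
  refine ⟨η / (8 * (C / (1 + C))), by positivity, G, fun v hv => ?_⟩
  have g1 : ‖smoothing p N v - testGraph p (G v)‖ ≤ min 1 (η / 10) * ‖(v : Lp ℝ 2 p)‖ := hG v
  have g2 := norm_formInclusion_apply_le (smoothing p N v - testGraph p (G v))
  rw [map_sub] at g2
  have g3 := norm_sq_formDomain (testGraph p (G v))
  rw [norm_sq_testGraph_snd] at g3
  rw [← norm_sq_formInclusion_testGraph (p := p) (G v)]
  have hx : 0 < ‖(v : Lp ℝ 2 p)‖ := norm_pos_iff.2 fun h => hv (Subtype.ext h)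
  exact rayleigh_of_near hC hηpos (lt_min one_pos (by positivity)) (min_le_left _ _)
    (min_le_right _ _) hx (norm_nonneg _) (norm_nonneg _) (norm_nonneg _)
    (abs_le.1 ((abs_norm_sub_norm_le _ _).trans g1))
    (abs_le.1 ((abs_norm_sub_norm_le _ _).trans (g2.trans g1)))
    (hgap v (hcon v v.2)) (norm_smoothing_le N _)
    ((norm_formInclusion_apply_le _).trans (norm_smoothing_le N _)) g3

/-- The eigenvalues of the semigroup in terms of those of its generator. -/
theorem exists_cfcForm_lt_of_generatorEigenvalue [IsFiniteMeasure (gibbs f)] {C t : ℝ}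
    (hC : 0 < C) (ht : 0 < t) {n : ℕ}
    (hgen : ((1 / C : ℝ) : EReal) ≤ generatorEigenvalue f (n + 1))
    (V : Submodule ℝ (Lp ℝ 2 (gibbs f))) (hV : Module.finrank ℝ V = n + 1) {s : ℝ}
    (hs : Real.exp (-t / C) < s) :
    ∃ v ∈ V, cfcForm (resolvent (gibbs f)) (semigroupFun t) (ofRealL _ v) < s * ‖v‖ ^ 2 := by
  by_contra hcon
  push Not at hcon
  have hfin : FiniteDimensional ℝ V := Module.finite_of_finrank_pos (by rw [hV]; omega)
  obtain ⟨κ, hκ, G, hest⟩ := exists_test_rayleigh_le hC ht V hs hcon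
  set G' : V →ₗ[ℝ] (Space d → ℝ) := (testSpace d).subtype ∘ₗ G with hG'
  have hinj : Function.Injective G' := by
    rw [injective_iff_map_eq_zero]
    intro v hv
    by_contra hne
    have h1 := (hest v hne).1
    have h2 : (G v : Space d → ℝ) = 0 := hv
    simp [h2] at h1
  -- The image of V is an admissible (n+1)-dimensional space of test functions, and the uniform κ
  -- keeps its supremum of Rayleigh quotients strictly below 1/C.
  have hle : generatorEigenvalue f (n + 1) ≤ ((1 / C - κ : ℝ) : EReal) := by
    refine iInf_le_of_le (LinearMap.range G') (iInf_le_of_le ?_ (iInf_le_of_le ?_ ?_))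
    · rintro _ ⟨v, rfl⟩
      exact (G v).2
    · rw [LinearMap.finrank_range_of_inj hinj, hV]
    · refine iSup_le fun g => iSup_le fun hg => iSup_le fun hne => ?_
      obtain ⟨v, rfl⟩ := hg
      have hv : v ≠ 0 := fun h => hne (by rw [h, map_zero])
      rw [EReal.coe_le_coe_iff]
      exact (div_le_iff₀ (hest v hv).1).2 (hest v hv).2
  have h3 := hgen.trans hle
  rw [EReal.coe_le_coe_iff] at h3
  linarith

end SpectralGap

/-! ### Small sets have large conductance -/

section Cutoff

/-- A smooth function with Lipschitz constant `1`, vanishing on `(-∞, 1/2]`, with value `1/4`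
at `1`. -/
def cutoff (t : ℝ) : ℝ := Real.exp 2 / 4 * expNegInvGlue (t - 1 / 2)

theorem cutoff_of_le {t : ℝ} (ht : t ≤ 1 / 2) : cutoff t = 0 := by
  rw [cutoff, expNegInvGlue.zero_of_nonpos (by linarith), mul_zero]

theorem cutoff_one : cutoff 1 = 1 / 4 := by
  rw [cutoff, expNegInvGlue, if_neg (by norm_num), div_mul_eq_mul_div, ← Real.exp_add]
  norm_num

theorem contDiff_cutoff : ContDiff ℝ ∞ cutoff :=
  contDiff_const.mul (expNegInvGlue.contDiff.comp (contDiff_id.sub contDiff_const))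

theorem differentiable_cutoff : Differentiable ℝ cutoff := contDiff_cutoff.differentiable (by simp)

/-- With y = 1/(t - 1/2) the derivative is (e²/4)y²exp(-y), whose maximum, at y = 2, is exactly 1.
This fixes the constant in `cutoff`. -/
theorem abs_deriv_cutoff_le (t : ℝ) : |deriv cutoff t| ≤ 1 := by
  have h := expNegInvGlue.hasDerivAt_polynomial_eval_inv_mul 1 (t - 1 / 2)
  simp only [Polynomial.eval_one, one_mul, Polynomial.derivative_one, sub_zero, mul_one,
    Polynomial.eval_pow, Polynomial.eval_X] at h
  have h2 : HasDerivAt cutoff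
      (Real.exp 2 / 4 * ((t - 1 / 2)⁻¹ ^ 2 * expNegInvGlue (t - 1 / 2))) t :=
    (h.comp_sub_const t (1 / 2)).const_mul _
  rw [h2.deriv]
  rcases le_or_gt (t - 1 / 2) 0 with h0 | h0
  · rw [expNegInvGlue.zero_of_nonpos h0]
    simp
  · rw [expNegInvGlue, if_neg (not_le.2 h0)]
    set y := (t - 1 / 2)⁻¹
    have hy : 0 < y := inv_pos.2 h0
    rw [abs_of_nonneg (by positivity)]
    have h3 : y / 2 ≤ Real.exp (y / 2 - 1) := by
      have := Real.add_one_le_exp (y / 2 - 1)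
      linarith
    have h4 : (y / 2) ^ 2 ≤ Real.exp (y - 2) := by
      calc (y / 2) ^ 2 ≤ Real.exp (y / 2 - 1) ^ 2 := pow_le_pow_left₀ (by positivity) h3 2
        _ = Real.exp (y - 2) := by
          rw [← Real.exp_nat_mul]
          congr 1
          push_cast
          ring
    calc Real.exp 2 / 4 * (y ^ 2 * Real.exp (-y)) =
        (y / 2) ^ 2 * (Real.exp 2 * Real.exp (-y)) := by ring
      _ ≤ Real.exp (y - 2) * (Real.exp 2 * Real.exp (-y)) := by gcongr
      _ = 1 := by
        rw [← Real.exp_add, ← Real.exp_add, show y - 2 + (2 + -y) = 0 by ring, Real.exp_zero]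

theorem abs_cutoff_sub_le (s t : ℝ) : |cutoff s - cutoff t| ≤ |s - t| := by
  have h : LipschitzWith 1 cutoff := lipschitzWith_of_nnnorm_deriv_le differentiable_cutoff
    fun x => by
      rw [← NNReal.coe_le_coe]
      simpa using abs_deriv_cutoff_le x
  have := h.dist_le_mul s t
  simpa [Real.dist_eq] using this

end Cutoff

section SmallSets

variable {d : ℕ} {p : Measure (Space d)}

theorem dirichlet_nonneg (g : Space d → ℝ) : 0 ≤ dirichlet p g :=
  integral_nonneg fun _ => sq_nonneg _

theorem IsTest.integrable_gradient_sq [IsFiniteMeasure p] {a : Space d → ℝ} (ha : IsTest a) :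
    Integrable (fun x => ‖gradient a x‖ ^ 2) p := by
  have h1 : Continuous (fderiv ℝ a) := ha.1.continuous_fderiv (by simp)
  have h2 : ∀ x, ‖gradient a x‖ = ‖fderiv ℝ a x‖ := fun x => by
    rw [gradient, LinearIsometryEquiv.norm_map]
  simp only [h2]
  have h3 : HasCompactSupport (fderiv ℝ a) := ha.2.fderiv (𝕜 := ℝ)
  have h4 : HasCompactSupport fun x => ‖fderiv ℝ a x‖ ^ 2 :=
    h3.norm.comp_left (g := fun r : ℝ => r ^ 2) (by norm_num)
  have h5 : Continuous fun x => ‖fderiv ℝ a x‖ ^ 2 := h1.norm.pow 2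
  exact h5.integrable_of_hasCompactSupport h4

theorem IsTest.cutoff_comp {a : Space d → ℝ} (ha : IsTest a) : IsTest (fun x => cutoff (a x)) :=
  ⟨contDiff_cutoff.comp ha.1, ha.2.comp_left (g := cutoff) (cutoff_of_le (by norm_num))⟩

theorem dirichlet_cutoff_le [IsFiniteMeasure p] {a : Space d → ℝ} (ha : IsTest a) :
    dirichlet p (fun x => cutoff (a x)) ≤ dirichlet p a := by
  refine integral_mono_of_nonneg (Filter.Eventually.of_forall fun _ => sq_nonneg _)
    ha.integrable_gradient_sq (Filter.Eventually.of_forall fun x => ?_)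
  have h : fderiv ℝ (fun x => cutoff (a x)) x = deriv cutoff (a x) • fderiv ℝ a x :=
    ((differentiable_cutoff (a x)).hasDerivAt.comp_hasFDerivAt x
      (ha.differentiable x).hasFDerivAt).fderiv
  refine pow_le_pow_left₀ (norm_nonneg _) ?_ 2
  rw [gradient, gradient, LinearIsometryEquiv.norm_map, LinearIsometryEquiv.norm_map, h, norm_smul]
  exact mul_le_of_le_one_left (norm_nonneg _) (abs_deriv_cutoff_le _)

/-- The function `cutoff ∘ a` is as close to (1/4)·1_A as a is to 1_A, because `cutoff` is
1-Lipschitz, and (1/4)·1_A has variance of order p(A) when p(A) ≤ 1/2. -/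
theorem variance_cutoff_ge [IsProbabilityMeasure p] {a : Space d → ℝ} (ha : IsTest a)
    {A : Set (Space d)} (hA : MeasurableSet A) (hle : p.real A ≤ 1 / 2) :
    p.real A / 64 - ∫ x, (a x - A.indicator 1 x) ^ 2 ∂p ≤
      variance (fun x => cutoff (a x)) p := by
  have hX := ha.cutoff_comp.memLp p
  have hind : MemLp (A.indicator (1 : Space d → ℝ)) 2 p := (memLp_const (1 : ℝ)).indicator hA
  rw [variance_eq_integral hX.aestronglyMeasurable.aemeasurable]
  set m := ∫ x, cutoff (a x) ∂p
  set q := p.real A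
  have hq : 0 ≤ q := measureReal_nonneg
  have i1 : Integrable (fun x => (cutoff (a x) - m) ^ 2) p :=
    (hX.sub (memLp_const m)).integrable_sq
  have i2 : Integrable (fun x => (a x - A.indicator 1 x) ^ 2) p :=
    ((ha.memLp p).sub hind).integrable_sq
  have i3 : Integrable (fun x => A.indicator (1 : Space d → ℝ) x) p := hind.integrable (by norm_num)
  have hind2 : ∫ x, A.indicator (1 : Space d → ℝ) x ∂p = q := integral_indicator_one hA
  -- The bracket is (1_A/4 - m)² expanded; the inequality is (u + v)² ≤ 2u² + 2v² together with the
  -- Lipschitz bound.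
  have hpt : ∀ x, (m ^ 2 + (1 / 16 - m / 2) * A.indicator 1 x) / 2 - (a x - A.indicator 1 x) ^ 2 ≤
      (cutoff (a x) - m) ^ 2 := by
    intro x
    have h0 : cutoff 0 = 0 := cutoff_of_le (by norm_num)
    by_cases hx : x ∈ A
    · have h1 := abs_cutoff_sub_le (a x) 1
      rw [cutoff_one] at h1
      have h2 := sq_le_sq.2 h1
      simp only [hx, Set.indicator_of_mem, Pi.one_apply]
      nlinarith [sq_nonneg (cutoff (a x) - 1 / 4 + (cutoff (a x) - m))]
    · have h1 := abs_cutoff_sub_le (a x) 0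
      rw [h0] at h1
      have h2 := sq_le_sq.2 h1
      simp only [hx, not_false_eq_true, Set.indicator_of_notMem]
      nlinarith [sq_nonneg (cutoff (a x) + (cutoff (a x) - m))]
  have i5 : Integrable (fun x => m ^ 2 + (1 / 16 - m / 2) * A.indicator 1 x) p :=
    (integrable_const (m ^ 2)).add (i3.const_mul (1 / 16 - m / 2))
  have i4 : Integrable (fun x => (m ^ 2 + (1 / 16 - m / 2) * A.indicator 1 x) / 2) p :=
    i5.div_const 2
  have hint := integral_mono (i4.sub i2) i1 hpt
  have e1 : ∫ x, ((m ^ 2 + (1 / 16 - m / 2) * A.indicator 1 x) / 2 -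
      (a x - A.indicator 1 x) ^ 2) ∂p =
      (m ^ 2 + (1 / 16 - m / 2) * q) / 2 - ∫ x, (a x - A.indicator 1 x) ^ 2 ∂p := by
    rw [integral_sub i4 i2, integral_div, integral_add (integrable_const _) (i3.const_mul _), integral_const_mul,
      hind2]
    simp
  have hint' := e1.symm.le.trans hint
  -- Minimizing over m at q/4 leaves (q - q²)/32, at least q/64 for q ≤ 1/2.
  nlinarith [sq_nonneg (m - q / 4)]

theorem tsupport_cutoff_subset {a : Space d → ℝ} (ha : IsTest a) :
    tsupport (fun x => cutoff (a x)) ⊆ {x | 1 / 2 ≤ a x} := by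
  refine closure_minimal (fun x hx => ?_) (isClosed_le continuous_const ha.1.continuous)
  by_contra hlt
  exact hx (cutoff_of_le (not_le.1 hlt).le)

/-- Chebyshev: outside A, a point of the support has a ≥ 1/2, so the squared error there is at least
1/4. -/
theorem measureReal_tsupport_cutoff_le [IsProbabilityMeasure p] {a : Space d → ℝ} (ha : IsTest a)
    {A : Set (Space d)} (hA : MeasurableSet A) :
    p.real (tsupport (fun x => cutoff (a x))) ≤
      p.real A + 4 * ∫ x, (a x - A.indicator 1 x) ^ 2 ∂p := by
  have hind : MemLp (A.indicator (1 : Space d → ℝ)) 2 p := (memLp_const (1 : ℝ)).indicator hA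
  have i2 : Integrable (fun x => (a x - A.indicator 1 x) ^ 2) p :=
    ((ha.memLp p).sub hind).integrable_sq
  have h1 := mul_meas_ge_le_integral_of_nonneg
    (Filter.Eventually.of_forall fun x => sq_nonneg (a x - A.indicator 1 x)) i2 (1 / 4)
  have hsub : tsupport (fun x => cutoff (a x)) ⊆
      A ∪ {x | 1 / 4 ≤ (a x - A.indicator 1 x) ^ 2} := by
    intro x hx
    have h2 : 1 / 2 ≤ a x := tsupport_cutoff_subset ha hx
    by_cases hxA : x ∈ A
    · exact Or.inl hxA
    · refine Or.inr ?_
      simp only [hxA, Set.mem_ofPred_eq, not_false_eq_true, Set.indicator_of_notMem]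
      nlinarith
  have h3 := (measureReal_mono (μ := p) hsub).trans (measureReal_union_le _ _)
  linarith

/-- Indicators of small sets do not have good approximations of small energy. -/
theorem PoincareOnSmallSets.not_near [IsProbabilityMeasure p] {C μ T : ℝ} (hC : 0 < C)
    (hT : 0 < T) (hTC : T ≤ C / 2) (hμ : μ ≤ 1) (hP : PoincareOnSmallSets p (2 * C) μ)
    {a : Space d → ℝ} (ha : IsTest a) {A : Set (Space d)} (hA : MeasurableSet A)
    (hpos : 0 < p.real A) (hle : p.real A ≤ μ / 2)
    (h1 : ∫ x, (a x - A.indicator 1 x) ^ 2 ∂p ≤ T / (200 * C) * p.real A)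
    (h2 : T * dirichlet p a ≤ T / (200 * C) * p.real A) : False := by
  set q := p.real A
  have hx : T / (200 * C) ≤ 1 / 400 := by
    rw [div_le_div_iff₀ (by positivity) (by norm_num)]
    linarith
  have h3 : ∫ x, (a x - A.indicator 1 x) ^ 2 ∂p ≤ 1 / 400 * q :=
    h1.trans (mul_le_mul_of_nonneg_right hx hpos.le)
  have h4 := measureReal_tsupport_cutoff_le (p := p) ha hA
  have h5 := hP _ ha.cutoff_comp (by linarith)
  have h6 := variance_cutoff_ge (p := p) ha hA (by linarith)
  have h7 : dirichlet p a ≤ q / (200 * C) := by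
    have h8 : T * dirichlet p a ≤ T * (q / (200 * C)) := by
      calc _ ≤ _ := h2
        _ = _ := by ring
    exact le_of_mul_le_mul_left h8 hT
  have h9 := (h5.trans (dirichlet_cutoff_le ha)).trans h7
  rw [one_div, inv_mul_le_iff₀ (by positivity)] at h9
  have h10 : 2 * C * (q / (200 * C)) = q / 100 := by
    field_simp
    norm_num
  rw [h10] at h9
  -- The Poincaré inequality bounds the variance by q/100, whereas it is at least q/64 - q/400.
  linarith

/-- A Poincaré inequality on small sets gives a lower bound for the probability that the
semigroup leaves a small set. -/
theorem PoincareOnSmallSets.le_escape [IsProbabilityMeasure p] {C μ T : ℝ} (hC : 0 < C)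
    (hT : 0 < T) (hTC : T ≤ C / 2) (hμ : μ ≤ 1) (hP : PoincareOnSmallSets p (2 * C) μ)
    {A : Set (Space d)} (hA : MeasurableSet A) (hle : p.real A ≤ μ / 2) {v : L2 p}
    (hv : (v : Space d → ℂ) =ᵐ[p] A.indicator fun _ => (1 : ℂ)) :
    T / (200 * C) * p.real A ≤ ‖v‖ ^ 2 - cfcForm (resolvent p) (semigroupFun T) v := by
  by_contra hcon
  push Not at hcon
  obtain ⟨w, hw1, hw2⟩ := exists_form_near (formInclusion p) norm_formInclusion_le hT v
  rw [← resolvent_eq] at hw1 hw2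
  have hpos : 0 < p.real A := by
    rcases measureReal_nonneg (μ := p) (s := A) |>.eq_or_lt with h | h
    · rw [← h, mul_zero] at hcon
      nlinarith [sq_nonneg ‖formInclusion p w - v‖]
    · exact h
  set D := T / (200 * C) * p.real A
  -- The strict inequalities are an open condition in the form norm, so they pass from w to a nearby
  -- element of the core.
  have hopen : IsOpen {z : formDomain p | ‖formInclusion p z - v‖ ^ 2 < D ∧
      T * (‖z‖ ^ 2 - ‖formInclusion p z‖ ^ 2) < D} := by
    have c1 : Continuous fun z : formDomain p => ‖formInclusion p z - v‖ ^ 2 := by fun_prop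
    have c2 : Continuous fun z : formDomain p => T * (‖z‖ ^ 2 - ‖formInclusion p z‖ ^ 2) := by
      fun_prop
    exact (isOpen_lt c1 continuous_const).inter (isOpen_lt c2 continuous_const)
  obtain ⟨ε, hε, hball⟩ := Metric.isOpen_iff.1 hopen w ⟨hw1.trans_lt hcon, hw2.trans_lt hcon⟩
  obtain ⟨a, b, hab⟩ := exists_testGraph_near w hε
  obtain ⟨hz1, hz2⟩ := hball (show testGraph p a + Complex.I • testGraph p b ∈ Metric.ball w ε by
    rwa [Metric.mem_ball, dist_comm, dist_eq_norm])
  -- Energy and pointwise error both split into real and imaginary parts, so the real test function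
  -- a alone satisfies the two bounds.
  rw [norm_sq_formDomain, add_sub_cancel_left, norm_sq_snd_add_I] at hz2
  refine hP.not_near hC hT hTC hμ a.2 hA hpos hle (le_trans ?_ hz1.le) (le_trans ?_ hz2.le)
  · rw [norm_sq_L2]
    refine integral_mono_of_nonneg (Filter.Eventually.of_forall fun _ => sq_nonneg _) ?_ ?_
    · exact (Lp.memLp _).integrable_norm_pow (by norm_num)
    · rw [map_add, map_smul]
      filter_upwards [hv, testGraph_fst (p := p) a, testGraph_fst (p := p) b,
        Lp.coeFn_sub (formInclusion p (testGraph p a) +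
          Complex.I • formInclusion p (testGraph p b)) v,
        Lp.coeFn_add (formInclusion p (testGraph p a))
          (Complex.I • formInclusion p (testGraph p b)),
        Lp.coeFn_smul Complex.I (formInclusion p (testGraph p b))] with x e0 e1 e2 e3 e4 e5
      have e1' : (formInclusion p (testGraph p a) : Space d → ℂ) x =
        ((a : Space d → ℝ) x : ℂ) := e1
      have e2' : (formInclusion p (testGraph p b) : Space d → ℂ) x =
        ((b : Space d → ℝ) x : ℂ) := e2
      rw [e3, Pi.sub_apply, e4, Pi.add_apply, e5, Pi.smul_apply, e0, e1', e2', Complex.sq_norm,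
        Complex.normSq_apply]
      by_cases hx : x ∈ A
      · simp [hx]
        nlinarith [sq_nonneg ((b : Space d → ℝ) x)]
      · simp [hx]
        nlinarith [sq_nonneg ((b : Space d → ℝ) x)]
  · have := dirichlet_nonneg (p := p) (b : Space d → ℝ)
    nlinarith

end SmallSets

/-! ### The Langevin chain as an operator -/

section Chain

variable {d : ℕ} {p : Measure (Space d)} [IsProbabilityMeasure p]

theorem integral_comp_eq {Ω : Type*} [MeasurableSpace Ω] {κ : Kernel Ω Ω} {ν : Measure Ω}
    {g : Ω → ℝ} (hg : Integrable g (κ ∘ₘ ν)) :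
    Integrable (fun x => ∫ y, g y ∂(κ x)) ν ∧ ∫ y, g y ∂(κ ∘ₘ ν) = ∫ x, ∫ y, g y ∂(κ x) ∂ν := by
  rw [Measure.comp_eq_comp_const_apply] at hg ⊢
  have h1 := hg.integral_comp
  have h2 := ProbabilityTheory.Kernel.integral_comp hg
  rw [Kernel.const_apply] at h1 h2
  exact ⟨h1, h2⟩

theorem real_setIntegral_eq {Ω : Type*} [MeasurableSpace Ω] (κ : Kernel Ω Ω) [IsMarkovKernel κ]
    (ν : Measure Ω) (A : Set Ω) {B : Set Ω} (hB : MeasurableSet B) :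
    ∫ x in A, (κ x).real B ∂ν = (∫⁻ x in A, κ x B ∂ν).toReal :=
  integral_toReal (κ.measurable_coe hB).aemeasurable
    (Filter.Eventually.of_forall fun _ => measure_lt_top _ _)

/-- `κ` represents the operator `exp (t 𝓛)`. -/
def RepresentsSemigroup (p : Measure (Space d)) (t : ℝ) (κ : Kernel (Space d) (Space d)) : Prop :=
  ∀ S : Set (Space d), MeasurableSet S → ∀ h : L2 p,
    (h : Space d → ℂ) =ᵐ[p] S.indicator (fun _ => (1 : ℂ)) →
    (langevinOperator p t h : Space d → ℂ) =ᵐ[p] fun x => (((κ x).real S : ℝ) : ℂ)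

variable {t : ℝ} {κ : Kernel (Space d) (Space d)} [IsMarkovKernel κ]

theorem inner_langevinOperator_left (u v : L2 p) :
    inner ℂ (langevinOperator p t u) v = inner ℂ u (langevinOperator p t v) :=
  inner_cfc_left _ _ u v

theorem RepresentsSemigroup.inner_eq (h : RepresentsSemigroup p t κ) {A B : Set (Space d)}
    (hA : MeasurableSet A) (hB : MeasurableSet B) :
    inner ℂ (indicatorConstLp 2 hA (measure_ne_top p A) (1 : ℂ))
      (langevinOperator p t (indicatorConstLp 2 hB (measure_ne_top p B) (1 : ℂ))) =
      ((∫ x in A, (κ x).real B ∂p : ℝ) : ℂ) := by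
  rw [MeasureTheory.L2.inner_indicatorConstLp_one, ← integral_complex_ofReal]
  exact integral_congr_ae (ae_restrict_of_ae (h B hB _ indicatorConstLp_coeFn))

/-- Detailed balance is the self-adjointness of exp(t𝓛) tested on two indicators. -/
theorem RepresentsSemigroup.isReversible (h : RepresentsSemigroup p t κ) :
    Kernel.IsReversible κ p := by
  intro A B hA hB
  have h1 := h.inner_eq hA hB
  have h2 := h.inner_eq hB hA
  rw [← inner_langevinOperator_left, ← inner_conj_symm, h2, Complex.conj_ofReal,
    Complex.ofReal_inj, real_setIntegral_eq κ p B hA, real_setIntegral_eq κ p A hB] at h1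
  have hfin : ∀ A B : Set (Space d), ∫⁻ x in A, κ x B ∂p ≠ ⊤ := by
    intro A B
    refine ne_top_of_le_ne_top (measure_ne_top p A) ?_
    calc ∫⁻ x in A, κ x B ∂p ≤ ∫⁻ _ in A, 1 ∂p := lintegral_mono fun x => prob_le_one
      _ = p A := by simp
  exact ((ENNReal.toReal_eq_toReal_iff' (hfin _ _) (hfin _ _)).1 h1).symm

/-- Detailed balance for functions. -/
theorem setIntegral_integral_of_isReversible {Ω : Type*} [MeasurableSpace Ω] {κ : Kernel Ω Ω}
    [IsMarkovKernel κ] {ν : Measure Ω} [IsFiniteMeasure ν] (h : Kernel.IsReversible κ ν) {g : Ω → ℝ}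
    (hg : Integrable g ν) {S : Set Ω} (hS : MeasurableSet S) :
    ∫ x in S, ∫ y, g y ∂(κ x) ∂ν = ∫ x, (κ x).real S * g x ∂ν := by
  -- By reversibility, starting from ν restricted to S and making one step gives the law with
  -- density κ(·, S) with respect to ν.
  have hmeas : κ ∘ₘ (ν.restrict S) = ν.withDensity fun x => κ x S := by
    ext E hE
    rw [Measure.bind_apply hE (Kernel.aemeasurable _), withDensity_apply _ hE]
    exact h hS hE
  have hle : κ ∘ₘ (ν.restrict S) ≤ ν := by
    rw [hmeas]
    refine (withDensity_mono (Filter.Eventually.of_forall fun x => ?_)).trans_eq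
      withDensity_one
    exact prob_le_one
  rw [← (integral_comp_eq (hg.mono_measure hle)).2, hmeas,
    integral_withDensity_eq_integral_toReal_smul (κ.measurable_coe hS)
      (Filter.Eventually.of_forall fun _ => measure_lt_top _ _)]
  rfl

/-- The kernel is tied to the operator only on indicators. Testing against 1_S and moving the
operator onto 1_S by symmetry extends the identity to all real L² functions. -/
theorem RepresentsSemigroup.ae_eq (h : RepresentsSemigroup p t κ) (g : Lp ℝ 2 p) :
    (langevinOperator p t (ofRealL p g) : Space d → ℂ) =ᵐ[p]
      fun x => ((∫ y, g y ∂(κ x) : ℝ) : ℂ) := by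
  have hg : Integrable g p := (Lp.memLp g).integrable (by norm_num)
  have hinv : κ ∘ₘ p = p := h.isReversible.invariant
  have hκg : Integrable (fun x => ∫ y, g y ∂(κ x)) p :=
    (integral_comp_eq (κ := κ) (ν := p) (hinv.symm ▸ hg)).1
  refine Integrable.ae_eq_of_forall_setIntegral_eq _ _
    ((Lp.memLp _).integrable (by norm_num)) hκg.ofReal fun S hS _ => ?_
  have h1 := MeasureTheory.L2.inner_indicatorConstLp_one (𝕜 := ℂ) hS (measure_ne_top p S)
    (langevinOperator p t (ofRealL p g))
  rw [← h1, ← inner_langevinOperator_left, MeasureTheory.L2.inner_def, integral_complex_ofReal,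
    setIntegral_integral_of_isReversible h.isReversible hg hS, ← integral_complex_ofReal]
  refine integral_congr_ae ?_
  filter_upwards [h S hS _ (indicatorConstLp_coeFn (hs := hS) (hμs := measure_ne_top p S)),
    coeFn_ofRealL g] with x e1 e2
  rw [e1, e2]
  simp [mul_comm]

theorem RepresentsSemigroup.chainForm_eq (h : RepresentsSemigroup p t κ) (g : Lp ℝ 2 p) :
    ∫ x, g x * (g x - ∫ y, g y ∂(κ x)) ∂p =
      ‖g‖ ^ 2 - cfcForm (resolvent p) (semigroupFun t) (ofRealL p g) := by
  have h1 : cfcForm (resolvent p) (semigroupFun t) (ofRealL p g) =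
      (inner ℂ (langevinOperator p t (ofRealL p g)) (ofRealL p g)).re := rfl
  rw [h1, re_inner_L2, ← norm_ofRealL g, norm_sq_L2, ← integral_sub]
  · refine integral_congr_ae ?_
    filter_upwards [h.ae_eq g, coeFn_ofRealL g] with x e1 e2
    rw [e1, e2]
    simp only [RCLike.inner_apply, Complex.conj_ofReal, Complex.norm_real, Real.norm_eq_abs,
      sq_abs, ← Complex.ofReal_mul, Complex.ofReal_re]
    ring
  · exact (Lp.memLp _).integrable_norm_pow (by norm_num)
  · exact (MeasureTheory.L2.integrable_inner (𝕜 := ℂ)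
      (langevinOperator p t (ofRealL p g)) (ofRealL p g)).re

theorem RepresentsSemigroup.escape_eq (h : RepresentsSemigroup p t κ) {A : Set (Space d)}
    (hA : MeasurableSet A) :
    ‖indicatorConstLp 2 hA (measure_ne_top p A) (1 : ℂ)‖ ^ 2 -
      cfcForm (resolvent p) (semigroupFun t) (indicatorConstLp 2 hA (measure_ne_top p A) 1) =
      p.real A - ∫ x in A, (κ x).real A ∂p := by
  have h1 : cfcForm (resolvent p) (semigroupFun t)
      (indicatorConstLp 2 hA (measure_ne_top p A) 1) =
      (inner ℂ (langevinOperator p t (indicatorConstLp 2 hA (measure_ne_top p A) 1))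
        (indicatorConstLp 2 hA (measure_ne_top p A) 1)).re := rfl
  rw [h1, inner_langevinOperator_left, h.inner_eq hA hA, Complex.ofReal_re,
    norm_indicatorConstLp (by norm_num) (by norm_num)]
  congr 1
  rw [norm_one, one_mul, ← Real.rpow_natCast, ← Real.rpow_mul measureReal_nonneg]
  norm_num

theorem IsLangevinChain.representsSemigroup {f : Space d → ℝ}
    {P : ℝ → Kernel (Space d) (Space d)} (h : IsLangevinChain f P) (ht : 0 < t) :
    RepresentsSemigroup (gibbs f) t (P t) := (h t ht).2

/-- If some (n+1)-dimensional space had all Rayleigh quotients of I - P_t below q < 1 - exp(-t/C),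
those of P_t would exceed s = 1 - q > exp(-t/C), which the generator eigenvalue excludes. -/
theorem IsLangevinChain.le_chainEigenvalue {f : Space d → ℝ} [IsProbabilityMeasure (gibbs f)]
    {P : ℝ → Kernel (Space d) (Space d)} (h : IsLangevinChain f P) (ht : 0 < t) {C : ℝ}
    (hC : 0 < C) {n : ℕ} (hgen : ((1 / C : ℝ) : EReal) ≤ generatorEigenvalue f (n + 1)) :
    ((1 - Real.exp (-t / C) : ℝ) : EReal) ≤ chainEigenvalue (P t) (gibbs f) (n + 1) := by
  have := (h t ht).1
  refine le_iInf fun V => le_iInf fun hV => ?_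
  by_contra hcon
  rw [not_le, EReal.lt_iff_exists_real_btwn] at hcon
  obtain ⟨q, hq1, hq2⟩ := hcon
  rw [EReal.coe_lt_coe_iff] at hq2
  obtain ⟨v, hv, hlt⟩ := exists_cfcForm_lt_of_generatorEigenvalue hC ht hgen V hV
    (s := 1 - q) (by linarith)
  have hv0 : v ≠ 0 := by
    rintro rfl
    simp [cfcForm] at hlt
  have h1 := (le_iSup₂_of_le (f := fun (g : Lp ℝ 2 (gibbs f)) (_ : g ∈ V) => ⨆ (_ : g ≠ 0),
    (((∫ x, g x * (g x - ∫ y, g y ∂(P t x)) ∂(gibbs f)) / ‖g‖ ^ 2 : ℝ) : EReal)) v hv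
    (le_iSup_of_le hv0 le_rfl)).trans_lt hq1
  rw [EReal.coe_lt_coe_iff, (h.representsSemigroup ht).chainForm_eq v,
    div_lt_iff₀ (by positivity)] at h1
  linarith

end Chain

/-! ### Projection to a finite chain -/

section FiniteForm

variable {ι : Type*} [Fintype ι] [DecidableEq ι]

/-- The function equal to `c i` on `S i`. -/
def stepVector {k : ℕ} (S : Fin k → Finset ι) : (Fin k → ℝ) →ₗ[ℝ] (ι → ℝ) where
  toFun c x := ∑ i, if x ∈ S i then c i else 0
  map_add' c c' := by
    ext x
    rw [Pi.add_apply, ← Finset.sum_add_distrib]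
    refine Finset.sum_congr rfl fun i _ => ?_
    split_ifs <;> simp
  map_smul' r c := by
    ext x
    simp [Finset.mul_sum]

variable {k : ℕ} {S : Fin k → Finset ι}

theorem stepVector_apply (c : Fin k → ℝ) (x : ι) :
    stepVector S c x = ∑ i, if x ∈ S i then c i else 0 := rfl

theorem stepVector_of_mem (hS : ∀ i j, i ≠ j → Disjoint (S i) (S j)) (c : Fin k → ℝ) {i : Fin k}
    {x : ι} (hx : x ∈ S i) : stepVector S c x = c i := by
  rw [stepVector_apply, Finset.sum_eq_single i (fun j _ hj => ?_) (by simp), if_pos hx]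
  exact if_neg fun hxj => Finset.disjoint_left.1 (hS j i hj) hxj hx

theorem stepVector_of_notMem (c : Fin k → ℝ) {x : ι} (hx : ∀ i, x ∉ S i) :
    stepVector S c x = 0 := by
  rw [stepVector_apply]
  exact Finset.sum_eq_zero fun i _ => if_neg (hx i)

theorem stepVector_sq (hS : ∀ i j, i ≠ j → Disjoint (S i) (S j)) (c : Fin k → ℝ) (x : ι) :
    stepVector S c x ^ 2 = ∑ i, if x ∈ S i then c i ^ 2 else 0 := by
  by_cases h : ∃ i, x ∈ S i
  · obtain ⟨i, hi⟩ := h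
    rw [stepVector_of_mem hS c hi]
    exact (stepVector_of_mem hS (fun i => c i ^ 2) hi).symm
  · push Not at h
    rw [stepVector_of_notMem c h]
    simp [h]

/-- Pairs inside one set contribute nothing. For all others (u - v)² ≤ 2u² + 2v², and each term is
charged to an edge leaving the set of its endpoint; this is the source of the factor 2 in the
Cheeger bound. -/
theorem stepVector_sub_sq_le (hS : ∀ i j, i ≠ j → Disjoint (S i) (S j)) (c : Fin k → ℝ)
    (x y : ι) : (stepVector S c x - stepVector S c y) ^ 2 ≤
      ∑ i, ((if x ∈ S i ∧ y ∈ (S i)ᶜ then 2 * c i ^ 2 else 0) +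
        if x ∈ (S i)ᶜ ∧ y ∈ S i then 2 * c i ^ 2 else 0) := by
  by_cases h : ∃ i, x ∈ S i ∧ y ∈ S i
  · obtain ⟨i, hx, hy⟩ := h
    rw [stepVector_of_mem hS c hx, stepVector_of_mem hS c hy, sub_self, zero_pow two_ne_zero]
    refine Finset.sum_nonneg fun i _ => ?_
    split_ifs <;> positivity
  · push Not at h
    calc (stepVector S c x - stepVector S c y) ^ 2 ≤
        2 * stepVector S c x ^ 2 + 2 * stepVector S c y ^ 2 := by
          nlinarith [sq_nonneg (stepVector S c x + stepVector S c y)]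
      _ = ∑ i, ((if x ∈ S i then 2 * c i ^ 2 else 0) + if y ∈ S i then 2 * c i ^ 2 else 0) := by
          rw [stepVector_sq hS, stepVector_sq hS, Finset.mul_sum, Finset.mul_sum,
            ← Finset.sum_add_distrib]
          simp only [mul_ite, mul_zero]
      _ = _ := by
          refine Finset.sum_congr rfl fun i _ => ?_
          have := h i
          by_cases hx : x ∈ S i <;> by_cases hy : y ∈ S i <;> simp_all

theorem finiteForm_eq {w : ι → ι → ℝ} {π : ι → ℝ} (hs : ∀ x y, w x y = w y x)
    (hrow : ∀ x, ∑ y, w x y = π x) (a : ι → ℝ) :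
    ∑ x, a x * (a x * π x - ∑ y, a y * w x y) = (∑ x, ∑ y, w x y * (a x - a y) ^ 2) / 2 := by
  have h1 : ∑ x, a x * (a x * π x) = ∑ x, ∑ y, w x y * a x ^ 2 := by
    refine Finset.sum_congr rfl fun x _ => ?_
    rw [← hrow, Finset.mul_sum, Finset.mul_sum]
    exact Finset.sum_congr rfl fun y _ => by ring
  have h2 : ∑ x, ∑ y, w x y * a y ^ 2 = ∑ x, ∑ y, w x y * a x ^ 2 := by
    rw [Finset.sum_comm]
    exact Finset.sum_congr rfl fun y _ => Finset.sum_congr rfl fun x _ => by rw [hs]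
  have h3 : ∀ x y, w x y * (a x - a y) ^ 2 =
      w x y * a x ^ 2 + w x y * a y ^ 2 - 2 * (a x * (a y * w x y)) := fun x y => by ring
  simp only [h3, mul_sub, Finset.sum_sub_distrib, Finset.sum_add_distrib, h1, h2,
    ← Finset.mul_sum]
  ring

/-- The test functions of the easy direction of the higher order Cheeger inequality. -/
theorem IsSparseFamily.finiteForm_le {w : ι → ι → ℝ} {π : ι → ℝ} (hw : ∀ x y, 0 ≤ w x y)
    (hs : ∀ x y, w x y = w y x) (hrow : ∀ x, ∑ y, w x y = π x) {α : ℝ}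
    (h : IsSparseFamily w π α S) (c : Fin k → ℝ) :
    ∑ x, stepVector S c x * (stepVector S c x * π x - ∑ y, stepVector S c y * w x y) ≤
      2 * α * ∑ x, stepVector S c x ^ 2 * π x := by
  obtain ⟨-, hdisj, hcut⟩ := h
  have hflow : ∀ (U V : Finset ι) (r : ℝ),
      ∑ x, ∑ y, w x y * (if x ∈ U ∧ y ∈ V then r else 0) = r * flow w U V := by
    intro U V r
    simp [flow, ite_and, mul_ite, Finset.mul_sum, mul_comm]
  rw [finiteForm_eq hs hrow]
  have h1 : ∑ x, ∑ y, w x y * (stepVector S c x - stepVector S c y) ^ 2 ≤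
      ∑ i, 4 * c i ^ 2 * flow w (S i) (S i)ᶜ := by
    calc _ ≤ ∑ x, ∑ y, w x y * ∑ i, ((if x ∈ S i ∧ y ∈ (S i)ᶜ then 2 * c i ^ 2 else 0) +
          if x ∈ (S i)ᶜ ∧ y ∈ S i then 2 * c i ^ 2 else 0) :=
          Finset.sum_le_sum fun x _ => Finset.sum_le_sum fun y _ =>
            mul_le_mul_of_nonneg_left (stepVector_sub_sq_le hdisj c x y) (hw x y)
      _ = ∑ i, (∑ x, ∑ y, w x y * (if x ∈ S i ∧ y ∈ (S i)ᶜ then 2 * c i ^ 2 else 0) +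
          ∑ x, ∑ y, w x y * (if x ∈ (S i)ᶜ ∧ y ∈ S i then 2 * c i ^ 2 else 0)) := by
          simp only [Finset.mul_sum, ← Finset.sum_add_distrib, ← mul_add]
          rw [Finset.sum_comm (s := (Finset.univ : Finset (Fin k)))]
          exact Finset.sum_congr rfl fun x _ => Finset.sum_comm
      _ = _ := by
          refine Finset.sum_congr rfl fun i _ => ?_
          rw [hflow, hflow, flow_comm hs (S i)ᶜ]
          ring
  have h2 : ∑ x, stepVector S c x ^ 2 * π x = ∑ i, c i ^ 2 * mass π (S i) := by
    simp only [stepVector_sq hdisj, Finset.sum_mul]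
    rw [Finset.sum_comm]
    refine Finset.sum_congr rfl fun i _ => ?_
    simp [mass, ite_mul, Finset.mul_sum]
  rw [h2, Finset.mul_sum, div_le_iff₀ two_pos, Finset.sum_mul]
  refine h1.trans (Finset.sum_le_sum fun i _ => ?_)
  nlinarith [mul_le_mul_of_nonneg_left (hcut i) (sq_nonneg (c i))]

theorem stepVector_injective (hS : ∀ i j, i ≠ j → Disjoint (S i) (S j))
    (hne : ∀ i, (S i).Nonempty) : Function.Injective (stepVector S) := by
  rw [injective_iff_map_eq_zero]
  intro c hc
  ext i
  obtain ⟨x, hx⟩ := hne i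
  rw [← stepVector_of_mem hS c hx, hc]
  rfl

end FiniteForm

/-! ### Step functions on the cells and the easy higher-order Cheeger bound. -/

section Projection

variable {Ω : Type*} [MeasurableSpace Ω] {K : Kernel Ω Ω} [IsMarkovKernel K] {ν : Measure Ω}
  [IsProbabilityMeasure ν] {m : ℕ} {A : Fin m → Set Ω}

/-- The ergodic flow between the cells of a partition. -/
def cellFlow (K : Kernel Ω Ω) (ν : Measure Ω) (A : Fin m → Set Ω) (i j : Fin m) : ℝ :=
  ∫ x in A i, (K x).real (A j) ∂ν

theorem cellFlow_nonneg (i j : Fin m) : 0 ≤ cellFlow K ν A i j :=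
  integral_nonneg fun _ => measureReal_nonneg

theorem cellFlow_comm (hrev : Kernel.IsReversible K ν) (hA : ∀ j, MeasurableSet (A j))
    (i j : Fin m) : cellFlow K ν A i j = cellFlow K ν A j i := by
  rw [cellFlow, cellFlow, real_setIntegral_eq K ν _ (hA j), real_setIntegral_eq K ν _ (hA i),
    hrev (hA i) (hA j)]

theorem integrable_kernel_real {S : Set Ω} (hS : MeasurableSet S) :
    Integrable (fun x => (K x).real S) ν := by
  refine Integrable.of_bound (C := 1) ?_ (Filter.Eventually.of_forall fun x => ?_)
  · exact (K.measurable_coe hS).ennreal_toReal.aestronglyMeasurable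
  · rw [Real.norm_of_nonneg measureReal_nonneg]
    exact measureReal_le_one

/-- The cells cover only ν-almost everything; invariance ensures that for almost every x the step
from x lands in them almost surely, so no flow is lost. -/
theorem sum_cellFlow (hrev : Kernel.IsReversible K ν) (hA : ∀ j, MeasurableSet (A j))
    (hdisj : Pairwise fun i j => Disjoint (A i) (A j)) (hcover : ∀ᵐ x ∂ν, x ∈ ⋃ j, A j)
    (i : Fin m) : ∑ j, cellFlow K ν A i j = ν.real (A i) := by
  unfold cellFlow
  rw [← integral_finsetSum _ fun j _ => (integrable_kernel_real (hA j)).integrableOn]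
  have hinv : K ∘ₘ ν = ν := hrev.invariant
  have hae : ∀ᵐ x ∂ν, ∀ᵐ y ∂(K x), y ∈ ⋃ j, A j := by
    apply Measure.ae_ae_of_ae_comp
    rwa [hinv]
  have h1 : ∫ x in A i, ∑ j, (K x).real (A j) ∂ν = ∫ _ in A i, (1 : ℝ) ∂ν := by
    refine integral_congr_ae (ae_restrict_of_ae ?_)
    filter_upwards [hae] with x hx
    have h2 : (K x).real (⋃ j, A j) = 1 := by
      rw [measureReal_def, (prob_compl_eq_zero_iff (MeasurableSet.iUnion hA)).1 hx]
      simp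
    rw [← h2, measureReal_iUnion_fintype hdisj hA]
  rw [h1]
  simp

/-- The function equal to `a j` on the cell `A j`. -/
def cellFunction (ν : Measure Ω) [IsProbabilityMeasure ν] (hA : ∀ j, MeasurableSet (A j)) :
    (Fin m → ℝ) →ₗ[ℝ] Lp ℝ 2 ν where
  toFun a := ∑ j, a j • indicatorConstLp 2 (hA j) (measure_ne_top ν (A j)) (1 : ℝ)
  map_add' a b := by simp [add_smul, Finset.sum_add_distrib]
  map_smul' r a := by simp [Finset.smul_sum, smul_smul]

theorem coeFn_cellFunction (hA : ∀ j, MeasurableSet (A j)) (a : Fin m → ℝ) :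
    (cellFunction ν hA a : Ω → ℝ) =ᵐ[ν] fun x => ∑ j, a j * (A j).indicator 1 x := by
  have h1 : (cellFunction ν hA a : Ω → ℝ) =ᵐ[ν]
      fun x => ∑ j, (a j • indicatorConstLp 2 (hA j) (measure_ne_top ν (A j)) (1 : ℝ) :
        Lp ℝ 2 ν) x := by
    refine (Lp.coeFn_finsetSum Finset.univ fun j =>
      (a j • indicatorConstLp 2 (hA j) (measure_ne_top ν (A j)) (1 : ℝ) : Lp ℝ 2 ν)).trans ?_
    exact Filter.Eventually.of_forall fun x => Finset.sum_apply _ _ _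
  have h2 : ∀ᵐ x ∂ν, ∀ j, (a j • indicatorConstLp 2 (hA j) (measure_ne_top ν (A j)) (1 : ℝ) :
      Lp ℝ 2 ν) x = a j * (A j).indicator 1 x := by
    rw [ae_all_iff]
    intro j
    filter_upwards [Lp.coeFn_smul (a j) (indicatorConstLp 2 (hA j) (measure_ne_top ν (A j)) (1 : ℝ)),
      indicatorConstLp_coeFn (p := 2) (hs := hA j) (hμs := measure_ne_top ν (A j)) (c := (1 : ℝ))]
      with x e1 e2
    rw [e1, Pi.smul_apply, e2]
    rfl
  filter_upwards [h1, h2] with x e1 e2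
  rw [e1]
  exact Finset.sum_congr rfl fun j _ => e2 j

theorem integral_cellFunction_mul (hA : ∀ j, MeasurableSet (A j)) (a : Fin m → ℝ) {g : Ω → ℝ}
    (hg : Integrable g ν) :
    ∫ x, (∑ j, a j * (A j).indicator 1 x) * g x ∂ν = ∑ j, a j * ∫ x in A j, g x ∂ν := by
  have h1 : ∀ j x, a j * (A j).indicator 1 x * g x = a j * (A j).indicator g x := by
    intro j x
    by_cases hx : x ∈ A j <;> simp [hx]
  simp only [Finset.sum_mul, h1]
  rw [integral_finsetSum _ fun j _ => (hg.indicator (hA j)).const_mul (a j)]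
  refine Finset.sum_congr rfl fun j _ => ?_
  rw [integral_const_mul, integral_indicator (hA j)]

theorem setIntegral_cellFunction (hA : ∀ j, MeasurableSet (A j))
    (hdisj : Pairwise fun i j => Disjoint (A i) (A j)) (a : Fin m → ℝ) (i : Fin m) :
    ∫ x in A i, ∑ j, a j * (A j).indicator 1 x ∂ν = a i * ν.real (A i) := by
  have h1 : ∫ x in A i, ∑ j, a j * (A j).indicator 1 x ∂ν = ∫ _ in A i, a i ∂ν := by
    refine setIntegral_congr_fun (hA i) fun x hx => ?_
    refine (Finset.sum_eq_single i (fun j _ hj => ?_) (by simp)).trans (by simp [hx])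
    rw [Set.indicator_of_notMem fun hxj => Set.disjoint_left.1 (hdisj hj) hxj hx, mul_zero]
  rw [h1]
  simp [mul_comm]

theorem integrable_step (hA : ∀ j, MeasurableSet (A j)) (a : Fin m → ℝ) (ρ : Measure Ω)
    [IsFiniteMeasure ρ] : Integrable (fun x => ∑ j, a j * (A j).indicator (1 : Ω → ℝ) x) ρ :=
  integrable_finsetSum _ fun j _ =>
    ((integrable_const (1 : ℝ)).indicator (hA j)).const_mul (a j)

theorem norm_sq_cellFunction (hA : ∀ j, MeasurableSet (A j))
    (hdisj : Pairwise fun i j => Disjoint (A i) (A j)) (a : Fin m → ℝ) :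
    ‖cellFunction ν hA a‖ ^ 2 = ∑ j, a j ^ 2 * ν.real (A j) := by
  rw [norm_sq_real_L2]
  have h1 : ∫ x, cellFunction ν hA a x ^ 2 ∂ν =
      ∫ x, (∑ j, a j * (A j).indicator 1 x) * (∑ j, a j * (A j).indicator 1 x) ∂ν := by
    refine integral_congr_ae ?_
    filter_upwards [coeFn_cellFunction (ν := ν) hA a] with x hx
    rw [hx, sq]
  rw [h1, integral_cellFunction_mul hA a (integrable_step hA a ν)]
  refine Finset.sum_congr rfl fun j _ => ?_
  rw [setIntegral_cellFunction hA hdisj]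
  ring

theorem chainForm_cellFunction (hrev : Kernel.IsReversible K ν) (hA : ∀ j, MeasurableSet (A j))
    (hdisj : Pairwise fun i j => Disjoint (A i) (A j)) (a : Fin m → ℝ) :
    ∫ x, cellFunction ν hA a x * (cellFunction ν hA a x - ∫ y, cellFunction ν hA a y ∂(K x)) ∂ν =
      ∑ i, a i * (a i * ν.real (A i) - ∑ j, a j * cellFlow K ν A i j) := by
  have hinv : K ∘ₘ ν = ν := hrev.invariant
  -- An L² function is determined only ν-a.e.; invariance makes the choice of representative
  -- harmless under K x for almost every x.
  have hae : ∀ᵐ x ∂ν, ∀ᵐ y ∂(K x),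
      cellFunction ν hA a y = ∑ j, a j * (A j).indicator 1 y := by
    apply Measure.ae_ae_of_ae_comp
    rw [hinv]
    exact coeFn_cellFunction hA a
  have hK : Integrable (fun x => ∑ j, a j * (K x).real (A j)) ν :=
    integrable_finsetSum _ fun j _ => (integrable_kernel_real (hA j)).const_mul (a j)
  have h1 : ∫ x, cellFunction ν hA a x *
      (cellFunction ν hA a x - ∫ y, cellFunction ν hA a y ∂(K x)) ∂ν =
      ∫ x, (∑ j, a j * (A j).indicator 1 x) *
        ((∑ j, a j * (A j).indicator 1 x) - ∑ j, a j * (K x).real (A j)) ∂ν := by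
    refine integral_congr_ae ?_
    filter_upwards [coeFn_cellFunction (ν := ν) hA a, hae] with x hx hx'
    rw [hx, integral_congr_ae hx']
    have hj : ∀ j, Integrable (fun y => a j * (A j).indicator (1 : Ω → ℝ) y) (K x) := fun j =>
      ((integrable_const (1 : ℝ)).indicator (hA j)).const_mul (a j)
    rw [integral_finsetSum _ fun j _ => hj j]
    simp only [integral_const_mul, integral_indicator_one (hA _)]
  have hint : Integrable (fun x => (∑ j, a j * (A j).indicator (1 : Ω → ℝ) x) -
      ∑ j, a j * (K x).real (A j)) ν := (integrable_step hA a ν).sub hK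
  rw [h1, integral_cellFunction_mul hA a hint]
  refine Finset.sum_congr rfl fun i _ => ?_
  rw [integral_sub (integrable_step hA a ν).integrableOn hK.integrableOn,
    setIntegral_cellFunction hA hdisj, integral_finsetSum _ fun j _ =>
      ((integrable_kernel_real (hA j)).const_mul (a j)).integrableOn]
  simp only [integral_const_mul]
  rfl

/-- The easy direction of the higher order Cheeger inequality. -/
theorem chainEigenvalue_le_of_isSparseFamily (hrev : Kernel.IsReversible K ν)
    (hA : ∀ j, MeasurableSet (A j)) (hdisj : Pairwise fun i j => Disjoint (A i) (A j))
    (hcover : ∀ᵐ x ∂ν, x ∈ ⋃ j, A j) (hpos : ∀ j, 0 < ν.real (A j)) {k : ℕ}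
    {S : Fin k → Finset (Fin m)} {α : ℝ}
    (h : IsSparseFamily (cellFlow K ν A) (fun j => ν.real (A j)) α S) :
    chainEigenvalue K ν k ≤ ((2 * α : ℝ) : EReal) := by
  have hnorm : ∀ a : Fin m → ℝ, a ≠ 0 → 0 < ‖cellFunction ν hA a‖ ^ 2 := by
    intro a ha
    obtain ⟨i, hi⟩ := Function.ne_iff.1 ha
    rw [norm_sq_cellFunction hA hdisj]
    refine Finset.sum_pos' (fun j _ => mul_nonneg (sq_nonneg _) (hpos j).le)
      ⟨i, Finset.mem_univ i, mul_pos (by have : a i ≠ 0 := hi; positivity) (hpos i)⟩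
  have hinj1 : Function.Injective (cellFunction ν hA) := by
    rw [injective_iff_map_eq_zero]
    intro a ha
    by_contra hne
    have := hnorm a hne
    simp [ha] at this
  have hinj : Function.Injective (cellFunction ν hA ∘ₗ stepVector S) :=
    hinj1.comp (stepVector_injective h.2.1 h.1)
  refine iInf_le_of_le (LinearMap.range (cellFunction ν hA ∘ₗ stepVector S))
    (iInf_le_of_le ?_ ?_)
  · rw [LinearMap.finrank_range_of_inj hinj]
    simp
  · refine iSup_le fun g => iSup_le fun hg => iSup_le fun hne => ?_
    obtain ⟨c, rfl⟩ := hg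
    have hc : stepVector S c ≠ 0 := fun h0 => hne (by simp [h0])
    rw [EReal.coe_le_coe_iff]
    refine (div_le_iff₀ (hnorm _ hc)).2 ?_
    rw [LinearMap.comp_apply, chainForm_cellFunction hrev hA hdisj, norm_sq_cellFunction hA hdisj]
    exact h.finiteForm_le cellFlow_nonneg (cellFlow_comm hrev hA)
      (sum_cellFlow hrev hA hdisj hcover) c

end Projection

/-! ### The chain restricted to a subset. -/

section Restriction

variable {Ω : Type*} [MeasurableSpace Ω] (κ : Kernel Ω Ω) {B : Set Ω} (hB : MeasurableSet B)

theorem restrictKernel_apply (x : Ω) {S : Set Ω} (hS : MeasurableSet S) :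
    restrictKernel κ hB x S = κ x (S ∩ B) + κ x Bᶜ * S.indicator 1 x := by
  change ((κ x).restrict B + κ x Bᶜ • Measure.dirac x) S = _
  rw [Measure.add_apply, Measure.restrict_apply hS, Measure.smul_apply, Measure.dirac_apply' _ hS,
    smul_eq_mul]

instance [IsMarkovKernel κ] : IsMarkovKernel (restrictKernel κ hB) :=
  ⟨fun x => ⟨by
    rw [restrictKernel_apply κ hB x .univ]
    simp [prob_add_prob_compl hB]⟩⟩

/-- Rejected moves add a measure on the diagonal, which is symmetric, to the symmetric flow inside
B. -/
theorem isReversible_restrictKernel {ν : Measure Ω} (h : Kernel.IsReversible κ ν) :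
    Kernel.IsReversible (restrictKernel κ hB) (cond ν B) := by
  have key : ∀ S S' : Set Ω, MeasurableSet S → MeasurableSet S' →
      ∫⁻ x in S, restrictKernel κ hB x S' ∂(cond ν B) =
        (ν B)⁻¹ * (∫⁻ x in S ∩ B, κ x (S' ∩ B) ∂ν + ∫⁻ x in S ∩ B ∩ S', κ x Bᶜ ∂ν) := by
    intro S S' hS hS'
    rw [ProbabilityTheory.cond, Measure.restrict_smul, lintegral_smul_measure, Measure.restrict_restrict hS,
      smul_eq_mul]
    congr 1
    simp only [restrictKernel_apply κ hB _ hS']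
    rw [lintegral_add_left (κ.measurable_coe (hS'.inter hB))]
    congr 1
    have h1 : ∀ x, κ x Bᶜ * S'.indicator (1 : Ω → ENNReal) x = S'.indicator (fun x => κ x Bᶜ) x := by
      intro x
      by_cases hx : x ∈ S' <;> simp [hx]
    simp only [h1]
    rw [lintegral_indicator hS', Measure.restrict_restrict hS', Set.inter_comm]
  intro S S' hS hS'
  rw [key S S' hS hS', key S' S hS' hS, h (hS.inter hB) (hS'.inter hB)]
  congr 3
  rw [Set.inter_right_comm, Set.inter_comm S, Set.inter_right_comm]

/-- Holding at x contributes nothing between distinct cells, so off the diagonal only the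
normalization of the measure changes. -/
theorem cellFlow_restrictKernel {ν : Measure Ω} {m : ℕ} {A : Fin m → Set Ω}
    (hA : ∀ j, MeasurableSet (A j)) (hdisj : Pairwise fun i j => Disjoint (A i) (A j))
    (hAB : ∀ j, A j ⊆ B) {i j : Fin m} (hij : i ≠ j) :
    cellFlow (restrictKernel κ hB) (cond ν B) A i j =
      (ν B)⁻¹.toReal * ∫ x in A i, (κ x).real (A j) ∂ν := by
  rw [cellFlow, ProbabilityTheory.cond, Measure.restrict_smul, integral_smul_measure,
    Measure.restrict_restrict (hA i), Set.inter_eq_left.2 (hAB i), smul_eq_mul]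
  congr 1
  refine setIntegral_congr_fun (hA i) fun x hx => ?_
  have hxj : x ∉ A j := Set.disjoint_left.1 (hdisj hij) hx
  simp only [measureReal_def]
  rw [restrictKernel_apply κ hB x (hA j), Set.indicator_of_notMem hxj, mul_zero, add_zero,
    Set.inter_eq_left.2 (hAB j)]

end Restriction

/-! ### Clusterings of the projected chain -/

section Clustering

variable {ι : Type*} [Fintype ι] [DecidableEq ι]

theorem conductance_eq_flow {M w : ι → ι → ℝ} {π : ι → ℝ} (hM : ∀ x y, π x * M x y = w x y)
    (J : Finset ι) : conductance M π J = flow w J Jᶜ / mass π J := by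
  simp only [conductance, flow, mass, hM]

/-- Restriction alters only diagonal entries, so flows between disjoint subsets of J are unchanged,
and the factor 1/π(J) cancels in the conductance. -/
theorem le_cheeger_restrictMatrix {M w : ι → ι → ℝ} {π : ι → ℝ} (hπ : ∀ x, 0 < π x)
    (hM : ∀ x y, π x * M x y = w x y) {J : Finset ι} {φ : ℝ}
    (h : ∀ S ⊆ J, S.Nonempty → 2 * mass π S ≤ mass π J → φ * mass π S ≤ flow w S (J \ S)) :
    (φ : EReal) ≤ cheeger (restrictMatrix M J) (restrictWeight π J) := by
  refine le_iInf fun S => le_iInf fun hne => le_iInf fun hhalf => ?_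
  rw [EReal.coe_le_coe_iff]
  set S' : Finset ι := S.map (Function.Embedding.subtype _) with hS'
  have hsub : S' ⊆ J := by
    intro x hx
    rw [hS', Finset.mem_map] at hx
    obtain ⟨y, -, rfl⟩ := hx
    exact y.2
  have hne' : S'.Nonempty := hne.map
  have hJ : 0 < mass π J := mass_pos hπ (hne'.mono hsub)
  have hS'pos := mass_pos hπ hne'
  have e1 : ∑ x ∈ S, restrictWeight π J x = mass π S' / mass π J := by
    simp only [restrictWeight, mass, hS', Finset.sum_map, Finset.sum_div]
    rfl
  have e2 : ∑ x ∈ S, ∑ y ∈ Sᶜ, restrictWeight π J x * restrictMatrix M J x y =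
      flow w S' (J \ S') / mass π J := by
    have hc : J \ S' = (Sᶜ).map (Function.Embedding.subtype _) := by
      ext x
      simp only [hS', Finset.mem_sdiff, Finset.mem_map, Finset.mem_compl,
        Function.Embedding.subtype_apply, Subtype.exists, exists_and_right, exists_eq_right]
      constructor
      · rintro ⟨hx, hx'⟩
        exact ⟨hx, fun hxS => hx' ⟨hx, hxS⟩⟩
      · rintro ⟨hx, hx'⟩
        exact ⟨hx, fun ⟨_, hxS⟩ => hx' hxS⟩
    rw [hc]
    simp only [flow, hS', Finset.sum_map, Finset.sum_div]
    refine Finset.sum_congr rfl fun x hx => Finset.sum_congr rfl fun y hy => ?_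
    have hxy : x ≠ y := fun h => Finset.mem_compl.1 hy (h ▸ hx)
    rw [restrictWeight, restrictMatrix, if_neg hxy, add_zero, div_mul_eq_mul_div, hM]
    rfl
  rw [e1, div_le_iff₀ hJ] at hhalf
  rw [conductance, e1, e2, div_div_div_cancel_right₀ hJ.ne', le_div_iff₀ hS'pos]
  exact h S' hsub hne' (by linarith)

end Clustering

/-! ### Escape from unions of cells. -/

section Cells

variable {Ω : Type*} [MeasurableSpace Ω] {κ : Kernel Ω Ω} [IsMarkovKernel κ] {ν : Measure Ω}
  [IsProbabilityMeasure ν] {m : ℕ} {A : Fin m → Set Ω} {B : Set Ω}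

theorem measureReal_biUnion_cells {ρ : Measure Ω} [IsFiniteMeasure ρ]
    (hA : ∀ j, MeasurableSet (A j)) (hdisj : Pairwise fun i j => Disjoint (A i) (A j))
    (J : Finset (Fin m)) : ρ.real (⋃ j ∈ J, A j) = ∑ j ∈ J, ρ.real (A j) :=
  measureReal_biUnion_finset (fun _ _ _ _ hij => hdisj hij) fun j _ => hA j

/-- The probability to leave a union of cells is at most the flow to the other cells plus the
probability to leave `B`. -/
theorem escape_le_of_cells (hA : ∀ j, MeasurableSet (A j))
    (hdisj : Pairwise fun i j => Disjoint (A i) (A j)) (hcover : ⋃ j, A j = B) {ε : ℝ}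
    (hesc : ∀ x ∈ B, (κ x).real Bᶜ ≤ ε) (J : Finset (Fin m)) :
    ν.real (⋃ j ∈ J, A j) - ∫ x in ⋃ j ∈ J, A j, (κ x).real (⋃ j ∈ J, A j) ∂ν ≤
      flow (cellFlow κ ν A) J Jᶜ + ε * ν.real (⋃ j ∈ J, A j) := by
  set E := ⋃ j ∈ J, A j with hE
  have hEm : MeasurableSet E := Finset.measurableSet_biUnion J fun j _ => hA j
  have hJ : ∀ (g : Ω → ℝ), Integrable g ν → ∫ x in E, g x ∂ν = ∑ i ∈ J, ∫ x in A i, g x ∂ν :=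
    fun g hg => integral_biUnion_finset J (fun j _ => hA j) (fun _ _ _ _ hij => hdisj hij)
      fun j _ => hg.integrableOn
  have hpt : ∀ x ∈ E, 1 ≤ (κ x).real E + (∑ j ∈ Jᶜ, (κ x).real (A j) + ε) := by
    intro x hx
    have hxB : x ∈ B := by
      rw [← hcover]
      obtain ⟨j, -, hxj⟩ := Set.mem_iUnion₂.1 hx
      exact Set.mem_iUnion.2 ⟨j, hxj⟩
    have h1 : (Set.univ : Set Ω) = E ∪ ((⋃ j ∈ Jᶜ, A j) ∪ Bᶜ) := by
      refine (Set.eq_univ_of_forall fun y => ?_).symm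
      by_cases hy : y ∈ B
      · rw [← hcover] at hy
        obtain ⟨j, hyj⟩ := Set.mem_iUnion.1 hy
        by_cases hj : j ∈ J
        · exact Or.inl (Set.mem_iUnion₂.2 ⟨j, hj, hyj⟩)
        · exact Or.inr (Or.inl (Set.mem_iUnion₂.2 ⟨j, Finset.mem_compl.2 hj, hyj⟩))
      · exact Or.inr (Or.inr hy)
    have h2 : (κ x).real Set.univ = 1 := by simp
    rw [h1] at h2
    have h3 := measureReal_union_le (μ := κ x) E ((⋃ j ∈ Jᶜ, A j) ∪ Bᶜ)
    have h4 := measureReal_union_le (μ := κ x) (⋃ j ∈ Jᶜ, A j) Bᶜ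
    have h5 := measureReal_biUnion_cells (ρ := κ x) hA hdisj Jᶜ
    have h6 := hesc x hxB
    linarith
  have i1 : Integrable (fun x => (κ x).real E) ν := integrable_kernel_real hEm
  have i2 : Integrable (fun x => ∑ j ∈ Jᶜ, (κ x).real (A j)) ν :=
    integrable_finsetSum _ fun j _ => integrable_kernel_real (hA j)
  have i3 : Integrable (fun x => ∑ j ∈ Jᶜ, (κ x).real (A j) + ε) ν :=
    i2.add (integrable_const ε)
  have h1 : ∫ _ in E, (1 : ℝ) ∂ν ≤
      ∫ x in E, ((κ x).real E + (∑ j ∈ Jᶜ, (κ x).real (A j) + ε)) ∂ν :=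
    setIntegral_mono_on (integrable_const _).integrableOn (i1.add i3).integrableOn hEm hpt
  rw [integral_add i1.integrableOn i3.integrableOn, integral_add i2.integrableOn
    (integrable_const _).integrableOn, hJ _ i2] at h1
  have h2 : ∑ i ∈ J, ∫ x in A i, ∑ j ∈ Jᶜ, (κ x).real (A j) ∂ν = flow (cellFlow κ ν A) J Jᶜ := by
    refine Finset.sum_congr rfl fun i _ => ?_
    exact integral_finsetSum _ fun j _ => (integrable_kernel_real (hA j)).integrableOn
  rw [h2] at h1
  simp only [integral_const, measureReal_restrict_apply_univ, smul_eq_mul, mul_one] at h1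
  linarith

theorem one_sub_exp_neg_ge {x : ℝ} (hx : 0 < x) (hx2 : x ≤ 1 / 2) :
    2 / 3 * x ≤ 1 - Real.exp (-x) := by
  have h1 : Real.exp (-x) ≤ 1 / (1 + x) := by
    rw [Real.exp_neg, ← one_div]
    exact one_div_le_one_div_of_le (by linarith) (by linarith [Real.add_one_le_exp x])
  have h2 : 2 / 3 * x ≤ 1 - 1 / (1 + x) := by
    have : 1 - 1 / (1 + x) = x / (1 + x) := by
      field_simp
      ring
    rw [this, le_div_iff₀ (by linarith)]
    nlinarith
  linarith

end Cells

/-! ### Eigenvalue and mass bounds under the hypotheses of the theorem. -/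

section Main

variable {d n m : ℕ} {f : Space d → ℝ} {C μ T : ℝ} {P : ℝ → Kernel (Space d) (Space d)}
  {B : Set (Space d)} {A : Fin m → Set (Space d)}

/-- With x = T/C ≤ 1/2 one has 1 - exp(-x) ≥ 2x/3, and (3/4)(2x/3 - x/6) = 3x/8. -/
theorem le_restricted_eigenvalue [IsProbabilityMeasure (gibbs f)] (hB : MeasurableSet B)
    (hP : IsLangevinChain f P) (hC : 0 < C)
    (hgen : ((1 / C : ℝ) : EReal) ≤ generatorEigenvalue f (n + 1)) (hT : 0 < T) (hTC : T ≤ C / 2)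
    (heig : ((3 / 4 : ℝ) : EReal) *
        (chainEigenvalue (P T) (gibbs f) (n + 1) - ((T / (6 * C) : ℝ) : EReal)) ≤
      chainEigenvalue (restrictKernel (P T) hB) (ProbabilityTheory.cond (gibbs f) B) (n + 1)) :
    ((3 / 8 * (T / C) : ℝ) : EReal) ≤
      chainEigenvalue (restrictKernel (P T) hB) (ProbabilityTheory.cond (gibbs f) B) (n + 1) := by
  refine le_trans ?_ heig
  have h1 := hP.le_chainEigenvalue hT hC hgen
  have h2 := EReal.sub_le_sub h1 (le_refl ((T / (6 * C) : ℝ) : EReal))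
  have h3 := mul_le_mul_of_nonneg_left h2
    (EReal.coe_nonneg.2 (by norm_num : (0 : ℝ) ≤ 3 / 4))
  refine le_trans ?_ h3
  rw [← EReal.coe_sub, ← EReal.coe_mul, EReal.coe_le_coe_iff]
  have hx : T / C ≤ 1 / 2 := by
    rw [div_le_iff₀ hC]
    linarith
  have h4 := one_sub_exp_neg_ge (div_pos hT hC) hx
  rw [← neg_div] at h4
  have h5 : T / (6 * C) = 1 / 6 * (T / C) := by
    field_simp
  rw [h5]
  linarith

/-- A smaller set would lose at least 5/1000 of its mass, in units of T/C, whereas the flow to other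
cells accounts for 2/1000 and the exit from B for 1/1000. -/
theorem measure_ge_of_flow_le [IsProbabilityMeasure (gibbs f)]
    (hP : IsLangevinChain f P) (hC : 0 < C) (hμ : μ ≤ 1)
    (hpoin : PoincareOnSmallSets (gibbs f) (2 * C) μ) (hT : 0 < T) (hTC : T ≤ C / 2)
    (hA : ∀ j, MeasurableSet (A j)) (hpos : ∀ j, gibbs f (A j) ≠ 0)
    (hdisj : Pairwise fun i j => Disjoint (A i) (A j)) (hcover : ⋃ j, A j = B)
    (hesc : ∀ x ∈ B, (P T x).real Bᶜ ≤ T / (1000 * C)) {J : Finset (Fin m)} (hJ : J.Nonempty)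
    (hflow : flow (cellFlow (P T) (gibbs f) A) J Jᶜ ≤
      T / (500 * C) * mass (fun j => (gibbs f).real (A j)) J) :
    μ / 2 ≤ (gibbs f).real (⋃ j ∈ J, A j) := by
  have := (hP T hT).1
  by_contra hlt
  push Not at hlt
  have hrep := hP.representsSemigroup hT
  have hEm : MeasurableSet (⋃ j ∈ J, A j) := Finset.measurableSet_biUnion J fun j _ => hA j
  have h1 := hpoin.le_escape hC hT hTC hμ hEm hlt.le
    (indicatorConstLp_coeFn (hs := hEm) (hμs := measure_ne_top (gibbs f) _) (c := (1 : ℂ)))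
  rw [hrep.escape_eq hEm] at h1
  have h2 := escape_le_of_cells (ν := gibbs f) hA hdisj hcover hesc J
  have h3 := measureReal_biUnion_cells (ρ := gibbs f) hA hdisj J
  have h4 : 0 < mass (fun j => (gibbs f).real (A j)) J :=
    mass_pos (fun j => measureReal_nonneg.lt_of_ne'
      (fun h => hpos j ((measureReal_eq_zero_iff).1 h))) hJ
  have h5 : mass (fun j => (gibbs f).real (A j)) J = ∑ j ∈ J, (gibbs f).real (A j) := rfl
  rw [h3, ← h5] at h1
  rw [h3, ← h5] at h2
  have h6 := h1.trans h2
  have e1 : T / (200 * C) = 5 / 1000 * (T / C) := by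
    field_simp
    norm_num
  have e2 : T / (500 * C) = 2 / 1000 * (T / C) := by
    field_simp
    norm_num
  have e3 : T / (1000 * C) = 1 / 1000 * (T / C) := by
    field_simp
  rw [e2] at hflow
  rw [e1, e3] at h6
  have hx : 0 < T / C := div_pos hT hC
  have h7 := mul_pos hx h4
  linarith

end Main

/-! ### Choice of parameters and conclusion. -/

section Assembly

variable {d n m : ℕ} {f : Space d → ℝ} {C μ T : ℝ} {P : ℝ → Kernel (Space d) (Space d)}
  {B : Set (Space d)} {A : Fin m → Set (Space d)}

theorem isProbabilityMeasure_gibbs (hf : Integrable fun x => Real.exp (-f x)) :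
    IsProbabilityMeasure (gibbs f) :=
  isProbabilityMeasure_tilted hf

theorem mul_projMatrix {Ω : Type*} [MeasurableSpace Ω] {κ : Kernel Ω Ω} {ν : Measure Ω} {m : ℕ}
    {A : Fin m → Set Ω} (hpos : ∀ j, 0 < ν.real (A j)) (i j : Fin m) :
    ν.real (A i) * projMatrix κ ν A i j = cellFlow κ ν A i j := by
  rw [projMatrix, ← mul_assoc, mul_one_div_cancel (hpos i).ne', one_mul, cellFlow]

theorem not_isSparseFamily_of_card_lt {ι : Type*} [Fintype ι] [DecidableEq ι] {w : ι → ι → ℝ}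
    {π : ι → ℝ} {r : ℝ} {k : ℕ} (hk : Fintype.card ι < k) (S : Fin k → Finset ι) :
    ¬ IsSparseFamily w π r S := by
  rintro ⟨hne, hdisj, -⟩
  choose x hx using hne
  have hinj : Function.Injective x := by
    intro i j hij
    by_contra h
    exact Finset.disjoint_left.1 (hdisj i j h) (hx i) (hij ▸ hx j)
  have := Fintype.card_le_of_injective x hinj
  rw [Fintype.card_fin] at this
  omega

/-- The argument yields the inner bound x/(4000k³), where x stands for T/C. Since x ≤ 1 ≤ k this
dominates x²/(4000k⁸). -/
theorem inner_constant_mul_le {x σ k s F : ℝ} (hx : 0 < x) (hx1 : x ≤ 1) (hk : 1 ≤ k)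
    (hσ : σ * k ^ 2 = x / 500) (hs : 0 ≤ s) (h : σ * s ≤ 8 * k * F) :
    1 / 4000 * (x ^ 2 / k ^ 8) * s ≤ F := by
  have hk0 : 0 < k := by linarith
  have h1 : σ / (8 * k) * s ≤ F := by
    rw [div_mul_eq_mul_div, div_le_iff₀ (by positivity)]
    linarith
  refine le_trans (mul_le_mul_of_nonneg_right ?_ hs) h1
  have h2 : σ = x / 500 / k ^ 2 := by
    rw [eq_div_iff (by positivity), hσ]
  have h3 : σ / (8 * k) = 1 / 4000 * (x / k ^ 3) := by
    rw [h2]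
    field_simp
    norm_num
  rw [h3]
  refine mul_le_mul_of_nonneg_left ?_ (by norm_num)
  refine div_le_div₀ hx.le (by nlinarith) (by positivity) (pow_le_pow_right₀ hk (by norm_num))

theorem exists_clustering [IsProbabilityMeasure (gibbs f)] (hB : MeasurableSet B)
    (hP : IsLangevinChain f P) (hC : 0 < C) (hμ : μ ≤ 1)
    (hgen : ((1 / C : ℝ) : EReal) ≤ generatorEigenvalue f (n + 1))
    (hpoin : PoincareOnSmallSets (gibbs f) (2 * C) μ) (hT : 0 < T) (hTC : T ≤ C / 2)
    (hA : ∀ j, MeasurableSet (A j)) (hpos : ∀ j, gibbs f (A j) ≠ 0)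
    (hdisj : Pairwise fun i j => Disjoint (A i) (A j)) (hcover : ⋃ j, A j = B)
    (hesc : ∀ x ∈ B, (P T x).real Bᶜ ≤ T / (1000 * C))
    (heig : ((3 / 4 : ℝ) : EReal) *
        (chainEigenvalue (P T) (gibbs f) (n + 1) - ((T / (6 * C) : ℝ) : EReal)) ≤
      chainEigenvalue (restrictKernel (P T) hB) (ProbabilityTheory.cond (gibbs f) B) (n + 1)) :
    ∃ 𝒥 : Finpartition (Finset.univ : Finset (Fin m)), 𝒥.parts.card ≤ n ∧
      IsClustering (projMatrix (restrictKernel (P T) hB) (ProbabilityTheory.cond (gibbs f) B) A)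
        (fun j => (ProbabilityTheory.cond (gibbs f) B).real (A j)) 𝒥.parts
        (1 / 4000 * (T ^ 2 / (C ^ 2 * (min n m : ℝ) ^ 8))) (1 / 500 * (T / C)) ∧
      ∀ J ∈ 𝒥.parts, μ / 2 ≤ (gibbs f).real (⋃ j ∈ J, A j) := by
  rcases isEmpty_or_nonempty (Fin m) with hm | ⟨⟨j₀⟩⟩
  · have huniv : (Finset.univ : Finset (Fin m)) = ⊥ := by simp
    rw [huniv]
    exact ⟨⊥, by simp, ⟨by simp, by simp⟩, by simp⟩
  have hPT := (hP T hT).1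
  have hAB : ∀ j, A j ⊆ B := fun j => hcover ▸ Set.subset_iUnion A j
  have hB0 : gibbs f B ≠ 0 := fun h => hpos j₀ (measure_mono_null (hAB j₀) h)
  have hprob : IsProbabilityMeasure (ProbabilityTheory.cond (gibbs f) B) :=
    cond_isProbabilityMeasure hB0
  set ν := ProbabilityTheory.cond (gibbs f) B with hν
  set κ := restrictKernel (P T) hB with hκ
  set b := ((gibbs f B)⁻¹).toReal with hb
  have hb0 : 0 < b := ENNReal.toReal_pos (ENNReal.inv_ne_zero.2 (measure_ne_top _ _))
    (ENNReal.inv_ne_top.2 hB0)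
  have hreal : ∀ j, ν.real (A j) = b * (gibbs f).real (A j) := fun j => by
    rw [measureReal_def, hν, cond_apply hB, Set.inter_eq_right.2 (hAB j), ENNReal.toReal_mul]
    rfl
  have hπ : ∀ j, 0 < ν.real (A j) := fun j => by
    rw [hreal]
    exact mul_pos hb0 (ENNReal.toReal_pos (hpos j) (measure_ne_top _ _))
  have hrev : Kernel.IsReversible κ ν :=
    isReversible_restrictKernel (P T) hB (hP.representsSemigroup hT).isReversible
  have hae : ∀ᵐ x ∂ν, x ∈ ⋃ j, A j := by
    rw [hcover]
    exact ae_cond_mem hB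
  have hx : 0 < T / C := div_pos hT hC
  have hx2 : T / C ≤ 1 / 2 := by
    rw [div_le_iff₀ hC]
    linarith
  set k := min n m with hk
  -- The choice σk² = T/(500C) fixes the outer conductance, and k + 1 ≤ 2k² bounds the exclusion
  -- level σ(k+1). For k = 0 only the latter is needed, because no part can exist.
  obtain ⟨σ, hσ, hσk, hσk1⟩ : ∃ σ : ℝ, 0 < σ ∧ (1 ≤ k → σ * k ^ 2 = T / C / 500) ∧
      σ * (k + 1) ≤ T / C / 250 := by
    rcases Nat.eq_zero_or_pos k with h0 | h1
    · refine ⟨T / C / 500, by positivity, fun h => by omega, ?_⟩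
      rw [h0, Nat.cast_zero]
      linarith
    · have h1' : (1 : ℝ) ≤ k := by exact_mod_cast h1
      have e : T / C / 500 / (k : ℝ) ^ 2 * (k : ℝ) ^ 2 = T / C / 500 :=
        div_mul_cancel₀ _ (by positivity)
      refine ⟨T / C / 500 / (k : ℝ) ^ 2, by positivity, fun _ => e, ?_⟩
      have h2 : 0 < T / C / 500 / (k : ℝ) ^ 2 := by positivity
      have h3 := mul_le_mul_of_nonneg_left (show (k : ℝ) + 1 ≤ 2 * k ^ 2 by nlinarith) h2.le
      linarith
  obtain ⟨𝒥, hcard, h𝒥⟩ := exists_finpartition_expanders (w := cellFlow κ ν A)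
    (π := fun j => ν.real (A j)) cellFlow_nonneg (cellFlow_comm hrev hA) hπ hσ k (by
      intro S hS
      rcases le_or_gt m n with hmn | hmn
      · rw [min_eq_right hmn] at hk
        exact not_isSparseFamily_of_card_lt (by rw [Fintype.card_fin]; omega) S hS
      · rw [min_eq_left hmn.le] at hk
        -- A sparse family would give an eigenvalue at most 2σ(n+1) ≤ T/(125C), below 3T/(8C).
        have h1 := chainEigenvalue_le_of_isSparseFamily hrev hA hdisj hae hπ hS
        rw [hk] at h1
        have h2 := (le_restricted_eigenvalue hB hP hC hgen hT hTC heig).trans h1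
        rw [EReal.coe_le_coe_iff] at h2
        rw [hk] at hσk1
        linarith)
  have hM := mul_projMatrix (κ := κ) (ν := ν) hπ
  have hk1 : ∀ J ∈ 𝒥.parts, 1 ≤ k := fun J hJ =>
    (Finset.card_pos.2 ⟨J, hJ⟩).trans_le hcard
  refine ⟨𝒥, hcard.trans (min_le_left _ _), ⟨𝒥.disjoint, fun J hJ => ⟨?_, ?_⟩⟩, fun J hJ => ?_⟩
  · refine le_cheeger_restrictMatrix hπ hM fun S hSJ hS hhalf => ?_
    have h1 : (1 : ℝ) ≤ k := by exact_mod_cast hk1 J hJ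
    have e : T ^ 2 / (C ^ 2 * (min n m : ℝ) ^ 8) = (T / C) ^ 2 / (k : ℝ) ^ 8 := by
      rw [hk, Nat.cast_min, div_pow, div_div]
    rw [e]
    exact inner_constant_mul_le hx (by linarith) h1 (hσk (hk1 J hJ)) (mass_nonneg hπ S)
      ((h𝒥 J hJ).2 S hSJ hS hhalf)
  · rw [conductance_eq_flow hM, div_le_iff₀ (mass_pos hπ (𝒥.nonempty_of_mem_parts hJ))]
    have h1 := (h𝒥 J hJ).1
    rw [hσk (hk1 J hJ)] at h1
    linarith
  · refine measure_ge_of_flow_le hP hC hμ hpoin hT hTC hA hpos hdisj hcover hesc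
      (𝒥.nonempty_of_mem_parts hJ) ?_
    have h1 := (h𝒥 J hJ).1
    rw [hσk (hk1 J hJ)] at h1
    -- Flow and mass for the restricted chain are both 1/p(B) times those of P_T, so the conductance
    -- bound carries over to P_T.
    have e1 : flow (cellFlow κ ν A) J Jᶜ = b * flow (cellFlow (P T) (gibbs f) A) J Jᶜ := by
      simp only [flow, Finset.mul_sum]
      refine Finset.sum_congr rfl fun i hi => Finset.sum_congr rfl fun j hj => ?_
      exact cellFlow_restrictKernel (P T) hB hA hdisj hAB
        fun hij => Finset.mem_compl.1 hj (hij ▸ hi)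
    have e2 : mass (fun j => ν.real (A j)) J =
        b * mass (fun j => (gibbs f).real (A j)) J := by
      simp only [mass, Finset.mul_sum, hreal]
    have e3 : T / (500 * C) = T / C / 500 := by
      rw [div_div, mul_comm]
    rw [e1, e2, mul_left_comm] at h1
    rw [e3]
    exact le_of_mul_le_mul_left h1 hb0

end Assembly

end LangevinCluster

end

theorem lemma6p6 :
    ∃ c : ℝ, 0 < c ∧ ∃ K : ℝ, 0 < K ∧
      ∀ (d n m : ℕ) (f : LangevinCluster.Space d → ℝ) (C μ T : ℝ)
        (P : ℝ → Kernel (LangevinCluster.Space d) (LangevinCluster.Space d))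
        (B : Set (LangevinCluster.Space d)) (hB : MeasurableSet B)
        (A : Fin m → Set (LangevinCluster.Space d)),
        -- the Langevin chain on `f`, with stationary distribution `gibbs f`
        ContDiff ℝ 1 f →
        Integrable (fun x => Real.exp (-f x)) →
        LangevinCluster.IsLangevinChain f P →
        -- spectral assumption and Poincaré inequality on small sets
        0 < C → μ ≤ 1 →
        ((1 / C : ℝ) : EReal) ≤ LangevinCluster.generatorEigenvalue f (n + 1) →
        LangevinCluster.PoincareOnSmallSets (LangevinCluster.gibbs f) (2 * C) μ →
        0 < T → T ≤ C / 2 →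
        -- `A` is a partition of `B` into measurable cells of positive measure
        (∀ j, MeasurableSet (A j)) →
        (∀ j, LangevinCluster.gibbs f (A j) ≠ 0) →
        Pairwise (fun i j => Disjoint (A i) (A j)) →
        ⋃ j, A j = B →
        -- escape condition
        (∀ x ∈ B, (P T x).real Bᶜ ≤ T / (1000 * C)) →
        -- eigenvalue condition
        ((3 / 4 : ℝ) : EReal) *
            (LangevinCluster.chainEigenvalue (P T) (LangevinCluster.gibbs f) (n + 1)
              - ((T / (6 * C) : ℝ) : EReal))
          ≤ LangevinCluster.chainEigenvalue (LangevinCluster.restrictKernel (P T) hB)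
              (cond (LangevinCluster.gibbs f) B) (n + 1) →
        ∃ 𝒥 : Finpartition (Finset.univ : Finset (Fin m)),
          𝒥.parts.card ≤ n ∧
          LangevinCluster.IsClustering
            (LangevinCluster.projMatrix (LangevinCluster.restrictKernel (P T) hB)
              (cond (LangevinCluster.gibbs f) B) A)
            (fun j => (cond (LangevinCluster.gibbs f) B).real (A j))
            𝒥.parts
            (c * (T ^ 2 / (C ^ 2 * (min n m : ℝ) ^ 8)))
            (K * (T / C)) ∧
          ∀ J ∈ 𝒥.parts, μ / 2 ≤ (LangevinCluster.gibbs f).real (⋃ j ∈ J, A j) := by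
  refine ⟨1 / 4000, by norm_num, 1 / 500, by norm_num, ?_⟩
  intro d n m f C μ T P B hB A _ hf hP hC hμ hgen hpoin hT hTC hA hpos hdisj hcover hesc heig
  have := LangevinCluster.isProbabilityMeasure_gibbs hf
  exact LangevinCluster.exists_clustering hB hP hC hμ hgen hpoin hT hTC hA hpos hdisj hcover
    hesc heig
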